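/- **Setting.** Let $d\in\{2,3\}$, $k\ge 1$, let $\Omega\subset\mathbb R^d$ be a bounded polygonal/polyhedral domain, $\vec b\in C^1(\bar\Omega)^d$ (i.e. $C^1$ in a neighbourhood of $\bar\Omega$), $c\in C(\bar\Omega)$, $c_0>0$ with $c-\frac12\nabla\cdot\vec b\ge c_0$ in $\Omega$, and let $\varepsilon>0$. Let $\tau_h$ be a partition of $\Omega$ into finitely many polygonal/polyhedral elements $T$ (matching along edges/faces), $h_T=\operatorname{diam}T$, $h_e=\operatorname{diam}e$, $h=\max_T h_T$, such that for some fixed $\rho>0$: (Z1) $h_e\ge\rho h_T$ for every edge/face $e\subset\partial T$; (Z2) every $T$ is star-shaped with respect to all points of a ball of radius $\ge\rho h_T$; (Z3) for $d=3$, every face $e$ is star-shaped with respect to all points of a disk of radius $\ge\rho h_e$. **Spaces.** $\mathbb P^m=\{0\}$ for $m<0$. $V_h^k(T)=\{v\in H^1(T):\ \partial v/\partial\mathbf n\in\mathbb P^{k-1}(e)\ \forall e\subset\partial T,\ \Delta v\in\mathbb P^{k-2}(T)\}$, and $V_h^k$ is the space of $v$ with $v|_T\in V_h^k(T)$ for all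 $T$ whose jumps across interior edges/faces, and whose traces on boundary edges/faces, have vanishing moments against $\mathbb P^{k-1}(e)$. $\Pi_m$ is the $L^2(T)$-projection onto $\mathbb P^m(T)$ (componentwise on vector fields). **Forms.** For each $T$ let $\delta_T>0$, let $s_a,s_c,s^{sym},s_b$ be symmetric bilinear forms on $V_h^k(T)$, and let $v^\perp=(I-\Pi_k)v$. Put $a^T(u,v)=\int_T\varepsilon\nabla u\cdot\nabla v$, $c^T(u,v)=\int_T c\,uv$, $b^{T,sym}(u,v)=\frac12\int_T(\nabla\cdot\vec b)uv$, $G^T(u,v)=\int_T\delta_T(\vec b\cdot\nabla u)(\vec b\cdot\nabla v)$, and $$a_h^T(u,v)=\int_T\varepsilon\,\Pi_{k-1}\nabla u\cdot\Pi_{k-1}\nabla v+s_a(u^\perp,v^\perp),\qquad c_h^T(u,v)=\int_T c\,\Pi_ku\,\Pi_kv+s_c(u^\perp,v^\perp),$$ $$b_h^{T,sym}(u,v)=\tfrac12\int_T(\nabla\cdot\vec b)\Pi_ku\,\Pi_kv+s^{sym}(u^\perp,v^\perp),\qquad b_h^{T,skew}(u,v)=\tfrac12\Big[\int_T\vec b\cdot\Pi_{k-1}(\nabla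 u)\,\Pi_kv-\int_T\vec b\cdot\Pi_{k-1}(\nabla v)\,\Pi_ku\Big],$$ $$G_h^T(u,v)=\int_T\delta_T\,\vec b\cdot\Pi_{k-1}(\nabla u)\ \vec b\cdot\Pi_{k-1}(\nabla v)+s_b(u^\perp,v^\perp),$$ $$b_h^{T,stab}(u,v)=\int_T(-\varepsilon\,\Pi_{k-2}(\Delta u)+c\,\Pi_ku)\,\delta_T\,\vec b\cdot\Pi_{k-1}(\nabla v)+G_h^T(u,v),$$ $$A_h^T=a_h^T-b_h^{T,sym}+b_h^{T,skew}+c_h^T+b_h^{T,stab}.$$ **Assumptions.** There are positive constants $\alpha_*,\alpha^*,\gamma_*,\gamma^*,\Gamma_*,\Gamma^*,s_*,s^*$ with, for all $T$ and $v\in V_h^k(T)$: $\alpha_*a^T(v,v)\le a_h^T(v,v)\le\alpha^*a^T(v,v)$, $\gamma_*c^T(v,v)\le c_h^T(v,v)\le\gamma^*c^T(v,v)$, $\Gamma_*G^T(v,v)\le G_h^T(v,v)\le\Gamma^*G^T(v,v)$, $s_*b^{T,sym}(v,v)\le b_h^{T,sym}(v,v)\le s^*b^{T,sym}(v,v)$.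 Moreover, with given positive constants $\mu_1,\mu_2,c_I$ (for instance those of the inverse inequalities $\|\Delta v\|_{0,T}\le\mu_1h_T^{-1}|v|_{1,T}$, $|v|_{1,T}\le\mu_2h_T^{-1}\|v\|_{0,T}$ on $V_h^k(T)$ and of the polynomial approximation estimate), $c_{\max}=\sup_\Omega|c|$ and $\|\vec b\|_{0,\infty}=\sup_\Omega|\vec b|$, $$0<\delta_T\le\min\Big\{\frac{c_0\min\{s^*,\gamma_*\}}{4c_{\max}^2},\ \frac{h_T^2\alpha_*}{2\varepsilon\mu_1^2},\ \min\{1,\tfrac1{c_I}\}\frac{c_0\min\{s^*,\gamma_*\}h_T^2}{4\|\vec b\|_{0,\infty}^2\mu_2^2}\Big\}$$ (a bound with zero denominator being void). **Statement.** 1. There is a constant $C_\Pi=C_\Pi(d,k,\rho)>0$ such that for every such $\Omega$, $\tau_h$, every $T\in\tau_h$ and every $u\in H^{k+1}(T)$ there is $u_\Pi\in\mathbb P^k(T)$ with $$\|u-u_\Pi\|_{0,T}+h_T|u-u_\Pi|_{1,T}\le C_\Pi h_T^{k+1}|u|_{k+1,T}.\qquad(*)$$ 2. For every $C_\Pi>0$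 there is $C>0$, depending only on $d,k,\rho,\Omega,\vec b,c,c_0$, the stability constants, $\mu_1,\mu_2,c_I$ and $C_\Pi$ (hence not on $\varepsilon$, $\tau_h$, $\delta_T$, the stabilization forms, $u$ or $u_h$), such that the following holds. Let $u$ satisfy $u|_T\in H^{k+1}(T)$ for all $T$, let $u_I\in V_h^k$ be the interpolant of $u$, i.e. $u_I$ and $u$ have the same moments against $\mathbb P^{k-1}(e)$ on every edge/face $e$ and against $\mathbb P^{k-2}(T)$ on every $T$, let $u_\Pi|_T\in\mathbb P^k(T)$ satisfy $(*)$ for all $T$, let $u_h\in V_h^k$ and $\delta=u_h-u_I$. Then $$\Big|\sum_TA_h^T(u_I-u_\Pi,\delta)\Big|\le C\,h^k\Big(\sum_T\zeta_T\,|u|_{k+1,T}^2\Big)^{1/2}|||\delta|||,$$ where $\zeta_T=1+\varepsilon+\delta_T+h_T^2+\frac{h_T^2}{\varepsilon}+\delta_T^2\frac{h_T^2}{\varepsilon}$ and $|||v|||^2=\sum_T\{\varepsilon|v|_{1,T}^2+c_0\|v\|_{0,T}^2+\delta_T\|\vec b\cdot\nabla v\|_{0,T}^2\}$. -/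

import Mathlib

open MeasureTheory Filter Topology
open scoped ContDiff

noncomputable section

namespace NCVEM

/-- The Euclidean space `ℝ^d`. -/
abbrev E (d : ℕ) : Type := EuclideanSpace ℝ (Fin d)

variable {d : ℕ}

/-! ### Weak derivatives and Sobolev spaces -/

/-- The classical partial derivative `∂_i φ`. -/
def pd (i : Fin d) (φ : E d → ℝ) : E d → ℝ :=
  fun x => fderiv ℝ φ x (EuclideanSpace.single i 1)

/-- The iterated partial derivative `∂_{i₁} ⋯ ∂_{iₘ} φ` for the list `[i₁, …, iₘ]`. -/
def pds : List (Fin d) → (E d → ℝ) → E d → ℝ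
  | [], φ => φ
  | i :: L, φ => pd i (pds L φ)

/-- Test functions: smooth, with compact support contained in `T`. -/
def IsTest (T : Set (E d)) (φ : E d → ℝ) : Prop :=
  ContDiff ℝ ∞ φ ∧ HasCompactSupport φ ∧ tsupport φ ⊆ T

/-- `g` is the weak derivative `∂_{i₁} ⋯ ∂_{iₘ} v` on the open set `T`, for the list
`L = [i₁, …, iₘ]`. -/
def HasWeakDeriv (T : Set (E d)) (L : List (Fin d)) (v g : E d → ℝ) : Prop :=
  ∀ φ, IsTest T φ →
    ∫ x in T, v x * pds L φ x = (-1) ^ L.length * ∫ x in T, g x * φ x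

/-- `g` is the weak (distributional) Laplacian of `v` on the open set `T`. -/
def HasWeakLap (T : Set (E d)) (v g : E d → ℝ) : Prop :=
  ∀ φ, IsTest T φ →
    ∫ x in T, v x * (∑ i, pds [i, i] φ x) = ∫ x in T, g x * φ x

/-- Membership of (the restriction to `T` of) `v` in `L²(T)`. -/
def MemL2 (T : Set (E d)) (v : E d → ℝ) : Prop := MemLp v 2 (volume.restrict T)

/-- Membership of (the restriction to `T` of) `v` in the Sobolev space `H^m(T)`. -/
def MemH (m : ℕ) (T : Set (E d)) (v : E d → ℝ) : Prop :=
  MemL2 T v ∧ ∀ L : List (Fin d), L.length ≤ m → ∃ g, MemL2 T g ∧ HasWeakDeriv T L v g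

open scoped Classical in
/-- The square-integrable weak derivative of `v` on `T` along the list `L` (determined up to a
null set; `0` if there is none). -/
def wderiv (T : Set (E d)) (L : List (Fin d)) (v : E d → ℝ) : E d → ℝ :=
  if h : ∃ g, MemL2 T g ∧ HasWeakDeriv T L v g then h.choose else 0

open scoped Classical in
/-- The square-integrable weak Laplacian of `v` on `T` (`0` if there is none). -/
def wlap (T : Set (E d)) (v : E d → ℝ) : E d → ℝ :=
  if h : ∃ g, MemL2 T g ∧ HasWeakLap T v g then h.choose else 0

/-- The weak gradient of `v` on `T`. -/
def wgrad (T : Set (E d)) (v : E d → ℝ) (x : E d) : E d :=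
  WithLp.toLp 2 (fun i => wderiv T [i] v x)

/-- `‖v‖_{0,T}`. -/
def norm0 (T : Set (E d)) (v : E d → ℝ) : ℝ := √(∫ x in T, v x ^ 2)

/-- `|v|_{1,T} = ‖∇v‖_{0,T}`. -/
def semi1 (T : Set (E d)) (v : E d → ℝ) : ℝ := √(∫ x in T, ‖wgrad T v x‖ ^ 2)

/-- `|v|_{m,T}`, the `L²(T)` norm of the Frobenius norm of the tensor of the weak derivatives of
order `m`. -/
def semiH (m : ℕ) (T : Set (E d)) (v : E d → ℝ) : ℝ :=
  √(∑ I : Fin m → Fin d, ∫ x in T, wderiv T (List.ofFn I) v x ^ 2)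

/-- The space of polynomial functions of total degree at most `m`; it is `{0}` for `m < 0`. -/
def Poly (d : ℕ) (m : ℤ) : Set (E d → ℝ) :=
  {f | ∃ p : MvPolynomial (Fin d) ℝ, (p = 0 ∨ (p.totalDegree : ℤ) ≤ m) ∧
    ∀ x, f x = MvPolynomial.eval (fun i => x i) p}

open scoped Classical in
/-- The `L²(T)`-orthogonal projection of `v` onto the polynomials of degree at most `m`. -/
def proj (T : Set (E d)) (m : ℤ) (v : E d → ℝ) : E d → ℝ :=
  if h : ∃ p ∈ Poly d m, ∀ q ∈ Poly d m, ∫ x in T, (v x - p x) * q x = 0 then h.choose else 0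

/-- The componentwise `L²(T)`-orthogonal projection of the weak gradient of `v`. -/
def projGrad (T : Set (E d)) (m : ℤ) (v : E d → ℝ) (x : E d) : E d :=
  WithLp.toLp 2 (fun i => proj T m (wderiv T [i] v) x)

/-! ### Polytopal domains and meshes -/

/-- A flat `(d-1)`-dimensional polytope: a connected finite union of nondegenerate
`(d-1)`-simplices in one hyperplane (a segment for `d = 2`, a planar polygon for `d = 3`). -/
def IsFlatPolytope (e : Set (E d)) : Prop :=
  IsConnected e ∧ Module.finrank ℝ (vectorSpan ℝ e) + 1 = d ∧
    ∃ S : Finset (Fin d → E d), (∀ p ∈ S, AffineIndependent ℝ p) ∧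
      e = ⋃ p ∈ S, convexHull ℝ (Set.range p)

/-- Bounded polygonal (`d = 2`) or polyhedral (`d = 3`) domains. -/
def IsPolytopalDomain (Ω : Set (E d)) : Prop :=
  IsOpen Ω ∧ IsConnected Ω ∧ Bornology.IsBounded Ω ∧
    ∃ S : Finset (Set (E d)), (∀ e ∈ S, IsFlatPolytope e) ∧ frontier Ω = ⋃ e ∈ S, e

/-- The surface measure in `ℝ^d`: the `(d-1)`-dimensional Hausdorff measure. -/
def surf (d : ℕ) : Measure (E d) := Measure.euclideanHausdorffMeasure (d - 1)

/-- A partition of `Ω` into polytopal elements. The edges (faces) are shared by the adjacent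
elements: the boundary of each element is the union of the edges (faces) contained in it, and
different edges (faces) meet in sets of measure zero only. -/
structure Mesh (Ω : Set (E d)) where
  elems : Finset (Set (E d))
  faces : Finset (Set (E d))
  isOpen : ∀ T ∈ elems, IsOpen T
  isConnected : ∀ T ∈ elems, IsConnected T
  subset : ∀ T ∈ elems, T ⊆ Ω
  cover : closure Ω = ⋃ T ∈ elems, closure T
  disjoint : ∀ T ∈ elems, ∀ T' ∈ elems, T ≠ T' → Disjoint T T'
  flat : ∀ e ∈ faces, IsFlatPolytope e
  overlap : ∀ e ∈ faces, ∀ e' ∈ faces, e ≠ e' → surf d (e ∩ e') = 0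
  face_of_elem : ∀ e ∈ faces, ∃ T ∈ elems, e ⊆ frontier T
  frontier_eq : ∀ T ∈ elems, frontier T = ⋃ e ∈ {e : Set (E d) | e ∈ faces ∧ e ⊆ frontier T}, e

open scoped Classical in
/-- The edges (faces) of the element `T`. -/
def Mesh.facesOf {Ω : Set (E d)} (M : Mesh Ω) (T : Set (E d)) : Finset (Set (E d)) :=
  {e ∈ M.faces | e ⊆ frontier T}

/-- The mesh size `h`, the largest diameter of an element. -/
def Mesh.size {Ω : Set (E d)} (M : Mesh Ω) : ℝ :=
  sSup (Metric.diam '' (M.elems : Set (Set (E d))))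

/-- Shape regularity of the mesh with parameter `ρ`. -/
structure Mesh.ShapeRegular {Ω : Set (E d)} (M : Mesh Ω) (ρ : ℝ) : Prop where
  z1 : ∀ T ∈ M.elems, ∀ e ∈ M.facesOf T, ρ * Metric.diam T ≤ Metric.diam e
  z2 : ∀ T ∈ M.elems, ∃ (x : E d) (r : ℝ), ρ * Metric.diam T ≤ r ∧
    ∀ y ∈ Metric.ball x r, StarConvex ℝ y T
  z3 : d = 3 → ∀ e ∈ M.faces, ∃ x ∈ affineSpan ℝ e, ∃ r : ℝ, ρ * Metric.diam e ≤ r ∧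
    ∀ y ∈ Metric.ball x r, y ∈ affineSpan ℝ e → StarConvex ℝ y e

/-! ### Traces and the nonconforming virtual element space -/

/-- `g` is the trace on `∂T` of `v ∈ H¹(T)`: both are limits, in `H¹(T)` and in `L²(∂T)`, of one
sequence of smooth functions and of its restrictions to `∂T`. -/
def HasTrace (T : Set (E d)) (v g : E d → ℝ) : Prop :=
  MemLp g 2 ((surf d).restrict (frontier T)) ∧
  ∃ φ : ℕ → E d → ℝ, (∀ n, ContDiff ℝ ∞ (φ n)) ∧
    Tendsto (fun n => ∫ x in T, (φ n x - v x) ^ 2) atTop (𝓝 0) ∧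
    Tendsto (fun n => ∫ x in T, ‖gradient (φ n) x - wgrad T v x‖ ^ 2) atTop (𝓝 0) ∧
    Tendsto (fun n => ∫ x in frontier T, (φ n x - g x) ^ 2 ∂(surf d)) atTop (𝓝 0)

/-- The local virtual element space of order `k` on an element `T` with edges (faces) `F`:
functions in `H¹(T)` with `Δv = r ∈ ℙ^{k-2}(T)` and with normal derivative `q_e ∈ ℙ^{k-1}(e)` on
each `e ∈ F`, in the sense of Green's formula
`∫_T ∇v·∇w + ∫_T (Δv) w = ∑_e ∫_e (∂v/∂n) w` for all smooth `w`. -/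
def MemVLoc (k : ℕ) (T : Set (E d)) (F : Finset (Set (E d))) (v : E d → ℝ) : Prop :=
  MemH 1 T v ∧
  ∃ r ∈ Poly d ((k : ℤ) - 2), ∃ q : Set (E d) → E d → ℝ,
    (∀ e ∈ F, q e ∈ Poly d ((k : ℤ) - 1)) ∧
    ∀ w : E d → ℝ, ContDiff ℝ ∞ w →
      (∫ x in T, inner ℝ (wgrad T v x) (gradient w x)) + (∫ x in T, r x * w x)
        = ∑ e ∈ F, ∫ x in e, q e x * w x ∂(surf d)

/-- The space `H^{1,nc}(τ_h; k)`: piecewise `H¹` functions whose jumps have vanishing moments up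
to order `k-1` on all edges (faces), the jump on a boundary edge (face) being the trace. -/
def MemH1nc {Ω : Set (E d)} (M : Mesh Ω) (k : ℕ) (v : E d → ℝ) : Prop :=
  (∀ T ∈ M.elems, MemH 1 T v) ∧
  ∃ g : Set (E d) → E d → ℝ, (∀ T ∈ M.elems, HasTrace T v (g T)) ∧
    (∀ T ∈ M.elems, ∀ T' ∈ M.elems, T ≠ T' → ∀ e ∈ M.faces, e ⊆ frontier T → e ⊆ frontier T' →
      ∀ q ∈ Poly d ((k : ℤ) - 1), ∫ x in e, (g T x - g T' x) * q x ∂(surf d) = 0) ∧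
    (∀ T ∈ M.elems, ∀ e ∈ M.faces, e ⊆ frontier T → e ⊆ frontier Ω →
      ∀ q ∈ Poly d ((k : ℤ) - 1), ∫ x in e, g T x * q x ∂(surf d) = 0)

/-- The global nonconforming virtual element space `V_h^k`. -/
def MemV {Ω : Set (E d)} (M : Mesh Ω) (k : ℕ) (v : E d → ℝ) : Prop :=
  MemH1nc M k v ∧ ∀ T ∈ M.elems, MemVLoc k T (M.facesOf T) v

/-- `uI` is the virtual element interpolant of `u`: the element of `V_h^k` with the same degrees
of freedom, which are the moments up to order `k-1` on the edges (faces) and the moments up to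
order `k-2` on the elements. -/
def IsInterpolant {Ω : Set (E d)} (M : Mesh Ω) (k : ℕ) (u uI : E d → ℝ) : Prop :=
  MemV M k uI ∧ ∀ T ∈ M.elems,
    (∃ g gI, HasTrace T u g ∧ HasTrace T uI gI ∧
      ∀ e ∈ M.facesOf T, ∀ q ∈ Poly d ((k : ℤ) - 1),
        ∫ x in e, gI x * q x ∂(surf d) = ∫ x in e, g x * q x ∂(surf d)) ∧
    ∀ q ∈ Poly d ((k : ℤ) - 2), ∫ x in T, uI x * q x = ∫ x in T, u x * q x

/-- `p` is a local polynomial approximation of `u ∈ H^{k+1}(T)`, with constant `C`. -/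
def IsLocalApprox (k : ℕ) (T : Set (E d)) (C : ℝ) (u p : E d → ℝ) : Prop :=
  p ∈ Poly d (k : ℤ) ∧
    norm0 T (fun x => u x - p x) + Metric.diam T * semi1 T (fun x => u x - p x)
      ≤ C * Metric.diam T ^ (k + 1) * semiH (k + 1) T u

/-! ### The bilinear forms -/

/-- The divergence of a differentiable vector field. -/
def divergence (b : E d → E d) (x : E d) : ℝ :=
  ∑ i, fderiv ℝ b x (EuclideanSpace.single i 1) i

/-- The symmetric stabilization forms `s_a`, `s_c`, `s^{sym}`, `s_b^{stab}` of one element. They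
are arbitrary symmetric bilinear forms, given on all functions; only their values on the local
virtual element space matter. -/
structure StabForms (d : ℕ) where
  sa : (E d → ℝ) →ₗ[ℝ] (E d → ℝ) →ₗ[ℝ] ℝ
  sc : (E d → ℝ) →ₗ[ℝ] (E d → ℝ) →ₗ[ℝ] ℝ
  ssym : (E d → ℝ) →ₗ[ℝ] (E d → ℝ) →ₗ[ℝ] ℝ
  sb : (E d → ℝ) →ₗ[ℝ] (E d → ℝ) →ₗ[ℝ] ℝ
  sa_symm : ∀ v w, sa v w = sa w v
  sc_symm : ∀ v w, sc v w = sc w v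
  ssym_symm : ∀ v w, ssym v w = ssym w v
  sb_symm : ∀ v w, sb v w = sb w v

/-- `(I - Π_k) v` on the element `T`. -/
def compl (k : ℕ) (T : Set (E d)) (v : E d → ℝ) : E d → ℝ := fun x => v x - proj T k v x

/-- `a^T(u,v)`. -/
def formA (ε : ℝ) (T : Set (E d)) (u v : E d → ℝ) : ℝ :=
  ∫ x in T, ε * inner ℝ (wgrad T u x) (wgrad T v x)

/-- `c^T(u,v)`. -/
def formC (c : E d → ℝ) (T : Set (E d)) (u v : E d → ℝ) : ℝ :=
  ∫ x in T, c x * u x * v x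

/-- `b^{T,sym}(u,v)`. -/
def formBsym (b : E d → E d) (T : Set (E d)) (u v : E d → ℝ) : ℝ :=
  1 / 2 * ∫ x in T, divergence b x * u x * v x

/-- `G^T(u,v)`. -/
def formG (b : E d → E d) (δT : ℝ) (T : Set (E d)) (u v : E d → ℝ) : ℝ :=
  ∫ x in T, δT * inner ℝ (b x) (wgrad T u x) * inner ℝ (b x) (wgrad T v x)

/-- `a_h^T(u,v)`. -/
def formAh (k : ℕ) (ε : ℝ) (T : Set (E d)) (s : StabForms d) (u v : E d → ℝ) : ℝ :=
  (∫ x in T, ε * inner ℝ (projGrad T ((k : ℤ) - 1) u x) (projGrad T ((k : ℤ) - 1) v x))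
    + s.sa (compl k T u) (compl k T v)

/-- `c_h^T(u,v)`. -/
def formCh (k : ℕ) (c : E d → ℝ) (T : Set (E d)) (s : StabForms d) (u v : E d → ℝ) : ℝ :=
  (∫ x in T, c x * proj T k u x * proj T k v x) + s.sc (compl k T u) (compl k T v)

/-- `b_h^{T,sym}(u,v)`. -/
def formBsymh (k : ℕ) (b : E d → E d) (T : Set (E d)) (s : StabForms d) (u v : E d → ℝ) : ℝ :=
  1 / 2 * (∫ x in T, divergence b x * proj T k u x * proj T k v x)
    + s.ssym (compl k T u) (compl k T v)

/-- `b_h^{T,skew}(u,v)`. -/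
def formBskewh (k : ℕ) (b : E d → E d) (T : Set (E d)) (u v : E d → ℝ) : ℝ :=
  1 / 2 * ((∫ x in T, inner ℝ (b x) (projGrad T ((k : ℤ) - 1) u x) * proj T k v x)
    - ∫ x in T, inner ℝ (b x) (projGrad T ((k : ℤ) - 1) v x) * proj T k u x)

/-- `G_h^T(u,v)`. -/
def formGh (k : ℕ) (b : E d → E d) (δT : ℝ) (T : Set (E d)) (s : StabForms d)
    (u v : E d → ℝ) : ℝ :=
  (∫ x in T, δT * inner ℝ (b x) (projGrad T ((k : ℤ) - 1) u x)
      * inner ℝ (b x) (projGrad T ((k : ℤ) - 1) v x))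
    + s.sb (compl k T u) (compl k T v)

/-- `b_h^{T,stab}(u,v)`, the streamline-diffusion term. -/
def formBstabh (k : ℕ) (ε : ℝ) (b : E d → E d) (c : E d → ℝ) (δT : ℝ) (T : Set (E d))
    (s : StabForms d) (u v : E d → ℝ) : ℝ :=
  (∫ x in T, (-ε * proj T ((k : ℤ) - 2) (wlap T u) x + c x * proj T k u x)
      * (δT * inner ℝ (b x) (projGrad T ((k : ℤ) - 1) v x)))
    + formGh k b δT T s u v

/-- The discrete local bilinear form `A_h^T(u,v)`. -/
def formDisc (k : ℕ) (ε : ℝ) (b : E d → E d) (c : E d → ℝ) (δT : ℝ) (T : Set (E d))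
    (s : StabForms d) (u v : E d → ℝ) : ℝ :=
  formAh k ε T s u v + (-formBsymh k b T s u v + formBskewh k b T u v)
    + formCh k c T s u v + formBstabh k ε b c δT T s u v

/-- The constants `α_*, α^*, γ_*, γ^*, Γ_*, Γ^*, s_*, s^*` of the local stability bounds. -/
structure StabConst where
  αlo : ℝ
  αup : ℝ
  γlo : ℝ
  γup : ℝ
  Γlo : ℝ
  Γup : ℝ
  slo : ℝ
  sup : ℝ
  αlo_pos : 0 < αlo
  αup_pos : 0 < αup
  γlo_pos : 0 < γlo
  γup_pos : 0 < γup
  Γlo_pos : 0 < Γlo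
  Γup_pos : 0 < Γup
  slo_pos : 0 < slo
  sup_pos : 0 < sup

/-- The local stability bounds on the element `T` with edges (faces) `F`. -/
def IsStable (K : StabConst) (k : ℕ) (ε : ℝ) (b : E d → E d) (c : E d → ℝ) (δT : ℝ)
    (T : Set (E d)) (F : Finset (Set (E d))) (s : StabForms d) : Prop :=
  ∀ v, MemVLoc k T F v →
    (K.αlo * formA ε T v v ≤ formAh k ε T s v v ∧
      formAh k ε T s v v ≤ K.αup * formA ε T v v) ∧
    (K.γlo * formC c T v v ≤ formCh k c T s v v ∧
      formCh k c T s v v ≤ K.γup * formC c T v v) ∧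
    (K.Γlo * formG b δT T v v ≤ formGh k b δT T s v v ∧
      formGh k b δT T s v v ≤ K.Γup * formG b δT T v v) ∧
    (K.slo * formBsym b T v v ≤ formBsymh k b T s v v ∧
      formBsymh k b T s v v ≤ K.sup * formBsym b T v v)

/-- The condition
`0 < δ_T ≤ min { c₀ min{s^*,γ_*} / (4 c_max²), h_T² α_* / (2 ε μ₁²),
min{1,1/c_I} c₀ min{s^*,γ_*} h_T² / (4 ‖b‖_∞² μ₂²) }` on the control parameter, where
`c_max = sup |c|` and `‖b‖_∞ = sup |b|` over the closure of `Ω`. The denominators are cleared, so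
that a bound is void if its denominator vanishes. -/
def IsControl (K : StabConst) (Ω : Set (E d)) (ε : ℝ) (b : E d → E d) (c : E d → ℝ)
    (c0 μ1 μ2 cI : ℝ) (T : Set (E d)) (δT : ℝ) : Prop :=
  0 < δT ∧
  δT * (4 * (sSup ((fun x => |c x|) '' closure Ω)) ^ 2) ≤ c0 * min K.sup K.γlo ∧
  δT * (2 * ε * μ1 ^ 2) ≤ Metric.diam T ^ 2 * K.αlo ∧
  δT * (4 * (sSup ((fun x => ‖b x‖) '' closure Ω)) ^ 2 * μ2 ^ 2)
    ≤ min 1 (1 / cI) * (c0 * min K.sup K.γlo) * Metric.diam T ^ 2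

/-- The mesh-dependent norm `|||v|||`. -/
def tripleNorm {Ω : Set (E d)} (M : Mesh Ω) (ε : ℝ) (b : E d → E d) (c0 : ℝ)
    (δ : Set (E d) → ℝ) (v : E d → ℝ) : ℝ :=
  √(∑ T ∈ M.elems, (ε * semi1 T v ^ 2 + c0 * norm0 T v ^ 2
    + δ T * norm0 T (fun x => inner ℝ (b x) (wgrad T v x)) ^ 2))

/-- The weight `ζ = 1 + ε + δ_T + h_T² + h_T²/ε + δ_T² h_T²/ε`. -/
def zeta (ε δT : ℝ) (T : Set (E d)) : ℝ :=
  1 + ε + δT + Metric.diam T ^ 2 + Metric.diam T ^ 2 / ε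
    + δT ^ 2 * (Metric.diam T ^ 2 / ε)

end NCVEM

end

open MeasureTheory Filter Topology
open scoped ContDiff

noncomputable section

namespace NCVEM

variable {d : ℕ}

/-! ### The `L²` norm of functions -/

/-! On one element `T` write e = u_I - u_Π and h = diam T. The second claim follows from two bounds
on e and a Cauchy–Schwarz estimate for each piece of the discrete form.

Geometry. A domain that is star-shaped with respect to a ball and has flat faces is, up to null
sets, the disjoint union of the cones over its faces from any apex y in the ball. Integrating a
radial field over the cones gives an identity that is affine in y; comparing two apexes gives the
divergence theorem (`IsPolyBoundary.integral_pd`) and hence Green's formula. In particular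
polynomials of degree at most k lie in the local virtual element space, and so does e.

Approximation. Star-shapedness also gives a Poincaré inequality whose constant depends on d and ρ
only (`IsStarDomain.poincare`): integrate along segments for smooth functions, then mollify and use
Fatou's lemma. Subtracting the polynomial that matches the means of all derivatives up to order k,
and iterating Poincaré, proves the first claim (`IsStarDomain.exists_localApprox`).

Interpolation. Since u and u_I share their degrees of freedom, Green's formula makes u - u_I energy
orthogonal to the local space. As e lies in that space, |e|_1 ≤ |u - u_Π|_1
(`semi1_interpolant_sub_le`). The L² norm of u - u_I follows from Poincaré once its mean is
controlled, which Green's formula for the field x - x0 does (`norm0_sub_interpolant_le`). So |e|_1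
is of order h^k and ‖e‖_0 of order h^(k+1).

Forms. The stability bounds make a_h and G_h semidefinite, so Cauchy–Schwarz applies without looking
inside the stabilization. The forms c_h and b_h^sym may be indefinite and are first shifted by a
multiple of the L² product (`IsBilinOn.norm0_bound`). In the skew part a factor |δ|_1 costs
ε^(-1/2), which the extra power of h in ‖e‖_0 compensates. The streamline part contains ε δ_T Δe;
here the inverse inequality ‖Δe‖ ≤ C |e|_1 / h (`exists_inverse_inequality`) meets the control
condition ε δ_T ≤ C h². Every piece is then at most a constant times h^k ζ^(1/2) |u|_{k+1} times the
local part of the triple norm (`formDisc_le`), and a discrete Cauchy–Schwarz inequality sums over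
the mesh (`abs_sum_le_of_local`). -/

/-- The `L²` norm of a function, as the square root of a Bochner integral. -/
def L2n {α F : Type*} [MeasurableSpace α] [NormedAddCommGroup F] (μ : Measure α) (f : α → F) : ℝ :=
  √(∫ x, ‖f x‖ ^ 2 ∂μ)

section L2
variable {α F : Type*} [MeasurableSpace α] [NormedAddCommGroup F] {μ : Measure α}

theorem L2n_nonneg (f : α → F) : 0 ≤ L2n μ f := Real.sqrt_nonneg _

theorem L2n_sq (f : α → F) : L2n μ f ^ 2 = ∫ x, ‖f x‖ ^ 2 ∂μ :=
  Real.sq_sqrt (integral_nonneg fun _ => by positivity)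

theorem L2n_eq_toReal {f : α → F} (hf : MemLp f 2 μ) : L2n μ f = (eLpNorm f 2 μ).toReal := by
  rw [hf.eLpNorm_eq_integral_rpow_norm (by norm_num) (by norm_num), ENNReal.toReal_ofReal (by positivity)]
  simp [L2n, Real.sqrt_eq_rpow]

theorem L2n_congr {f g : α → F} (h : f =ᵐ[μ] g) : L2n μ f = L2n μ g := by
  unfold L2n
  congr 1
  exact integral_congr_ae (h.mono fun x hx => by simp only [hx])

theorem L2n_add_le {f g : α → F} (hf : MemLp f 2 μ) (hg : MemLp g 2 μ) :
    L2n μ (fun x => f x + g x) ≤ L2n μ f + L2n μ g := by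
  have h := hf.add hg
  rw [L2n_eq_toReal (f := fun x => f x + g x) h, L2n_eq_toReal hf, L2n_eq_toReal hg,
    ← ENNReal.toReal_add hf.2.ne hg.2.ne]
  exact ENNReal.toReal_mono (ENNReal.add_ne_top.2 ⟨hf.2.ne, hg.2.ne⟩)
    (eLpNorm_add_le hf.1 hg.1 (by norm_num))

theorem L2n_neg (f : α → F) : L2n μ (fun x => -f x) = L2n μ f := by simp [L2n]

theorem L2n_sub_le {f g : α → F} (hf : MemLp f 2 μ) (hg : MemLp g 2 μ) :
    L2n μ (fun x => f x - g x) ≤ L2n μ f + L2n μ g := by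
  have := L2n_add_le hf hg.neg
  simp only [Pi.neg_apply, ← sub_eq_add_neg] at this
  refine this.trans (le_of_eq ?_)
  rw [← L2n_neg g]; rfl

theorem L2n_le_of_norm_le {G : Type*} [NormedAddCommGroup G] {f : α → F} {g : α → G} {C : ℝ} (hC : 0 ≤ C)
    (hg : MemLp g 2 μ) (h : ∀ᵐ x ∂μ, ‖f x‖ ≤ C * ‖g x‖) : L2n μ f ≤ C * L2n μ g := by
  unfold L2n
  rw [← Real.sqrt_sq hC, ← Real.sqrt_mul (sq_nonneg C), ← integral_const_mul]
  refine Real.sqrt_le_sqrt (integral_mono_of_nonneg (.of_forall fun _ => by positivity)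
    ((hg.integrable_norm_pow (by norm_num)).const_mul _) (h.mono fun x hx => ?_))
  simp only [← mul_pow]
  gcongr

theorem integral_mul_le_L2n {f g : α → ℝ} (hf : MemLp f 2 μ) (hg : MemLp g 2 μ) :
    |∫ x, f x * g x ∂μ| ≤ L2n μ f * L2n μ g := by
  have h := integral_mul_norm_le_Lp_mul_Lq (μ := μ) (f := f) (g := g) Real.HolderConjugate.two_two
    (by simpa using hf) (by simpa using hg)
  refine (abs_integral_le_integral_abs).trans ?_
  simp only [L2n, Real.sqrt_eq_rpow, abs_mul]
  simpa using h

/-- Cauchy–Schwarz in the form used throughout: the integrand is only dominated by a product of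
norms, which covers inner products and bounded weights alike. `B` needs no measurability, since a
non-integrable function has Bochner integral 0. -/
theorem integral_norm_mul_le_L2n {G : Type*} [NormedAddCommGroup G] {f : α → F} {g : α → G}
    {B : α → ℝ} {C : ℝ} (hC : 0 ≤ C) (hf : MemLp f 2 μ) (hg : MemLp g 2 μ)
    (hB : ∀ᵐ x ∂μ, |B x| ≤ C * (‖f x‖ * ‖g x‖)) :
    |∫ x, B x ∂μ| ≤ C * (L2n μ f * L2n μ g) := by
  have h := integral_mul_le_L2n hf.norm hg.norm
  have e1 : L2n μ (fun x => ‖f x‖) = L2n μ f := by simp [L2n]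
  have e2 : L2n μ (fun x => ‖g x‖) = L2n μ g := by simp [L2n]
  rw [e1, e2] at h
  refine abs_integral_le_integral_abs.trans ?_
  refine le_trans ?_ (mul_le_mul_of_nonneg_left ((le_abs_self _).trans h) hC)
  rw [← integral_const_mul]
  exact integral_mono_of_nonneg (.of_forall fun _ => abs_nonneg _)
    ((hf.norm.integrable_mul hg.norm).const_mul C) hB

theorem norm0_eq_L2n {d : ℕ} (T : Set (E d)) (v : E d → ℝ) :
    norm0 T v = L2n (volume.restrict T) v := by
  simp [norm0, L2n]

theorem semi1_eq_L2n {d : ℕ} (T : Set (E d)) (v : E d → ℝ) :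
    semi1 T v = L2n (volume.restrict T) (wgrad T v) := rfl

theorem L2n_sq_euclidean {d : ℕ} {X : α → E d} (hX : MemLp X 2 μ) :
    L2n μ X ^ 2 = ∑ i, L2n μ (fun x => X x i) ^ 2 := by
  have hi : ∀ i, MemLp (fun x => X x i) 2 μ := fun i =>
    hX.of_le ((EuclideanSpace.proj (𝕜 := ℝ) i).continuous.comp_aestronglyMeasurable hX.1)
      (.of_forall fun x => PiLp.norm_apply_le (X x) i)
  simp only [L2n_sq, EuclideanSpace.norm_sq_eq]
  rw [integral_finsetSum]
  exact fun i _ => (hi i).integrable_norm_pow (by norm_num)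

theorem memLp_euclidean {d : ℕ} {X : α → E d} (h : ∀ i, MemLp (fun x => X x i) 2 μ) :
    MemLp X 2 μ := by
  exact MemLp.of_eval_piLp h

end L2

section bounded
variable {d : ℕ} {T : Set (E d)}

theorem volume_lt_top (hb : Bornology.IsBounded T) : volume T < ⊤ := hb.measure_lt_top

theorem memLp_of_continuous {F : Type*} [NormedAddCommGroup F] [SecondCountableTopology F]
    {f : E d → F} (hb : Bornology.IsBounded T)
    {μ : Measure (E d)} (hμ : μ T < ⊤) (hT : MeasurableSet T) (hf : Continuous f)
    (p : ENNReal) : MemLp f p (μ.restrict T) := by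
  have : IsFiniteMeasure (μ.restrict T) := ⟨by simpa using hμ⟩
  obtain ⟨C, hC⟩ := (hb.isCompact_closure.bddAbove_image hf.norm.continuousOn)
  exact MemLp.of_bound (by borelize F; exact hf.measurable.aestronglyMeasurable) C
    ((ae_restrict_iff' hT).2 (.of_forall fun x hx => hC ⟨x, subset_closure hx, rfl⟩))

theorem memL2_of_continuous {f : E d → ℝ} (hT : IsOpen T) (hb : Bornology.IsBounded T)
    (hf : Continuous f) : MemL2 T f :=
  memLp_of_continuous hb (volume_lt_top hb) hT.measurableSet hf 2

theorem MemL2.integrable {f : E d → ℝ} (hb : Bornology.IsBounded T) (hf : MemL2 T f) :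
    Integrable f (volume.restrict T) := by
  have : IsFiniteMeasure (volume.restrict T) := ⟨by simpa using volume_lt_top hb⟩
  exact MemLp.integrable (by norm_num) hf

theorem MemL2.mul_integrable {f g : E d → ℝ} (hf : MemL2 T f) (hg : MemL2 T g) :
    Integrable (fun x => f x * g x) (volume.restrict T) := MemLp.integrable_mul hf hg

end bounded

/-! ### Classical partial derivatives -/

theorem contDiff_pd {φ : E d → ℝ} (h : ContDiff ℝ ∞ φ) (i : Fin d) : ContDiff ℝ ∞ (pd i φ) :=
  (h.fderiv_right (m := ∞) (by simp)).clm_apply contDiff_const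

theorem contDiff_pds {φ : E d → ℝ} (h : ContDiff ℝ ∞ φ) (L : List (Fin d)) :
    ContDiff ℝ ∞ (pds L φ) := by
  induction L with
  | nil => exact h
  | cons i L ih => exact contDiff_pd ih i

theorem pds_append (L L' : List (Fin d)) (φ : E d → ℝ) : pds (L ++ L') φ = pds L (pds L' φ) := by
  induction L with
  | nil => rfl
  | cons i L ih => simp [pds, ih]

theorem pd_comm {φ : E d → ℝ} (h : ContDiff ℝ ∞ φ) (i j : Fin d) :
    pd i (pd j φ) = pd j (pd i φ) := by
  funext x
  have hd : DifferentiableAt ℝ (fderiv ℝ φ) x :=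
    ((h.fderiv_right (m := ∞) (by simp)).differentiable (by simp)).differentiableAt
  have key : ∀ i j : Fin d, pd i (pd j φ) x =
      fderiv ℝ (fderiv ℝ φ) x (EuclideanSpace.single i 1) (EuclideanSpace.single j 1) := by
    intro i j
    change fderiv ℝ (fun y => fderiv ℝ φ y (EuclideanSpace.single j 1)) x _ = _
    rw [fderiv_clm_apply hd (differentiableAt_const _)]
    simp
  rw [key, key]
  exact (h.contDiffAt.isSymmSndFDerivAt (by simpa using WithTop.coe_le_coe.2 (le_top : (2 : ℕ∞) ≤ ⊤))).eq _ _

theorem pds_perm {L L' : List (Fin d)} (hL : L.Perm L') {φ : E d → ℝ} (h : ContDiff ℝ ∞ φ) :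
    pds L φ = pds L' φ := by
  induction hL with
  | nil => rfl
  | cons i _ ih => simp [pds, ih]
  | swap i j L => exact pd_comm (contDiff_pds h L) _ _
  | trans _ _ ih1 ih2 => exact ih1.trans ih2

theorem gradient_apply (w : E d → ℝ) (x : E d) (i : Fin d) : gradient w x i = pd i w x := by
  have h : inner ℝ (gradient w x) (EuclideanSpace.single i (1 : ℝ)) = pd i w x := by
    unfold gradient pd
    rw [InnerProductSpace.toDual_symm_apply]
  rw [← h, EuclideanSpace.inner_single_right]
  simp

theorem continuous_gradient {w : E d → ℝ} (h : ContDiff ℝ ∞ w) : Continuous (gradient w) :=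
  (InnerProductSpace.toDual ℝ (E d)).symm.continuous.comp (h.continuous_fderiv (by simp))

/-! ### Test functions -/

section test
variable {T : Set (E d)} {φ : E d → ℝ}

theorem IsTest.pd (h : IsTest T φ) (i : Fin d) : IsTest T (pd i φ) := by
  refine ⟨contDiff_pd h.1 i, ?_, ?_⟩
  · exact (h.2.1.fderiv ℝ).comp_left (g := fun A : E d →L[ℝ] ℝ => A (EuclideanSpace.single i 1)) rfl
  · refine (closure_mono ?_).trans ((tsupport_fderiv_subset ℝ (f := φ)).trans h.2.2)
    intro x hx hx'
    exact hx (by simp [NCVEM.pd, hx'])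

theorem IsTest.pds (h : IsTest T φ) (L : List (Fin d)) : IsTest T (pds L φ) := by
  induction L with
  | nil => exact h
  | cons i L ih => exact ih.pd i

theorem IsTest.eq_zero (h : IsTest T φ) {x : E d} (hx : x ∉ T) : φ x = 0 := by
  by_contra h0
  exact hx (h.2.2 (subset_tsupport φ h0))

theorem IsTest.memL2 (h : IsTest T φ) (hT : IsOpen T) (hb : Bornology.IsBounded T) : MemL2 T φ :=
  memL2_of_continuous hT hb h.1.continuous

theorem IsTest.setIntegral_mul (h : IsTest T φ) (v : E d → ℝ) :
    ∫ x in T, v x * φ x = ∫ x, v x * φ x :=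
  setIntegral_eq_integral_of_forall_compl_eq_zero fun x hx => by simp [h.eq_zero hx]

/-- Integration by parts of a smooth function against a test function. -/
theorem IsTest.integral_mul_pd (h : IsTest T φ) {f : E d → ℝ} (hf : ContDiff ℝ ∞ f) (i : Fin d) :
    ∫ x in T, f x * NCVEM.pd i φ x = - ∫ x in T, NCVEM.pd i f x * φ x := by
  rw [(h.pd i).setIntegral_mul, h.setIntegral_mul]
  unfold NCVEM.pd
  refine integral_mul_fderiv_eq_neg_fderiv_mul_of_integrable ?_ ?_ ?_ ?_ ?_
  · exact ((contDiff_pd hf i).continuous.mul h.1.continuous).integrable_of_hasCompactSupport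
      h.2.1.mul_left
  · exact (hf.continuous.mul (h.pd i).1.continuous).integrable_of_hasCompactSupport
      (h.pd i).2.1.mul_left
  · exact (hf.continuous.mul h.1.continuous).integrable_of_hasCompactSupport h.2.1.mul_left
  · exact fun x _ => (hf.differentiable (by simp)).differentiableAt
  · exact fun x _ => (h.1.differentiable (by simp)).differentiableAt

/-- A square-integrable function orthogonal to all test functions vanishes almost everywhere. -/
theorem ae_eq_of_forall_isTest (hT : IsOpen T) (hb : Bornology.IsBounded T) {g g' : E d → ℝ}
    (hg : MemL2 T g) (hg' : MemL2 T g')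
    (h : ∀ φ, IsTest T φ → ∫ x in T, g x * φ x = ∫ x in T, g' x * φ x) :
    g =ᵐ[volume.restrict T] g' := by
  have hi : IntegrableOn (fun x => g x - g' x) T := (hg.integrable hb).sub (hg'.integrable hb)
  have := hT.ae_eq_zero_of_integral_contDiff_smul_eq_zero (μ := volume) (f := fun x => g x - g' x)
    hi.locallyIntegrableOn fun φ h1 h2 h3 => by
      have hφ : IsTest T φ := ⟨h1, h2, h3⟩
      have e := h φ hφ
      have : ∫ x in T, (g x - g' x) * φ x = 0 := by
        simp only [sub_mul]
        rw [integral_sub (hg.mul_integrable (hφ.memL2 hT hb)) (hg'.mul_integrable (hφ.memL2 hT hb)),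
          e, sub_self]
      rw [hφ.setIntegral_mul (fun x => g x - g' x)] at this
      simpa [mul_comm] using this
  refine (ae_restrict_iff' hT.measurableSet).2 (this.mono fun x hx hxT => sub_eq_zero.1 (hx hxT))

end test

/-! ### Weak derivatives -/

section weak
variable {T : Set (E d)} {L : List (Fin d)} {v w g g' : E d → ℝ}

theorem HasWeakDeriv.ae_unique (hT : IsOpen T) (hb : Bornology.IsBounded T) (hg : MemL2 T g)
    (hg' : MemL2 T g') (h : HasWeakDeriv T L v g) (h' : HasWeakDeriv T L v g') :
    g =ᵐ[volume.restrict T] g' := by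
  refine ae_eq_of_forall_isTest hT hb hg hg' fun φ hφ => ?_
  have := (h φ hφ).symm.trans (h' φ hφ)
  have h0 : ((-1 : ℝ)) ^ L.length ≠ 0 := pow_ne_zero _ (by norm_num)
  exact mul_left_cancel₀ h0 this

theorem HasWeakDeriv.add (hT : IsOpen T) (hb : Bornology.IsBounded T) (hv : MemL2 T v)
    (hw : MemL2 T w) (hg : MemL2 T g) (hg' : MemL2 T g') (h : HasWeakDeriv T L v g)
    (h' : HasWeakDeriv T L w g') :
    HasWeakDeriv T L (fun x => v x + w x) (fun x => g x + g' x) := by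
  intro φ hφ
  have hD := (hφ.pds L).memL2 hT hb
  have h0 := hφ.memL2 hT hb
  simp only [add_mul]
  rw [integral_add (hv.mul_integrable hD) (hw.mul_integrable hD),
    integral_add (hg.mul_integrable h0) (hg'.mul_integrable h0), h φ hφ, h' φ hφ, mul_add]

theorem HasWeakDeriv.const_mul (a : ℝ) (h : HasWeakDeriv T L v g) :
    HasWeakDeriv T L (fun x => a * v x) (fun x => a * g x) := by
  intro φ hφ
  simp only [mul_assoc, integral_const_mul]
  rw [h φ hφ]; ring

theorem HasWeakDeriv.perm {L' : List (Fin d)} (hL : L.Perm L') (h : HasWeakDeriv T L v g) :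
    HasWeakDeriv T L' v g := by
  intro φ hφ
  rw [← pds_perm hL hφ.1, ← hL.length_eq]
  exact h φ hφ

/-- Derivatives of test functions commute, so `i :: L` may be replaced by `L ++ [i]`; then `pd i φ`
serves as a test function for the derivative along `L`. This is what lets the Poincaré inequality be
applied to derivatives one order at a time. -/
theorem HasWeakDeriv.of_cons {i : Fin d} (h : HasWeakDeriv T L v g)
    (h' : HasWeakDeriv T (i :: L) v g') : HasWeakDeriv T [i] g g' := by
  have h'' : HasWeakDeriv T (L ++ [i]) v g' := h'.perm (List.perm_append_singleton i L).symm
  intro φ hφ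
  have e1 := h _ (hφ.pd i)
  have e2 := h'' φ hφ
  rw [pds_append] at e2
  simp only [pds, List.length_append, List.length_singleton, pow_succ] at e2 ⊢
  rw [e2] at e1
  have h0 : ((-1 : ℝ)) ^ L.length ≠ 0 := pow_ne_zero _ (by norm_num)
  apply mul_left_cancel₀ h0
  rw [← e1]; simp

theorem hasWeakDeriv_nil : HasWeakDeriv T [] v v := by
  intro φ _; simp [pds]

theorem wderiv_spec (h : ∃ g, MemL2 T g ∧ HasWeakDeriv T L v g) :
    MemL2 T (wderiv T L v) ∧ HasWeakDeriv T L v (wderiv T L v) := by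
  unfold wderiv
  rw [dif_pos h]
  exact h.choose_spec

/-- `wderiv` is an arbitrary choice, so it is only ever computed through this almost-everywhere
uniqueness. -/
theorem wderiv_ae_eq (hT : IsOpen T) (hb : Bornology.IsBounded T) (hg : MemL2 T g)
    (h : HasWeakDeriv T L v g) : wderiv T L v =ᵐ[volume.restrict T] g := by
  obtain ⟨h1, h2⟩ := wderiv_spec ⟨g, hg, h⟩
  exact h2.ae_unique hT hb h1 hg h

theorem MemH.memL2_wderiv {m : ℕ} (h : MemH m T v) (hL : L.length ≤ m) :
    MemL2 T (wderiv T L v) := (wderiv_spec (h.2 L hL)).1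

theorem MemH.hasWeakDeriv {m : ℕ} (h : MemH m T v) (hL : L.length ≤ m) :
    HasWeakDeriv T L v (wderiv T L v) := (wderiv_spec (h.2 L hL)).2

theorem MemH.mono {m n : ℕ} (hmn : n ≤ m) (h : MemH m T v) : MemH n T v :=
  ⟨h.1, fun L hL => h.2 L (hL.trans hmn)⟩

theorem MemH.add {m : ℕ} (hT : IsOpen T) (hb : Bornology.IsBounded T) (hv : MemH m T v)
    (hw : MemH m T w) : MemH m T (fun x => v x + w x) :=
  ⟨hv.1.add hw.1, fun _ hL => ⟨_, (hv.memL2_wderiv hL).add (hw.memL2_wderiv hL),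
    (hv.hasWeakDeriv hL).add hT hb hv.1 hw.1 (hv.memL2_wderiv hL) (hw.memL2_wderiv hL)
      (hw.hasWeakDeriv hL)⟩⟩

theorem MemH.const_mul {m : ℕ} (a : ℝ) (hv : MemH m T v) : MemH m T (fun x => a * v x) :=
  ⟨MemLp.const_mul hv.1 a, fun _ hL => ⟨_, MemLp.const_mul (hv.memL2_wderiv hL) a,
    (hv.hasWeakDeriv hL).const_mul a⟩⟩

theorem sub_eq_add_neg_one_mul (v w : E d → ℝ) :
    (fun x => v x - w x) = fun x => v x + (-1) * w x := by funext x; ring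

theorem MemH.sub {m : ℕ} (hT : IsOpen T) (hb : Bornology.IsBounded T) (hv : MemH m T v)
    (hw : MemH m T w) : MemH m T (fun x => v x - w x) := by
  rw [sub_eq_add_neg_one_mul]; exact hv.add hT hb (hw.const_mul _)

theorem MemH.wderiv_add {m : ℕ} (hT : IsOpen T) (hb : Bornology.IsBounded T) (hv : MemH m T v)
    (hw : MemH m T w) (hL : L.length ≤ m) :
    wderiv T L (fun x => v x + w x) =ᵐ[volume.restrict T]
      fun x => wderiv T L v x + wderiv T L w x :=
  wderiv_ae_eq hT hb ((hv.memL2_wderiv hL).add (hw.memL2_wderiv hL))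
    ((hv.hasWeakDeriv hL).add hT hb hv.1 hw.1 (hv.memL2_wderiv hL) (hw.memL2_wderiv hL)
      (hw.hasWeakDeriv hL))

theorem MemH.wderiv_const_mul {m : ℕ} (hT : IsOpen T) (hb : Bornology.IsBounded T) (a : ℝ)
    (hv : MemH m T v) (hL : L.length ≤ m) :
    wderiv T L (fun x => a * v x) =ᵐ[volume.restrict T] fun x => a * wderiv T L v x :=
  wderiv_ae_eq hT hb (MemLp.const_mul (hv.memL2_wderiv hL) a) ((hv.hasWeakDeriv hL).const_mul a)

theorem MemH.wderiv_sub {m : ℕ} (hT : IsOpen T) (hb : Bornology.IsBounded T) (hv : MemH m T v)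
    (hw : MemH m T w) (hL : L.length ≤ m) :
    wderiv T L (fun x => v x - w x) =ᵐ[volume.restrict T]
      fun x => wderiv T L v x - wderiv T L w x := by
  rw [sub_eq_add_neg_one_mul]
  filter_upwards [hv.wderiv_add hT hb (hw.const_mul (-1)) hL, hw.wderiv_const_mul hT hb (-1) hL]
    with x h1 h2
  rw [h1, h2]; ring

theorem MemH.memLp_wgrad (hv : MemH 1 T v) : MemLp (wgrad T v) 2 (volume.restrict T) :=
  memLp_euclidean fun i => hv.memL2_wderiv (L := [i]) le_rfl

theorem wgrad_ae_ext {v : E d → ℝ} {X : E d → E d}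
    (h : ∀ i, wderiv T [i] v =ᵐ[volume.restrict T] fun x => X x i) :
    wgrad T v =ᵐ[volume.restrict T] X := by
  filter_upwards [ae_all_iff.2 h] with x hx
  ext i
  exact hx i

theorem MemH.wgrad_add (hT : IsOpen T) (hb : Bornology.IsBounded T) (hv : MemH 1 T v)
    (hw : MemH 1 T w) :
    wgrad T (fun x => v x + w x) =ᵐ[volume.restrict T] fun x => wgrad T v x + wgrad T w x :=
  wgrad_ae_ext fun _ => hv.wderiv_add hT hb hw le_rfl

theorem MemH.wgrad_sub (hT : IsOpen T) (hb : Bornology.IsBounded T) (hv : MemH 1 T v)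
    (hw : MemH 1 T w) :
    wgrad T (fun x => v x - w x) =ᵐ[volume.restrict T] fun x => wgrad T v x - wgrad T w x :=
  wgrad_ae_ext fun _ => hv.wderiv_sub hT hb hw le_rfl

theorem MemH.wgrad_const_mul (hT : IsOpen T) (hb : Bornology.IsBounded T) (a : ℝ)
    (hv : MemH 1 T v) :
    wgrad T (fun x => a * v x) =ᵐ[volume.restrict T] fun x => a • wgrad T v x :=
  wgrad_ae_ext fun _ => hv.wderiv_const_mul hT hb a le_rfl

end weak

/-! ### Polynomial functions -/

/-- The function on `ℝ^d` defined by a polynomial. -/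
def polyFun (p : MvPolynomial (Fin d) ℝ) (x : E d) : ℝ := MvPolynomial.eval (fun i => x i) p

/-- The iterated partial derivative of a polynomial. -/
def pderivs : List (Fin d) → MvPolynomial (Fin d) ℝ → MvPolynomial (Fin d) ℝ
  | [], p => p
  | i :: L, p => MvPolynomial.pderiv i (pderivs L p)

theorem contDiff_polyFun (p : MvPolynomial (Fin d) ℝ) : ContDiff ℝ ∞ (polyFun p) := by
  induction p using MvPolynomial.induction_on with
  | C a =>
    have : polyFun (d := d) (MvPolynomial.C a) = fun _ => a := by funext x; simp [polyFun]
    rw [this]; exact contDiff_const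
  | add p q hp hq =>
    have : polyFun (p + q) = fun x => polyFun p x + polyFun q x := by funext x; simp [polyFun]
    rw [this]; exact hp.add hq
  | mul_X p i hp =>
    have : polyFun (p * MvPolynomial.X i) = fun x => polyFun p x * x i := by
      funext x; simp [polyFun]
    rw [this]; exact hp.mul (by fun_prop)

theorem pd_polyFun (i : Fin d) (p : MvPolynomial (Fin d) ℝ) :
    pd i (polyFun p) = polyFun (MvPolynomial.pderiv i p) := by
  funext x
  have hdf : ∀ p : MvPolynomial (Fin d) ℝ, DifferentiableAt ℝ (polyFun p) x := fun p =>
    ((contDiff_polyFun p).differentiable (by simp)).differentiableAt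
  induction p using MvPolynomial.induction_on with
  | C a =>
    have : polyFun (d := d) (MvPolynomial.C a) = fun _ => a := by funext x; simp [polyFun]
    simp [pd, this]; simp [polyFun]
  | add p q hp hq =>
    have : ∀ p q : MvPolynomial (Fin d) ℝ, polyFun (p + q) = polyFun p + polyFun q := by
      intro p q; funext x; simp [polyFun]
    rw [map_add, this, this, Pi.add_apply, ← hp, ← hq]
    unfold pd
    rw [fderiv_add (hdf p) (hdf q)]; rfl
  | mul_X p j hp =>
    have e : polyFun (p * MvPolynomial.X j) = fun x => polyFun p x * (EuclideanSpace.proj (𝕜 := ℝ) j) x := by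
      funext x; simp [polyFun]
    have h2 : polyFun (MvPolynomial.pderiv i (p * MvPolynomial.X j)) x =
      polyFun (MvPolynomial.pderiv i p) x * x j +
        polyFun p x * (if j = i then 1 else 0) := by
      rw [MvPolynomial.pderiv_mul, MvPolynomial.pderiv_X, Pi.single_apply]
      by_cases h : j = i <;> simp [polyFun, h]
    rw [h2, ← hp, e]
    unfold pd
    rw [fderiv_fun_mul (hdf p) (EuclideanSpace.proj (𝕜 := ℝ) j).differentiableAt,
      (EuclideanSpace.proj (𝕜 := ℝ) j).fderiv]
    simp
    ring

theorem pderiv_comm (i j : Fin d) (p : MvPolynomial (Fin d) ℝ) :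
    MvPolynomial.pderiv i (MvPolynomial.pderiv j p) =
      MvPolynomial.pderiv j (MvPolynomial.pderiv i p) := by
  ext m
  simp only [MvPolynomial.coeff_pderiv]
  by_cases h : i = j
  · subst h; rfl
  · rw [add_right_comm]
    simp [h, Ne.symm h]
    ring

theorem pderiv_pderivs (i : Fin d) (L : List (Fin d)) (p : MvPolynomial (Fin d) ℝ) :
    pderivs L (MvPolynomial.pderiv i p) = MvPolynomial.pderiv i (pderivs L p) := by
  induction L with
  | nil => rfl
  | cons j L ih => simp only [pderivs]; rw [ih, pderiv_comm]

theorem hasWeakDeriv_polyFun (T : Set (E d)) (L : List (Fin d)) (p : MvPolynomial (Fin d) ℝ) :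
    HasWeakDeriv T L (polyFun p) (polyFun (pderivs L p)) := by
  induction L generalizing p with
  | nil => exact hasWeakDeriv_nil
  | cons i L ih =>
    intro φ hφ
    simp only [pds, pderivs, List.length_cons, pow_succ]
    rw [(hφ.pds L).integral_mul_pd (contDiff_polyFun p), pd_polyFun, ih _ φ hφ, pderiv_pderivs]
    ring

section poly
variable {T : Set (E d)}

theorem memL2_polyFun (hT : IsOpen T) (hb : Bornology.IsBounded T)
    (p : MvPolynomial (Fin d) ℝ) : MemL2 T (polyFun p) :=
  memL2_of_continuous hT hb (contDiff_polyFun p).continuous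

theorem memH_polyFun (hT : IsOpen T) (hb : Bornology.IsBounded T) (m : ℕ)
    (p : MvPolynomial (Fin d) ℝ) : MemH m T (polyFun p) :=
  ⟨memL2_polyFun hT hb p, fun L _ => ⟨_, memL2_polyFun hT hb _, hasWeakDeriv_polyFun T L p⟩⟩

theorem wderiv_polyFun (hT : IsOpen T) (hb : Bornology.IsBounded T) (L : List (Fin d))
    (p : MvPolynomial (Fin d) ℝ) :
    wderiv T L (polyFun p) =ᵐ[volume.restrict T] polyFun (pderivs L p) :=
  wderiv_ae_eq hT hb (memL2_polyFun hT hb _) (hasWeakDeriv_polyFun T L p)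

theorem wgrad_polyFun (hT : IsOpen T) (hb : Bornology.IsBounded T)
    (p : MvPolynomial (Fin d) ℝ) :
    wgrad T (polyFun p) =ᵐ[volume.restrict T] gradient (polyFun p) := by
  refine wgrad_ae_ext fun i => ?_
  simp only [gradient_apply, pd_polyFun]
  exact wderiv_polyFun hT hb [i] p

theorem mem_Poly_iff {m : ℤ} {f : E d → ℝ} :
    f ∈ Poly d m ↔ ∃ p : MvPolynomial (Fin d) ℝ, (p = 0 ∨ (p.totalDegree : ℤ) ≤ m) ∧ f = polyFun p := by
  simp only [Poly, Set.mem_ofPred_eq, funext_iff, polyFun]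

theorem polyFun_mem {m : ℤ} {p : MvPolynomial (Fin d) ℝ} (h : p = 0 ∨ (p.totalDegree : ℤ) ≤ m) :
    polyFun p ∈ Poly d m := mem_Poly_iff.2 ⟨p, h, rfl⟩

/-- A monomial `s` of the derivative comes from the monomial `s + single i 1` of `p`, one degree
higher. The alternative `p = 0` is kept apart because `m` may be negative, whereas the zero
polynomial has `totalDegree` 0. -/
theorem totalDegree_pderiv_le {p : MvPolynomial (Fin d) ℝ} {m : ℤ} (i : Fin d)
    (h : p = 0 ∨ (p.totalDegree : ℤ) ≤ m) :
    MvPolynomial.pderiv i p = 0 ∨ ((MvPolynomial.pderiv i p).totalDegree : ℤ) ≤ m - 1 := by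
  rcases h with rfl | h
  · left; simp
  by_cases h0 : MvPolynomial.pderiv i p = 0
  · exact Or.inl h0
  right
  obtain ⟨s, hs, hs'⟩ := Finset.exists_mem_eq_sup (MvPolynomial.pderiv i p).support
    (by simpa [Finset.nonempty_iff_ne_empty] using h0) (fun s => s.sum fun _ e => e)
  have e : (MvPolynomial.pderiv i p).totalDegree = s.sum fun _ e => e := hs'
  rw [e]
  rw [MvPolynomial.mem_support_iff, MvPolynomial.coeff_pderiv] at hs
  have h1 := MvPolynomial.le_totalDegree (p := p) (s := s + Finsupp.single i 1)
    (MvPolynomial.mem_support_iff.2 (left_ne_zero_of_mul hs))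
  rw [Finsupp.sum_add_index' (by simp) (by simp), Finsupp.sum_single_index rfl] at h1
  omega

end poly

/-! ### Domains star-shaped with respect to a ball -/

/-- Bounded open sets that are star-shaped with respect to all points of the ball of centre `x0`
and radius `s`. -/
structure IsStarDomain (T : Set (E d)) (x0 : E d) (s : ℝ) : Prop where
  isOpen : IsOpen T
  bounded : Bornology.IsBounded T
  nonempty : T.Nonempty
  pos : 0 < s
  star : ∀ y ∈ Metric.ball x0 s, StarConvex ℝ y T

section star
variable {T : Set (E d)} {x0 : E d} {s : ℝ}

theorem IsStarDomain.ball_subset (h : IsStarDomain T x0 s) : Metric.ball x0 s ⊆ T :=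
  fun y hy => (h.star y hy).mem h.nonempty

/-- Approximate `x` by a point `x'` of `T`. The point in question also lies on the segment to `x'`
from the slightly moved centre `y + (t / (1 - t)) • (x - x')`, which is still in the ball. -/
theorem IsStarDomain.mem_of_closure (h : IsStarDomain T x0 s) {x y : E d}
    (hy : y ∈ Metric.ball x0 s) (hx : x ∈ closure T) {t : ℝ} (ht0 : 0 ≤ t) (ht1 : t < 1) :
    y + t • (x - y) ∈ T := by
  have hc : Continuous fun x' : E d => y + (t / (1 - t)) • (x - x') := by fun_prop
  have ho : IsOpen ((fun x' : E d => y + (t / (1 - t)) • (x - x')) ⁻¹' Metric.ball x0 s) :=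
    Metric.isOpen_ball.preimage hc
  obtain ⟨x', hx', hx'T⟩ := mem_closure_iff.1 hx _ ho (by simpa using hy)
  have := (h.star _ hx') hx'T (a := 1 - t) (b := t) (by linarith) ht0 (by ring)
  convert! this using 1
  have h1 : (1 - t) ≠ 0 := by linarith
  rw [smul_add, smul_smul, mul_div_cancel₀ _ h1]
  module

theorem IsStarDomain.notMem_frontier (h : IsStarDomain T x0 s) {x : E d} (hx : x ∈ T) :
    x ∉ frontier T := by
  rw [h.isOpen.frontier_eq]; exact fun hx' => hx'.2 hx

/-- Every point of `T` other than `y` lies on a segment from `y` to the boundary. -/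
theorem IsStarDomain.exists_frontier (h : IsStarDomain T x0 s) {x y : E d}
    (hx : x ∈ T) (hxy : x ≠ y) :
    ∃ z ∈ frontier T, ∃ t ∈ Set.Ioo (0 : ℝ) 1, x = y + t • (z - y) := by
  set f : ℝ → E d := fun t => y + t • (x - y) with hf
  have hfc : Continuous f := by fun_prop
  -- The parameters `t ≥ 1` at which the ray is outside `T`. The infimum `τ` is attained because `T`
  -- is open, it exceeds 1, and `f τ` is a limit of points of `T`: it is the boundary point sought.
  set S : Set ℝ := {t | 1 ≤ t ∧ f t ∉ T} with hS
  have hxy' : 0 < ‖x - y‖ := norm_pos_iff.2 (sub_ne_zero.2 hxy)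
  have hne : S.Nonempty := by
    obtain ⟨R, hR⟩ := h.bounded.subset_ball y
    refine ⟨max 1 (R / ‖x - y‖), le_max_left _ _, fun hT => ?_⟩
    have h1 := hR hT
    rw [mem_ball_iff_norm] at h1
    simp only [hf, add_sub_cancel_left, norm_smul, Real.norm_eq_abs] at h1
    rw [abs_of_nonneg (le_trans zero_le_one (le_max_left _ _))] at h1
    have h2 := mul_le_mul_of_nonneg_right (le_max_right 1 (R / ‖x - y‖)) hxy'.le
    rw [div_mul_cancel₀ _ hxy'.ne'] at h2
    linarith
  have hbd : BddBelow S := ⟨1, fun t ht => ht.1⟩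
  have hcl : IsClosed S := (isClosed_Ici (a := (1 : ℝ))).inter (h.isOpen.preimage hfc).isClosed_compl
  have hm := hcl.csInf_mem hne hbd
  set τ := sInf S
  have hτ1 : 1 < τ := by
    refine lt_of_le_of_ne hm.1 fun h1 => hm.2 ?_
    rw [← h1]; simpa [hf] using hx
  have hcl' : f τ ∈ closure T := by
    have hcw : Set.Ico 1 τ ⊆ f ⁻¹' T := fun t ht => by
      by_contra h1
      exact absurd (csInf_le hbd ⟨ht.1, h1⟩) (not_le.2 ht.2)
    have : τ ∈ closure (Set.Ico 1 τ) := by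
      rw [closure_Ico hτ1.ne]; exact ⟨hτ1.le, le_rfl⟩
    exact hfc.closure_preimage_subset T (closure_mono hcw this)
  refine ⟨f τ, ?_, τ⁻¹, ⟨by positivity, inv_lt_one_of_one_lt₀ hτ1⟩, ?_⟩
  · rw [h.isOpen.frontier_eq]; exact ⟨hcl', hm.2⟩
  · simp only [hf, add_sub_cancel_left, smul_smul]
    rw [inv_mul_cancel₀ (by positivity)]; simp

/-- A ray from a point of the ball meets the boundary only once. -/
theorem IsStarDomain.frontier_unique (h : IsStarDomain T x0 s) {y z z' : E d}
    (hy : y ∈ Metric.ball x0 s) (hz : z ∈ frontier T) (hz' : z' ∈ frontier T) {t t' : ℝ}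
    (ht : 0 < t) (ht' : 0 < t') (e : y + t • (z - y) = y + t' • (z' - y)) : z = z' := by
  -- If `t' < t`, then `z` lies strictly between `y` and the boundary point `z'`, hence in the open
  -- set `T`.
  have key : ∀ {z z' : E d} {t t' : ℝ}, z ∈ frontier T → z' ∈ frontier T → 0 < t → 0 < t' →
      y + t • (z - y) = y + t' • (z' - y) → ¬ t' < t := by
    intro z z' t t' hz hz' ht ht' e hlt
    refine h.notMem_frontier ?_ hz
    have := h.mem_of_closure hy (frontier_subset_closure hz') (t := t' / t) (by positivity)
      ((div_lt_one ht).2 hlt)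
    convert! this using 1
    have e' : t • (z - y) = t' • (z' - y) := add_left_cancel e
    rw [div_eq_inv_mul, mul_smul, ← e', smul_smul, inv_mul_cancel₀ ht.ne']
    simp
  have : t = t' := le_antisymm (not_lt.1 (key hz hz' ht ht' e)) (not_lt.1 (key hz' hz ht' ht e.symm))
  subst this
  have e' : t • (z - y) = t • (z' - y) := add_left_cancel e
  have := smul_right_injective (E d) ht.ne' e'
  simpa using this

end star

/-! ### Cones over flat sets -/

/-- The cone with apex `y` over `e`. -/
def cone (y : E d) (e : Set (E d)) : Set (E d) :=
  {p | ∃ t ∈ Set.Ioo (0 : ℝ) 1, ∃ z ∈ e, p = y + t • (z - y)}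

section cone
variable {y v : E d} {e : Set (E d)}

/-- The hypothesis says that `v` leads from `y` perpendicularly to the hyperplane of `e`. So the
parameter of `p` in the cone is the relative height `inner v (p - y) / ‖v‖ ^ 2`, and the base point
is recovered by rescaling `p - y`; measurability can be read off from this. -/
theorem cone_eq_preimage (hv : v ≠ 0) (he : ∀ z ∈ e, inner ℝ v (z - y) = ‖v‖ ^ 2) :
    cone y e = (fun p => inner ℝ v (p - y) / ‖v‖ ^ 2) ⁻¹' Set.Ioo 0 1 ∩
      (fun p => y + (inner ℝ v (p - y) / ‖v‖ ^ 2)⁻¹ • (p - y)) ⁻¹' e := by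
  have hv2 : ‖v‖ ^ 2 ≠ 0 := by simpa using hv
  ext p
  constructor
  · rintro ⟨t, ht, z, hz, rfl⟩
    have : inner ℝ v (y + t • (z - y) - y) / ‖v‖ ^ 2 = t := by
      rw [add_sub_cancel_left, inner_smul_right, he z hz, mul_div_assoc, div_self hv2, mul_one]
    refine ⟨by simp only [Set.mem_preimage, this]; exact ht, ?_⟩
    rw [Set.mem_preimage, this, add_sub_cancel_left, smul_smul, inv_mul_cancel₀ ht.1.ne', one_smul]
    simpa using hz
  · rintro ⟨h1, h2⟩
    refine ⟨_, h1, _, h2, ?_⟩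
    rw [add_sub_cancel_left, smul_smul, mul_inv_cancel₀ h1.1.ne']
    simp

theorem measurableSet_cone (hv : v ≠ 0) (he : ∀ z ∈ e, inner ℝ v (z - y) = ‖v‖ ^ 2)
    (hm : MeasurableSet e) : MeasurableSet (cone y e) := by
  rw [cone_eq_preimage hv he]
  refine MeasurableSet.inter ?_ ?_
  · exact measurableSet_Ioo.preimage (by fun_prop)
  · exact hm.preimage (by fun_prop)

/-- Slice by the hyperplanes orthogonal to `v`. The slice at relative height `t` is a homothetic
image of a part of `e` with ratio `t`, so its surface measure scales by `t ^ (d - 1)`; the factor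
`‖v‖` turns relative height into length. Slices outside `(0, 1)` are empty. -/
theorem volume_inter_cone (hv : v ≠ 0) (he : ∀ z ∈ e, inner ℝ v (z - y) = ‖v‖ ^ 2)
    (hm : MeasurableSet e) {A : Set (E d)} (hA : MeasurableSet A) :
    volume (A ∩ cone y e) = ∫⁻ t in Set.Ioo (0 : ℝ) 1,
      ENNReal.ofReal (‖v‖ * t ^ (d - 1)) * surf d (e ∩ (fun z => y + t • (z - y)) ⁻¹' A) := by
  have hv2 : ‖v‖ ^ 2 ≠ 0 := by simpa using hv
  have h := EuclideanGeometry.euclideanHausdorffMeasure_eq_lintegral y hv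
    (hA.inter (measurableSet_cone hv he hm))
  have hfr : Module.finrank ℝ (E d) = d := by simp
  rw [hfr, EuclideanSpace.euclideanHausdorffMeasure_eq_volume] at h
  rw [h, ← lintegral_indicator measurableSet_Ioo]
  rw [← lintegral_const_mul' _ _ (by simp)]
  refine lintegral_congr fun t => ?_
  by_cases ht : t ∈ Set.Ioo (0 : ℝ) 1
  · rw [Set.indicator_of_mem ht]
    have himg : A ∩ cone y e ∩ AffineSubspace.mk' (t • v +ᵥ y) (Submodule.span ℝ {v})ᗮ =
        AffineMap.homothety y t '' (e ∩ (fun z => y + t • (z - y)) ⁻¹' A) := by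
      ext p
      constructor
      · rintro ⟨⟨hpA, t', ht', z, hz, rfl⟩, hp⟩
        have hp' : inner ℝ v (t' • (z - y) - t • v) = 0 := by
          have h1 := (Submodule.mem_orthogonal_singleton_iff_inner_right).1
            ((AffineSubspace.mem_mk').1 hp)
          simp only [vsub_eq_sub, vadd_eq_add] at h1
          rw [← h1]; congr 1; module
        rw [inner_sub_right, inner_smul_right, inner_smul_right, he z hz,
          real_inner_self_eq_norm_sq, ← sub_mul] at hp'
        have : t' = t := by
          rcases mul_eq_zero.1 hp' with h0 | h0
          · linarith
          · exact absurd h0 hv2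
        subst this
        exact ⟨z, ⟨hz, hpA⟩, by simp [AffineMap.homothety_apply, add_comm]⟩
      · rintro ⟨z, ⟨hz, hzA⟩, rfl⟩
        have e1 : AffineMap.homothety y t z = y + t • (z - y) := by
          simp [AffineMap.homothety_apply, add_comm]
        rw [e1]
        refine ⟨⟨hzA, t, ht, z, hz, rfl⟩, ?_⟩
        refine (AffineSubspace.mem_mk').2 ((Submodule.mem_orthogonal_singleton_iff_inner_right).2 ?_)
        have : (y + t • (z - y) -ᵥ (t • v +ᵥ y) : E d) = t • (z - y) - t • v := by
          simp only [vsub_eq_sub, vadd_eq_add]; module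
        rw [this, inner_sub_right, inner_smul_right, inner_smul_right, he z hz,
          real_inner_self_eq_norm_sq, sub_self]
    rw [himg, euclideanHausdorffMeasure_homothety_image _ _ ht.1.ne']
    rw [ENNReal.ofReal_mul (norm_nonneg _), ofReal_norm, mul_assoc, ENNReal.smul_def,
      smul_eq_mul, ENNReal.ofReal_pow ht.1.le]
    congr 2
    rw [ENNReal.coe_pow]; congr 1
    rw [← enorm_eq_nnnorm, Real.enorm_eq_ofReal ht.1.le]
  · rw [Set.indicator_of_notMem ht]
    have : A ∩ cone y e ∩ AffineSubspace.mk' (t • v +ᵥ y) (Submodule.span ℝ {v})ᗮ = ∅ := by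
      ext p
      simp only [Set.mem_empty_iff_false, iff_false]
      rintro ⟨⟨hpA, t', ht', z, hz, rfl⟩, hp⟩
      have hp' : inner ℝ v (t' • (z - y) - t • v) = 0 := by
        have h1 := (Submodule.mem_orthogonal_singleton_iff_inner_right).1
          ((AffineSubspace.mem_mk').1 hp)
        simp only [vsub_eq_sub, vadd_eq_add] at h1
        rw [← h1]; congr 1; module
      rw [inner_sub_right, inner_smul_right, inner_smul_right, he z hz,
        real_inner_self_eq_norm_sq, ← sub_mul] at hp'
      rcases mul_eq_zero.1 hp' with h0 | h0
      · exact ht (by rwa [← sub_eq_zero.1 h0])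
      · exact absurd h0 hv2
    rw [this]; simp

end cone

/-- Needed because cones over adjacent faces may overlap in null sets. -/
theorem setIntegral_biUnion_finset₀ {α ι : Type*} [MeasurableSpace α] {μ : Measure α}
    (t : Finset ι) {s : ι → Set α} {f : α → ℝ} (hs : ∀ i ∈ t, MeasurableSet (s i))
    (h's : ∀ i ∈ t, ∀ j ∈ t, i ≠ j → μ (s i ∩ s j) = 0) (hf : ∀ i ∈ t, IntegrableOn f (s i) μ) :
    ∫ x in ⋃ i ∈ t, s i, f x ∂μ = ∑ i ∈ t, ∫ x in s i, f x ∂μ := by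
  classical
  induction t using Finset.induction_on with
  | empty => simp
  | insert i t hi ih =>
    simp only [Finset.mem_insert, forall_eq_or_imp] at hs h's hf
    rw [Finset.set_biUnion_insert, Finset.sum_insert hi, setIntegral_union₀ _
      (Finset.measurableSet_biUnion _ hs.2).nullMeasurableSet hf.1 (integrableOn_finset_iUnion.2 hf.2),
      ih hs.2 (fun i hi j hj => (h's.2 i hi).2 j hj) hf.2]
    change μ (s i ∩ ⋃ j ∈ t, s j) = 0
    rw [Set.inter_iUnion₂]
    exact (measure_biUnion_null_iff t.countable_toSet).2
      fun j hj => h's.1.2 j hj (fun h => hi (h ▸ hj))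

section cone
variable {y v : E d} {e : Set (E d)}

theorem isBounded_cone (hb : Bornology.IsBounded e) : Bornology.IsBounded (cone y e) := by
  obtain ⟨R, hR⟩ := hb.subset_ball y
  refine Metric.isBounded_ball (x := y) (r := R) |>.subset ?_
  rintro p ⟨t, ht, z, hz, rfl⟩
  have := hR hz
  rw [mem_ball_iff_norm] at this ⊢
  rw [add_sub_cancel_left, norm_smul, Real.norm_eq_abs, abs_of_pos ht.1]
  calc t * ‖z - y‖ ≤ 1 * ‖z - y‖ := by gcongr; exact ht.2.le
    _ < R := by simpa using this

/-- The cone over `e` is bounded, and its volume is a positive multiple of the surface measure of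
`e`. -/
theorem surf_lt_top (hv : v ≠ 0) (he : ∀ z ∈ e, inner ℝ v (z - y) = ‖v‖ ^ 2)
    (hm : MeasurableSet e) (hb : Bornology.IsBounded e) : surf d e < ⊤ := by
  have h := volume_inter_cone hv he hm (A := Set.univ) MeasurableSet.univ
  simp only [Set.univ_inter, Set.preimage_univ, Set.inter_univ] at h
  have h1 : volume (cone y e) < ⊤ := (isBounded_cone hb).measure_lt_top
  rw [h, lintegral_mul_const _ (by fun_prop)] at h1
  by_contra h2
  rw [not_lt, top_le_iff] at h2
  rw [h2, ENNReal.mul_top] at h1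
  · exact lt_irrefl _ h1
  · refine (setLIntegral_pos_iff (by fun_prop)).2 ?_ |>.ne'
    have : Set.Ioo (0:ℝ) 1 ⊆ Function.support (fun t : ℝ => ENNReal.ofReal (‖v‖ * t ^ (d - 1))) := by
      intro t ht
      have h3 := norm_pos_iff.2 hv
      have h4 := pow_pos ht.1 (d - 1)
      simp only [Function.mem_support, ne_eq, ENNReal.ofReal_eq_zero, not_le]
      positivity
    rw [Set.inter_eq_right.2 this]; simp

/-- The Lebesgue measure on a cone in polar coordinates about its apex. -/
theorem restrict_cone_eq_map (hv : v ≠ 0) (he : ∀ z ∈ e, inner ℝ v (z - y) = ‖v‖ ^ 2)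
    (hm : MeasurableSet e) (hb : Bornology.IsBounded e) :
    volume.restrict (cone y e) =
      Measure.map (fun q : ℝ × E d => y + q.1 • (q.2 - y))
        (((volume.restrict (Set.Ioo (0 : ℝ) 1)).withDensity
          (fun t => ENNReal.ofReal (‖v‖ * t ^ (d - 1)))).prod ((surf d).restrict e)) := by
  have : IsFiniteMeasure ((surf d).restrict e) := ⟨by simpa using surf_lt_top hv he hm hb⟩
  have hmeas : Measurable (fun q : ℝ × E d => y + q.1 • (q.2 - y)) := by fun_prop
  ext A hA
  rw [Measure.restrict_apply hA, volume_inter_cone hv he hm hA, Measure.map_apply hmeas hA,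
    Measure.prod_apply (hmeas hA), lintegral_withDensity_eq_lintegral_mul _ (by fun_prop)
      (measurable_measure_prodMk_left (hmeas hA))]
  refine lintegral_congr fun t => ?_
  simp only [Pi.mul_apply]
  congr 1
  rw [Measure.restrict_apply (measurable_prodMk_left (hmeas hA)), Set.inter_comm]
  rfl

theorem setIntegral_cone (hv : v ≠ 0) (he : ∀ z ∈ e, inner ℝ v (z - y) = ‖v‖ ^ 2)
    (hm : MeasurableSet e) (hb : Bornology.IsBounded e) {F : E d → ℝ} (hF : Continuous F) :
    ∫ x in cone y e, F x = ∫ z in e, (∫ t in Set.Ioo (0 : ℝ) 1,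
      ‖v‖ * t ^ (d - 1) * F (y + t • (z - y))) ∂(surf d) := by
  have : IsFiniteMeasure ((surf d).restrict e) := ⟨by simpa using surf_lt_top hv he hm hb⟩
  have hmeas : Measurable (fun q : ℝ × E d => y + q.1 • (q.2 - y)) := by fun_prop
  have hint : Integrable F (volume.restrict (cone y e)) :=
    memLp_one_iff_integrable.1 (memLp_of_continuous (isBounded_cone hb)
      (isBounded_cone hb).measure_lt_top (measurableSet_cone hv he hm) hF 1)
  rw [restrict_cone_eq_map hv he hm hb] at hint ⊢
  rw [integral_map hmeas.aemeasurable hF.aestronglyMeasurable, integral_prod_symm]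
  · refine integral_congr_ae (.of_forall fun z => ?_)
    simp only
    rw [integral_withDensity_eq_integral_toReal_smul (by fun_prop)
      (.of_forall fun _ => ENNReal.ofReal_lt_top)]
    refine setIntegral_congr_fun measurableSet_Ioo fun t ht => ?_
    simp only [smul_eq_mul]
    rw [ENNReal.toReal_ofReal (mul_nonneg (norm_nonneg _) (pow_nonneg ht.1.le _))]
  · exact (integrable_map_measure hF.aestronglyMeasurable hmeas.aemeasurable).1 hint

/-- The divergence theorem for radial fields on a cone. -/
theorem setIntegral_cone_div (hd : 0 < d) (hv : v ≠ 0)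
    (he : ∀ z ∈ e, inner ℝ v (z - y) = ‖v‖ ^ 2)
    (hm : MeasurableSet e) (hb : Bornology.IsBounded e) {g : E d → ℝ} (hg : ContDiff ℝ ∞ g) :
    ∫ x in cone y e, (d * g x + fderiv ℝ g x (x - y)) = ‖v‖ * ∫ z in e, g z ∂(surf d) := by
  have hg' : Continuous (fderiv ℝ g) := hg.continuous_fderiv (by simp)
  rw [setIntegral_cone hv he hm hb (by have := hg.continuous; fun_prop), ← integral_const_mul]
  refine integral_congr_ae (.of_forall fun z => ?_)
  simp only
  -- In polar coordinates the integrand, with its weight `t ^ (d - 1)`, is the derivative of `t ^ d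
  -- * g (y + t • (z - y))`; this vanishes at 0 as `0 < d` and equals `g z` at 1.
  have hder : ∀ t : ℝ, HasDerivAt (fun t : ℝ => t ^ d * g (y + t • (z - y)))
      (t ^ (d - 1) * (d * g (y + t • (z - y)) +
        fderiv ℝ g (y + t • (z - y)) (y + t • (z - y) - y))) t := by
    intro t
    have h1 : HasDerivAt (fun t : ℝ => y + t • (z - y)) (z - y) t := by
      simpa using ((hasDerivAt_id t).smul_const (z - y)).const_add y
    have h2 : HasFDerivAt g (fderiv ℝ g (y + t • (z - y))) (y + t • (z - y)) :=
      ((hg.differentiable (by simp)) _).hasFDerivAt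
    have h3 := (hasDerivAt_pow d t).mul (h2.comp_hasDerivAt t h1)
    convert! h3 using 1
    simp only [add_sub_cancel_left, map_smul, smul_eq_mul, Function.comp_apply]
    have : t ^ d = t ^ (d - 1) * t := by rw [← pow_succ]; congr 1; omega
    rw [this]; ring
  have hgc := hg.continuous
  have hcont : Continuous fun t : ℝ => t ^ (d - 1) * (d * g (y + t • (z - y)) +
        fderiv ℝ g (y + t • (z - y)) (y + t • (z - y) - y)) := by fun_prop
  have := intervalIntegral.integral_eq_sub_of_hasDerivAt (a := 0) (b := 1) (fun t _ => hder t)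
    (hcont.intervalIntegrable _ _)
  rw [intervalIntegral.integral_of_le zero_le_one, integral_Ioc_eq_integral_Ioo] at this
  simp only [mul_assoc, integral_const_mul]
  rw [this]
  simp [zero_pow hd.ne']

end cone

/-! ### The divergence theorem -/

section divergence
variable {T : Set (E d)} {x0 : E d} {s : ℝ}

/-- A finite family of flat faces covering the boundary of a star-shaped domain, with their unit
outer normal vectors. -/
structure IsPolyBoundary (T : Set (E d)) (x0 : E d) (s : ℝ) (F : Finset (Set (E d)))
    (n : Set (E d) → E d) (a : Set (E d) → ℝ) : Prop where
  star : IsStarDomain T x0 s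
  cover : frontier T = ⋃ e ∈ F, e
  overlap : ∀ e ∈ F, ∀ e' ∈ F, e ≠ e' → surf d (e ∩ e') = 0
  compact : ∀ e ∈ F, IsCompact e
  unit : ∀ e ∈ F, ‖n e‖ = 1
  flat : ∀ e ∈ F, ∀ z ∈ e, inner ℝ (n e) z = a e
  outer : ∀ e ∈ F, ∀ y ∈ Metric.ball x0 s, inner ℝ (n e) y < a e

variable {F : Finset (Set (E d))} {n : Set (E d) → E d} {a : Set (E d) → ℝ}

theorem IsPolyBoundary.subset (h : IsPolyBoundary T x0 s F n a) {e : Set (E d)} (he : e ∈ F) :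
    e ⊆ frontier T := by
  rw [h.cover]; exact Set.subset_biUnion_of_mem (u := fun e => e) he

/-- The perpendicular from `y` to the hyperplane of a face has length `a e - inner (n e) y`,
positive because ball points lie strictly on the inner side. It is the vector `v` that the cone
lemmas ask for. -/
theorem IsPolyBoundary.foot (h : IsPolyBoundary T x0 s F n a) {e : Set (E d)} (he : e ∈ F)
    {y : E d} (hy : y ∈ Metric.ball x0 s) :
    (a e - inner ℝ (n e) y) • n e ≠ 0 ∧ ‖(a e - inner ℝ (n e) y) • n e‖ = a e - inner ℝ (n e) y ∧
    ∀ z ∈ e, inner ℝ ((a e - inner ℝ (n e) y) • n e) (z - y) =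
      ‖(a e - inner ℝ (n e) y) • n e‖ ^ 2 := by
  have h1 := h.outer e he y hy
  have h2 : ‖(a e - inner ℝ (n e) y) • n e‖ = a e - inner ℝ (n e) y := by
    rw [norm_smul, h.unit e he, mul_one, Real.norm_eq_abs, abs_of_pos (by linarith)]
  refine ⟨?_, h2, fun z hz => ?_⟩
  · rw [← norm_pos_iff, h2]; linarith
  · rw [h2, real_inner_smul_left, inner_sub_right, h.flat e he z hz]; ring

theorem IsPolyBoundary.surf_lt_top (h : IsPolyBoundary T x0 s F n a) {e : Set (E d)} (he : e ∈ F) :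
    surf d e < ⊤ := by
  obtain ⟨h1, -, h3⟩ := h.foot he (Metric.mem_ball_self h.star.pos)
  exact NCVEM.surf_lt_top h1 h3 (h.compact e he).measurableSet (h.compact e he).isBounded

theorem IsPolyBoundary.surf_frontier_lt_top (h : IsPolyBoundary T x0 s F n a) :
    surf d (frontier T) < ⊤ := by
  rw [h.cover]
  exact measure_biUnion_lt_top F.finite_toSet fun e he => h.surf_lt_top he

/-- By `exists_frontier`, every point of `T` except possibly the apex lies on an open segment from
`y` to some face. The apex is a null set since `0 < d`. -/
theorem IsPolyBoundary.ae_eq_cones (h : IsPolyBoundary T x0 s F n a) (hd : 0 < d) {y : E d}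
    (hy : y ∈ Metric.ball x0 s) : (⋃ e ∈ F, cone y e : Set (E d)) =ᵐ[volume] T := by
  have hsub : (⋃ e ∈ F, cone y e : Set (E d)) ⊆ T := by
    refine Set.iUnion₂_subset fun e he => ?_
    rintro p ⟨t, ht, z, hz, rfl⟩
    exact h.star.mem_of_closure hy (frontier_subset_closure (h.subset he hz)) ht.1.le ht.2
  have : Nonempty (Fin d) := ⟨⟨0, hd⟩⟩
  have h0 : volume ({y} : Set (E d)) = 0 := measure_singleton y
  have hsup : T ⊆ (⋃ e ∈ F, cone y e : Set (E d)) ∪ {y} := by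
    intro x hx
    by_cases hxy : x = y
    · exact Or.inr hxy
    left
    obtain ⟨z, hz, t, ht, e1⟩ := h.star.exists_frontier hx hxy
    rw [h.cover] at hz
    simp only [Set.mem_iUnion] at hz ⊢
    obtain ⟨e, he, hze⟩ := hz
    exact ⟨e, he, t, ht, z, hze, e1⟩
  refine hsub.eventuallyLE.antisymm ?_
  refine ae_le_set.2 (measure_mono_null (fun x hx => ?_) h0)
  rcases hsup hx.1 with h1 | h1
  · exact absurd h1 hx.2
  · exact h1

/-- Rays from `y` meet the boundary once, so every slice of the intersection lies over `e ∩ e'`,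
which has surface measure zero. -/
theorem IsPolyBoundary.cones_aedisjoint (h : IsPolyBoundary T x0 s F n a) {y : E d}
    (hy : y ∈ Metric.ball x0 s) {e e' : Set (E d)} (he : e ∈ F) (he' : e' ∈ F) (hne : e ≠ e') :
    volume (cone y e ∩ cone y e') = 0 := by
  obtain ⟨h1, h2, h3⟩ := h.foot he hy
  obtain ⟨h1', h2', h3'⟩ := h.foot he' hy
  rw [Set.inter_comm, volume_inter_cone h1 h3 (h.compact e he).measurableSet
    (measurableSet_cone h1' h3' (h.compact e' he').measurableSet)]
  refine (setLIntegral_congr_fun measurableSet_Ioo (g := fun _ => 0) fun t ht => ?_).trans (by simp)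
  simp only
  have : e ∩ (fun z => y + t • (z - y)) ⁻¹' cone y e' ⊆ e ∩ e' := by
    rintro z ⟨hz, t', ht', z', hz', e1⟩
    have := h.star.frontier_unique hy (h.subset he hz) (h.subset he' hz') ht.1 ht'.1 e1
    exact ⟨hz, this ▸ hz'⟩
  rw [measure_mono_null this (h.overlap e he e' he' hne), mul_zero]

theorem IsPolyBoundary.radial (h : IsPolyBoundary T x0 s F n a) (hd : 0 < d) {y : E d}
    (hy : y ∈ Metric.ball x0 s) {g : E d → ℝ} (hg : ContDiff ℝ ∞ g) :
    ∫ x in T, (d * g x + fderiv ℝ g x (x - y)) =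
      ∑ e ∈ F, (a e - inner ℝ (n e) y) * ∫ z in e, g z ∂(surf d) := by
  have hg' : Continuous (fderiv ℝ g) := hg.continuous_fderiv (by simp)
  have hgc := hg.continuous
  rw [← setIntegral_congr_set (h.ae_eq_cones hd hy)]
  rw [setIntegral_biUnion_finset₀]
  · refine Finset.sum_congr rfl fun e he => ?_
    obtain ⟨h1, h2, h3⟩ := h.foot he hy
    rw [setIntegral_cone_div hd h1 h3 (h.compact e he).measurableSet (h.compact e he).isBounded hg,
      h2]
  · intro e he
    obtain ⟨h1, h2, h3⟩ := h.foot he hy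
    exact (measurableSet_cone h1 h3 (h.compact e he).measurableSet)
  · exact fun e he e' he' hne => h.cones_aedisjoint hy he he' hne
  · intro e he
    obtain ⟨h1, h2, h3⟩ := h.foot he hy
    have hb := isBounded_cone (y := y) (h.compact e he).isBounded
    exact memLp_one_iff_integrable.1 (memLp_of_continuous hb hb.measure_lt_top
      (measurableSet_cone h1 h3 (h.compact e he).measurableSet) (by fun_prop) 1)

/-- The divergence theorem for a smooth function on a star-shaped polytope. -/
theorem IsPolyBoundary.integral_pd (h : IsPolyBoundary T x0 s F n a) {g : E d → ℝ}
    (hg : ContDiff ℝ ∞ g) (i : Fin d) :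
    ∫ x in T, pd i g x = ∑ e ∈ F, n e i * ∫ z in e, g z ∂(surf d) := by
  have hd : 0 < d := Fin.pos i
  have hg' : Continuous (fderiv ℝ g) := hg.continuous_fderiv (by simp)
  have hgc := hg.continuous
  have hs := h.star.pos
  set u : E d := EuclideanSpace.single i (1 : ℝ) with hu
  -- A second apex in the ball. The identity `radial` is affine in the apex, so subtracting its
  -- instances at `x0` and here isolates `(s / 2) * pd i g` inside and `(s / 2) * n e i` on the
  -- faces.
  have hy : x0 - (s / 2) • u ∈ Metric.ball x0 s := by
    rw [mem_ball_iff_norm, sub_sub_cancel_left, norm_neg, norm_smul, hu]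
    simp [abs_of_pos hs, hs]
  have hint : ∀ y : E d, Integrable (fun x => d * g x + fderiv ℝ g x (x - y)) (volume.restrict T) :=
    fun y => memLp_one_iff_integrable.1 (memLp_of_continuous h.star.bounded
      h.star.bounded.measure_lt_top h.star.isOpen.measurableSet (by fun_prop) 1)
  have e1 := h.radial hd hy hg
  have e2 := h.radial hd (Metric.mem_ball_self hs) hg
  have e3 : ∫ x in T, (s / 2) * pd i g x = (∑ e ∈ F, (s / 2) * (n e i * ∫ z in e, g z ∂(surf d))) := by
    calc ∫ x in T, (s / 2) * pd i g x
        = ∫ x in T, ((d * g x + fderiv ℝ g x (x - (x0 - (s / 2) • u))) -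
            (d * g x + fderiv ℝ g x (x - x0))) := by
          refine integral_congr_ae (.of_forall fun x => ?_)
          have : x - (x0 - (s / 2) • u) = (x - x0) + (s / 2) • u := by abel
          simp only
          rw [this, map_add, map_smul, smul_eq_mul]
          change (s / 2) * fderiv ℝ g x u = _
          ring
      _ = _ := by
          rw [integral_sub (hint _) (hint _), e1, e2, ← Finset.sum_sub_distrib]
          refine Finset.sum_congr rfl fun e _ => ?_
          have : inner ℝ (n e) (x0 - (s / 2) • u) = inner ℝ (n e) x0 - (s / 2) * n e i := by
            rw [inner_sub_right, real_inner_smul_right, hu, EuclideanSpace.inner_single_right]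
            simp
          rw [this]; ring
  rw [integral_const_mul, ← Finset.mul_sum] at e3
  exact mul_left_cancel₀ (by positivity) e3

end divergence

/-! ### Faces of a mesh -/

theorem IsFlatPolytope.isCompact {e : Set (E d)} (h : IsFlatPolytope e) : IsCompact e := by
  obtain ⟨-, -, S, -, rfl⟩ := h
  exact S.finite_toSet.isCompact_biUnion fun p _ => (Set.finite_range p).isCompact_convexHull ℝ

/-- A flat polytope contains a point around which it contains all points of its hyperplane. -/
theorem IsFlatPolytope.exists_normal {e : Set (E d)} (h : IsFlatPolytope e) :
    ∃ (n : E d) (a : ℝ), ‖n‖ = 1 ∧ (∀ z ∈ e, inner ℝ n z = a) ∧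
      ∃ c ∈ e, ∀ y, inner ℝ n y = a → ∃ τ ∈ Set.Ioo (0 : ℝ) 1, c + τ • (y - c) ∈ e := by
  obtain ⟨hc, hdim, S, hS, rfl⟩ := h
  set e : Set (E d) := ⋃ p ∈ S, convexHull ℝ (Set.range p) with he
  obtain ⟨z0, hz0⟩ := hc.nonempty
  have hz0' := hz0
  simp only [he, Set.mem_iUnion] at hz0'
  obtain ⟨p, hp, -⟩ := hz0'
  have hd : 0 < d := by omega
  have hpe : convexHull ℝ (Set.range p) ⊆ e :=
    Set.subset_biUnion_of_mem (u := fun p : Fin d → E d => convexHull ℝ (Set.range p)) hp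
  have hpr : Set.range p ⊆ e := (subset_convexHull ℝ _).trans hpe
  -- the normal vector
  have hfr : Module.finrank ℝ (vectorSpan ℝ e)ᗮ = 1 := by
    have := (vectorSpan ℝ e).finrank_add_finrank_orthogonal
    rw [finrank_euclideanSpace_fin] at this
    omega
  have hnt : Nontrivial (vectorSpan ℝ e)ᗮ := Module.nontrivial_of_finrank_pos (R := ℝ) (by omega)
  obtain ⟨n, hn⟩ := exists_norm_eq (vectorSpan ℝ e)ᗮ zero_le_one
  have hnorm : ‖(n : E d)‖ = 1 := hn
  have hflat : ∀ z ∈ e, inner ℝ (n : E d) z = inner ℝ (n : E d) z0 := by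
    intro z hz
    have h1 : z -ᵥ z0 ∈ vectorSpan ℝ e := vsub_mem_vectorSpan ℝ hz hz0
    have h2 := (Submodule.mem_orthogonal' _ _).1 n.2 _ h1
    rw [vsub_eq_sub, inner_sub_right] at h2
    linarith
  refine ⟨n, inner ℝ (n : E d) z0, hnorm, hflat, ?_⟩
  -- the centroid of one simplex
  have hd' : (0 : ℝ) < d := by exact_mod_cast hd
  set c : E d := ∑ i, (d : ℝ)⁻¹ • p i with hcdef
  have hce : c ∈ convexHull ℝ (Set.range p) := by
    refine (convex_convexHull ℝ _).sum_mem (fun _ _ => by positivity) ?_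
      (fun i _ => subset_convexHull ℝ _ ⟨i, rfl⟩)
    simp [hd'.ne']
  refine ⟨c, hpe hce, fun y hy => ?_⟩
  have hle : vectorSpan ℝ (Set.range p) ≤ vectorSpan ℝ e := vectorSpan_mono ℝ hpr
  have heq : vectorSpan ℝ (Set.range p) = vectorSpan ℝ e := by
    refine Submodule.eq_of_le_of_finrank_eq hle ?_
    rw [(hS p hp).finrank_vectorSpan (n := d - 1) (by simp; omega)]
    omega
  have horth : vectorSpan ℝ e = (Submodule.span ℝ {(n : E d)})ᗮ := by
    refine Submodule.eq_of_le_of_finrank_eq (fun w hw => ?_) ?_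
    · rw [Submodule.mem_orthogonal_singleton_iff_inner_right]
      exact (Submodule.mem_orthogonal' _ _).1 n.2 _ hw
    · have h1 := (Submodule.span ℝ {(n : E d)}).finrank_add_finrank_orthogonal
      rw [finrank_euclideanSpace_fin, finrank_span_singleton (by
        intro h0; rw [h0] at hnorm; simp at hnorm)] at h1
      omega
  have hyspan : y ∈ affineSpan ℝ (Set.range p) := by
    have h1 : y - p ⟨0, hd⟩ ∈ vectorSpan ℝ (Set.range p) := by
      rw [heq, horth, Submodule.mem_orthogonal_singleton_iff_inner_right, inner_sub_right, hy,
        hflat _ (hpr ⟨_, rfl⟩), sub_self]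
    have h2 : p ⟨0, hd⟩ ∈ affineSpan ℝ (Set.range p) := mem_affineSpan ℝ ⟨_, rfl⟩
    have := AffineSubspace.vadd_mem_of_mem_direction (by rwa [direction_affineSpan]) h2
      (v := y - p ⟨0, hd⟩)
    simpa using this
  obtain ⟨w, hw1, hwy⟩ := eq_affineCombination_of_mem_affineSpan_of_fintype hyspan
  have hwy' : y = ∑ i, w i • p i := by
    rw [hwy, Finset.univ.affineCombination_eq_linear_combination p w hw1]
  obtain ⟨W, hW⟩ := (Set.finite_range fun i => |w i|).bddAbove
  have hW' : ∀ i, |w i| ≤ W := fun i => hW ⟨i, rfl⟩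
  have hW0 : 0 ≤ W := (abs_nonneg _).trans (hW' ⟨0, hd⟩)
  -- Chosen so that `1 - τ = τ * d * (W + 1)`. The centroid has barycentric coordinates `1 / d`, so
  -- those of `c + τ • (y - c)` are `τ * (W + 1 + w i)`, nonnegative by `|w i| ≤ W`.
  set τ : ℝ := (1 + d * (W + 1))⁻¹ with hτ
  have hden : 1 < 1 + d * (W + 1) := by nlinarith
  have hτ0 : 0 < τ := by positivity
  have hτ1 : τ < 1 := inv_lt_one_of_one_lt₀ hden
  refine ⟨τ, ⟨hτ0, hτ1⟩, hpe ?_⟩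
  have hexp : c + τ • (y - c) = ∑ i, ((1 - τ) * (d : ℝ)⁻¹ + τ * w i) • p i := by
    have : c + τ • (y - c) = (1 - τ) • c + τ • y := by module
    rw [this, hcdef, hwy', Finset.smul_sum, Finset.smul_sum, ← Finset.sum_add_distrib]
    refine Finset.sum_congr rfl fun i _ => ?_
    rw [add_smul, mul_smul, mul_smul]
  rw [hexp]
  refine (convex_convexHull ℝ _).sum_mem (fun i _ => ?_) ?_
    (fun i _ => subset_convexHull ℝ _ ⟨i, rfl⟩)
  · have h1 : -W ≤ w i := (neg_le_neg (hW' i)).trans (neg_abs_le _)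
    have h2 : (1 - τ) = τ * (d * (W + 1)) := by
      rw [hτ]; field_simp; ring
    rw [h2]
    have : τ * (d * (W + 1)) * (d : ℝ)⁻¹ = τ * (W + 1) := by field_simp
    rw [this]; nlinarith
  · rw [Finset.sum_add_distrib, ← Finset.mul_sum, ← Finset.mul_sum, hw1]
    simp [hd'.ne']

/-- A flat polytope in the boundary of a star-shaped domain has an outer unit normal vector. -/
theorem IsFlatPolytope.exists_outer {e T : Set (E d)} {x0 : E d} {s : ℝ} (h : IsFlatPolytope e)
    (hT : IsStarDomain T x0 s) (he : e ⊆ frontier T) :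
    ∃ q : E d × ℝ, ‖q.1‖ = 1 ∧ (∀ z ∈ e, inner ℝ q.1 z = q.2) ∧
      ∀ y ∈ Metric.ball x0 s, inner ℝ q.1 y < q.2 := by
  obtain ⟨n, a, hn, hflat, c, hc, hy⟩ := h.exists_normal
  -- If the hyperplane of `e` met the ball at `y`, a point strictly between `y` and `c` would lie in
  -- `e`, hence on the boundary, while star-shapedness puts it in `T`.
  have hne : ∀ y ∈ Metric.ball x0 s, inner ℝ n y ≠ a := by
    intro y hyB hya
    obtain ⟨τ, hτ, hmem⟩ := hy y hya
    refine hT.notMem_frontier ?_ (he hmem)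
    have := hT.mem_of_closure hyB (frontier_subset_closure (he hc)) (t := 1 - τ)
      (by linarith [hτ.2]) (by linarith [hτ.1])
    convert! this using 1
    module
  have hcont : ContinuousOn (fun y : E d => inner ℝ n y) (Metric.ball x0 s) := by fun_prop
  have hx0 := Metric.mem_ball_self (x := x0) hT.pos
  have hpc : IsPreconnected (Metric.ball x0 s) := (convex_ball x0 s).isPreconnected
  -- The height over the hyperplane does not vanish on the connected ball, so its sign is constant;
  -- it decides between `n` and `-n`.
  rcases lt_or_gt_of_ne (hne x0 hx0) with h0 | h0
  · refine ⟨(n, a), hn, hflat, fun y hyB => ?_⟩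
    by_contra h1
    obtain ⟨z, hz, hz'⟩ := hpc.intermediate_value hx0 hyB hcont ⟨h0.le, not_lt.1 h1⟩
    exact hne z hz hz'
  · refine ⟨(-n, -a), by simpa using hn, fun z hz => by simp [hflat z hz], fun y hyB => ?_⟩
    by_contra h1
    rw [inner_neg_left, neg_lt_neg_iff, not_lt] at h1
    obtain ⟨z, hz, hz'⟩ := hpc.intermediate_value hyB hx0 hcont ⟨h1, h0.le⟩
    exact hne z hz hz'

theorem diam_pos (hd : 0 < d) {T : Set (E d)} (hT : IsOpen T) (hb : Bornology.IsBounded T)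
    (hne : T.Nonempty) : 0 < Metric.diam T := by
  have : Nonempty (Fin d) := ⟨⟨0, hd⟩⟩
  have : Nontrivial (E d) := inferInstance
  obtain ⟨x, hx⟩ := hne
  obtain ⟨y, hy, hxy⟩ := (hT.mem_nhds hx |> infinite_of_mem_nhds x).exists_notMem_finset {x}
  exact Metric.diam_pos ⟨x, hx, y, hy, fun h => hxy (by simp [h])⟩ hb

/-- The passage from mesh assumptions to the local geometry. The ball is shrunk to radius exactly `ρ
* diam T`, so that later constants depend on the element only through `ρ`. -/
theorem Mesh.ShapeRegular.isPolyBoundary {Ω : Set (E d)} {M : Mesh Ω} {ρ : ℝ}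
    (hM : M.ShapeRegular ρ) (hd : 0 < d) (hρ : 0 < ρ) (hΩ : Bornology.IsBounded Ω) {T : Set (E d)}
    (hT : T ∈ M.elems) :
    ∃ x0 n a, IsPolyBoundary T x0 (ρ * Metric.diam T) (M.facesOf T) n a := by
  obtain ⟨x0, r, hr, hstar⟩ := hM.z2 T hT
  have hb := hΩ.subset (M.subset T hT)
  have hne := (M.isConnected T hT).nonempty
  have hD := diam_pos hd (M.isOpen T hT) hb hne
  have hS : IsStarDomain T x0 (ρ * Metric.diam T) :=
    ⟨M.isOpen T hT, hb, hne, by positivity,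
      fun y hy => hstar y (Metric.ball_subset_ball hr hy)⟩
  have hface : ∀ e ∈ M.facesOf T, e ∈ M.faces ∧ e ⊆ frontier T := fun e he => by
    simpa [Mesh.facesOf] using he
  have hex : ∀ e : Set (E d), ∃ q : E d × ℝ, e ∈ M.facesOf T → (‖q.1‖ = 1 ∧
      (∀ z ∈ e, inner ℝ q.1 z = q.2) ∧
      ∀ y ∈ Metric.ball x0 (ρ * Metric.diam T), inner ℝ q.1 y < q.2) := by
    intro e
    by_cases he : e ∈ M.facesOf T
    · obtain ⟨q, hq⟩ := (M.flat e (hface e he).1).exists_outer hS (hface e he).2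
      exact ⟨q, fun _ => hq⟩
    · exact ⟨0, fun h => absurd h he⟩
  choose q hq using hex
  refine ⟨x0, fun e => (q e).1, fun e => (q e).2, hS, ?_, ?_, ?_, ?_, ?_, ?_⟩
  · conv_lhs => rw [M.frontier_eq T hT]
    ext x; simp [Mesh.facesOf]
  · exact fun e he e' he' => M.overlap e (hface e he).1 e' (hface e' he').1
  · exact fun e he => (M.flat e (hface e he).1).isCompact
  · exact fun e he => (hq e he).1
  · exact fun e he => (hq e he).2.1
  · exact fun e he => (hq e he).2.2

/-! ### Green's formula for polynomials -/

theorem Poly_zero_mem (m : ℤ) : (fun _ => 0) ∈ Poly d m :=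
  mem_Poly_iff.2 ⟨0, Or.inl rfl, by funext x; simp [polyFun]⟩

theorem Poly_add {m : ℤ} {f g : E d → ℝ} (hf : f ∈ Poly d m) (hg : g ∈ Poly d m) :
    (fun x => f x + g x) ∈ Poly d m := by
  obtain ⟨p, hp, rfl⟩ := mem_Poly_iff.1 hf
  obtain ⟨q, hq, rfl⟩ := mem_Poly_iff.1 hg
  refine mem_Poly_iff.2 ⟨p + q, ?_, by funext x; simp [polyFun]⟩
  rcases hp with rfl | hp
  · simpa using hq
  rcases hq with rfl | hq
  · simpa using Or.inr hp
  · right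
    refine le_trans (Int.ofNat_le.2 (MvPolynomial.totalDegree_add p q)) ?_
    push_cast; exact max_le hp hq

theorem Poly_const_mul {m : ℤ} {f : E d → ℝ} (a : ℝ) (hf : f ∈ Poly d m) :
    (fun x => a * f x) ∈ Poly d m := by
  obtain ⟨p, hp, rfl⟩ := mem_Poly_iff.1 hf
  refine mem_Poly_iff.2 ⟨a • p, ?_, by funext x; simp [polyFun]⟩
  rcases hp with rfl | hp
  · left; simp
  · right; exact le_trans (Int.ofNat_le.2 (MvPolynomial.totalDegree_smul_le a p)) hp

theorem Poly_sum {ι : Type*} {m : ℤ} (S : Finset ι) {f : ι → E d → ℝ}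
    (hf : ∀ i ∈ S, f i ∈ Poly d m) : (fun x => ∑ i ∈ S, f i x) ∈ Poly d m := by
  classical
  induction S using Finset.induction_on with
  | empty => simpa using Poly_zero_mem m
  | insert i S hi ih =>
    simp only [Finset.sum_insert hi]
    exact Poly_add (hf i (by simp)) (ih fun j hj => hf j (by simp [hj]))

theorem Poly_pd {m : ℤ} {f : E d → ℝ} (i : Fin d) (hf : f ∈ Poly d m) : pd i f ∈ Poly d (m - 1) := by
  obtain ⟨p, hp, rfl⟩ := mem_Poly_iff.1 hf
  rw [pd_polyFun]
  exact polyFun_mem (totalDegree_pderiv_le i hp)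

theorem Poly_contDiff {m : ℤ} {f : E d → ℝ} (hf : f ∈ Poly d m) : ContDiff ℝ ∞ f := by
  obtain ⟨p, hp, rfl⟩ := mem_Poly_iff.1 hf
  exact contDiff_polyFun p

theorem Poly_memH {T : Set (E d)} (hT : IsOpen T) (hb : Bornology.IsBounded T) (n : ℕ) {m : ℤ}
    {f : E d → ℝ} (hf : f ∈ Poly d m) : MemH n T f := by
  obtain ⟨p, hp, rfl⟩ := mem_Poly_iff.1 hf
  exact memH_polyFun hT hb n p

theorem Poly_wgrad {T : Set (E d)} (hT : IsOpen T) (hb : Bornology.IsBounded T) {m : ℤ}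
    {f : E d → ℝ} (hf : f ∈ Poly d m) : wgrad T f =ᵐ[volume.restrict T] gradient f := by
  obtain ⟨p, hp, rfl⟩ := mem_Poly_iff.1 hf
  exact wgrad_polyFun hT hb p

theorem pd_mul {f g : E d → ℝ} (hf : ContDiff ℝ ∞ f) (hg : ContDiff ℝ ∞ g) (i : Fin d) (x : E d) :
    pd i (fun x => f x * g x) x = f x * pd i g x + pd i f x * g x := by
  unfold pd
  rw [fderiv_fun_mul ((hf.differentiable (by simp)) x) ((hg.differentiable (by simp)) x)]
  simp [mul_comm]

section green
variable {T : Set (E d)} {x0 : E d} {s : ℝ} {F : Finset (Set (E d))} {n : Set (E d) → E d}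
  {a : Set (E d) → ℝ}

/-- Green's formula for smooth functions. -/
theorem IsPolyBoundary.green (h : IsPolyBoundary T x0 s F n a) {f w : E d → ℝ}
    (hf : ContDiff ℝ ∞ f) (hw : ContDiff ℝ ∞ w) :
    (∫ x in T, inner ℝ (gradient f x) (gradient w x)) + ∫ x in T, (∑ i, pd i (pd i f) x) * w x =
      ∑ e ∈ F, ∫ x in e, (∑ i, n e i * pd i f x) * w x ∂(surf d) := by
  have hint : ∀ {f : E d → ℝ}, Continuous f → Integrable f (volume.restrict T) := fun hf =>
    memLp_one_iff_integrable.1 (memLp_of_continuous h.star.bounded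
      h.star.bounded.measure_lt_top h.star.isOpen.measurableSet hf 1)
  have hpw : ∀ i, Continuous (pd i w) := fun i => (contDiff_pd hw i).continuous
  have hpf : ∀ i, Continuous (pd i f) := fun i => (contDiff_pd hf i).continuous
  have hpf2 : ∀ i, Continuous (pd i (pd i f)) := fun i => (contDiff_pd (contDiff_pd hf i) i).continuous
  have hwc := hw.continuous
  have e1 : ∀ x, inner ℝ (gradient f x) (gradient w x) = ∑ i, pd i f x * pd i w x := fun x => by
    rw [PiLp.inner_apply]
    simp [gradient_apply, mul_comm]
  simp only [e1]
  rw [← integral_add (hint (by fun_prop)) (hint (by fun_prop))]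
  have e2 : ∀ x, (∑ i, pd i f x * pd i w x) + (∑ i, pd i (pd i f) x) * w x =
      ∑ i, pd i (fun x => pd i f x * w x) x := fun x => by
    rw [Finset.sum_mul, ← Finset.sum_add_distrib]
    exact Finset.sum_congr rfl fun i _ => (pd_mul (contDiff_pd hf i) hw i x).symm
  simp only [e2]
  rw [integral_finsetSum _ fun i _ => hint (contDiff_pd ((contDiff_pd hf i).mul hw) i).continuous]
  simp only [h.integral_pd ((contDiff_pd hf _).mul hw)]
  rw [Finset.sum_comm]
  refine Finset.sum_congr rfl fun e he => ?_
  have hie : ∀ i, Integrable (fun x => pd i f x * w x) ((surf d).restrict e) := fun i =>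
    memLp_one_iff_integrable.1 (memLp_of_continuous (h.compact e he).isBounded
      (h.surf_lt_top he) (h.compact e he).measurableSet (by fun_prop) 1)
  simp only [← integral_const_mul]
  rw [← integral_finsetSum _ fun i _ => (hie i).const_mul _]
  refine integral_congr_ae (.of_forall fun x => ?_)
  simp only [Finset.sum_mul, mul_assoc]

/-- The Laplacian lowers the degree by two and, the normal being constant on a flat face, the normal
derivative is polynomial of degree one less. This is why `u_I - u_Π` stays in the local space. -/
theorem IsPolyBoundary.memVLoc_of_poly (h : IsPolyBoundary T x0 s F n a) {k : ℕ} {f : E d → ℝ}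
    (hf : f ∈ Poly d k) : MemVLoc k T F f := by
  refine ⟨Poly_memH h.star.isOpen h.star.bounded 1 hf, fun x => ∑ i, pd i (pd i f) x, ?_,
    fun e x => ∑ i, n e i * pd i f x, ?_, fun w hw => ?_⟩
  · refine Poly_sum _ fun i _ => ?_
    have := Poly_pd i (Poly_pd i hf)
    rwa [sub_sub] at this
  · exact fun e _ => Poly_sum _ fun i _ => Poly_const_mul _ (Poly_pd i hf)
  · rw [← h.green (Poly_contDiff hf) hw]
    congr 1
    refine integral_congr_ae ?_
    filter_upwards [Poly_wgrad h.star.isOpen h.star.bounded hf] with x hx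
    rw [hx]

end green

/-! ### The Poincaré inequality for smooth functions -/

/-- A linear change of variables; its Jacobian factor `c ^ (-d)` is at most `2 ^ d` because `c ≥ 1 /
2`. -/
theorem setLIntegral_comp_affine_le {B S : Set (E d)} (hS : MeasurableSet S) (b : E d) {c : ℝ}
    (hc : 1 / 2 ≤ c) (hBS : ∀ y ∈ B, b + c • y ∈ S) {f : E d → ENNReal} (hf : Measurable f)
    (hB : MeasurableSet B) :
    ∫⁻ y in B, f (b + c • y) ≤ 2 ^ d * ∫⁻ z in S, f z := by
  have hc0 : c ≠ 0 := by linarith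
  calc ∫⁻ y in B, f (b + c • y) ≤ ∫⁻ y in B, S.indicator f (b + c • y) := by
        refine setLIntegral_mono' hB fun y hy => ?_
        rw [Set.indicator_of_mem (hBS y hy)]
    _ ≤ ∫⁻ y, S.indicator f (b + c • y) := setLIntegral_le_lintegral _ _
    _ = ∫⁻ z, S.indicator f (b + z) ∂(Measure.map (fun y : E d => c • y) volume) := by
        have hm : Measurable fun z => S.indicator f (b + z) :=
          (hf.indicator hS).comp (measurable_const_add b)
        rw [lintegral_map hm (measurable_const_smul c)]
    _ = ENNReal.ofReal |(c ^ d)⁻¹| * ∫⁻ z in S, f z := by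
        rw [Measure.map_addHaar_smul _ hc0, lintegral_smul_measure, smul_eq_mul,
          lintegral_add_left_eq_self, lintegral_indicator hS, finrank_euclideanSpace_fin]
    _ ≤ 2 ^ d * ∫⁻ z in S, f z := by
        gcongr
        rw [← inv_pow, abs_of_nonneg (by positivity), ENNReal.ofReal_pow (by positivity)]
        gcongr
        refine ENNReal.ofReal_le_of_le_toReal ?_
        rw [ENNReal.toReal_ofNat]
        exact inv_le_of_inv_le₀ (by norm_num) (by simpa using hc)

theorem sq_sub_le_integral_segment {v : E d → ℝ} (hv : ContDiff ℝ ∞ v) (x y : E d) :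
    (v x - v y) ^ 2 ≤ ‖x - y‖ ^ 2 * ∫ t in Set.Ioc (0 : ℝ) 1, ‖gradient v (y + t • (x - y))‖ ^ 2 := by
  have hg := continuous_gradient hv
  set μ := (volume : Measure ℝ).restrict (Set.Ioc 0 1) with hμ
  have hder : ∀ t : ℝ, HasDerivAt (fun t : ℝ => v (y + t • (x - y)))
      (inner ℝ (gradient v (y + t • (x - y))) (x - y)) t := fun t => by
    have h1 : HasDerivAt (fun t : ℝ => y + t • (x - y)) (x - y) t := by
      simpa using ((hasDerivAt_id t).smul_const (x - y)).const_add y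
    have h2 := ((hv.differentiable (by simp)) (y + t • (x - y))).hasFDerivAt.comp_hasDerivAt t h1
    convert! h2 using 1
    unfold gradient
    rw [InnerProductSpace.toDual_symm_apply]
  have hFTC := intervalIntegral.integral_eq_sub_of_hasDerivAt (a := 0) (b := 1)
    (fun t _ => hder t) ((by fun_prop : Continuous fun t : ℝ =>
      inner ℝ (gradient v (y + t • (x - y))) (x - y)).intervalIntegrable _ _)
  rw [intervalIntegral.integral_of_le zero_le_one, zero_smul, add_zero, one_smul,
    add_sub_cancel] at hFTC
  have hmem : MemLp (fun t : ℝ => gradient v (y + t • (x - y))) 2 μ := by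
    have hc : Continuous fun t : ℝ => gradient v (y + t • (x - y)) := by fun_prop
    obtain ⟨C, hC⟩ := (isCompact_Icc (a := (0 : ℝ)) (b := 1)).bddAbove_image hc.norm.continuousOn
    refine MemLp.of_bound hc.aestronglyMeasurable C ?_
    rw [ae_restrict_iff' measurableSet_Ioc]
    exact .of_forall fun t ht => hC ⟨t, Set.Ioc_subset_Icc_self ht, rfl⟩
  have h1 : MemLp (fun _ : ℝ => (x - y)) 2 μ := memLp_const _
  have h2 := integral_norm_mul_le_L2n (C := 1) zero_le_one hmem h1
    (B := fun t => inner ℝ (gradient v (y + t • (x - y))) (x - y))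
    (.of_forall fun t => by rw [one_mul]; exact abs_real_inner_le_norm _ _)
  rw [hFTC, one_mul] at h2
  have h3 : L2n μ (fun _ : ℝ => (x - y)) = ‖x - y‖ := by
    unfold L2n
    simp [hμ]
  rw [h3] at h2
  have h4 := pow_le_pow_left₀ (abs_nonneg _) h2 2
  rw [sq_abs, mul_pow, L2n_sq] at h4
  linarith

/-- Write `v x - v y` as an integral of the gradient along the segment and exchange integrals. For
`t ≤ 1 / 2` substitute in `y`, where the segment map contracts by `1 - t`; for `t ≥ 1 / 2`
substitute in `x`, where it contracts by `t`. Neither factor drops below 1/2. -/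
theorem poincare_smooth {A B S : Set (E d)} (hA : MeasurableSet A) (hB : MeasurableSet B)
    (hS : MeasurableSet S) (hseg : ∀ x ∈ A, ∀ y ∈ B, ∀ t ∈ Set.Icc (0 : ℝ) 1, y + t • (x - y) ∈ S)
    {h : ℝ} (hh : ∀ x ∈ A, ∀ y ∈ B, ‖x - y‖ ≤ h) {v : E d → ℝ} (hv : ContDiff ℝ ∞ v) :
    ∫⁻ x in A, ∫⁻ y in B, ENNReal.ofReal ((v x - v y) ^ 2) ≤
      ENNReal.ofReal (h ^ 2) * (2 ^ d * (volume A + volume B) *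
        ∫⁻ z in S, ENNReal.ofReal (‖gradient v z‖ ^ 2)) := by
  have hg := continuous_gradient hv
  set f : E d → ENNReal := fun z => ENNReal.ofReal (‖gradient v z‖ ^ 2) with hf
  have hfc : Continuous f := ENNReal.continuous_ofReal.comp (by fun_prop)
  have hfm : Measurable f := hfc.measurable
  have step1 : ∀ x ∈ A, ∀ y ∈ B, ENNReal.ofReal ((v x - v y) ^ 2) ≤
      ENNReal.ofReal (h ^ 2) * ∫⁻ t in Set.Ioc (0 : ℝ) 1, f (y + t • (x - y)) := by
    intro x hx y hy
    have hc : Continuous fun t : ℝ => ‖gradient v (y + t • (x - y))‖ ^ 2 := by fun_prop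
    rw [← ofReal_integral_eq_lintegral_ofReal ((hc.integrableOn_Icc).mono_set
      Set.Ioc_subset_Icc_self) (.of_forall fun _ => by positivity), ← ENNReal.ofReal_mul (by positivity)]
    refine ENNReal.ofReal_le_ofReal ((sq_sub_le_integral_segment hv x y).trans ?_)
    have := hh x hx y hy
    refine mul_le_mul_of_nonneg_right ?_ (integral_nonneg fun _ => by positivity)
    gcongr
  have hm3 : Measurable fun q : ℝ × E d × E d => f (q.2.2 + q.1 • (q.2.1 - q.2.2)) :=
    (hfc.comp (by fun_prop)).measurable
  calc ∫⁻ x in A, ∫⁻ y in B, ENNReal.ofReal ((v x - v y) ^ 2)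
      ≤ ∫⁻ x in A, ∫⁻ y in B, ENNReal.ofReal (h ^ 2) *
          ∫⁻ t in Set.Ioc (0 : ℝ) 1, f (y + t • (x - y)) :=
        setLIntegral_mono' hA fun x hx => setLIntegral_mono' hB fun y hy => step1 x hx y hy
    _ = ENNReal.ofReal (h ^ 2) * ∫⁻ t in Set.Ioc (0 : ℝ) 1, ∫⁻ x in A, ∫⁻ y in B,
          f (y + t • (x - y)) := by
        simp only [lintegral_const_mul' _ _ ENNReal.ofReal_ne_top]
        congr 1
        rw [lintegral_lintegral_swap (f := fun t x => ∫⁻ y in B, f (y + t • (x - y)))]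
        · refine lintegral_congr fun x => ?_
          rw [lintegral_lintegral_swap]
          exact (hfc.comp (by fun_prop : Continuous fun q : E d × ℝ =>
            q.1 + q.2 • (x - q.1))).measurable.aemeasurable
        · refine Measurable.aemeasurable ?_
          exact Measurable.lintegral_prod_right' (f := fun q : (ℝ × E d) × E d =>
            f (q.2 + q.1.1 • (q.1.2 - q.2))) (hfc.comp (by fun_prop)).measurable
    _ ≤ ENNReal.ofReal (h ^ 2) * ∫⁻ t in Set.Ioc (0 : ℝ) 1, 2 ^ d * (volume A + volume B) *
        ∫⁻ z in S, f z := by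
        gcongr 1
        refine setLIntegral_mono' measurableSet_Ioc fun t ht => ?_
        rcases le_total t (1 / 2) with h2 | h2
        · calc ∫⁻ x in A, ∫⁻ y in B, f (y + t • (x - y))
              ≤ ∫⁻ x in A, 2 ^ d * ∫⁻ z in S, f z := by
                refine setLIntegral_mono' hA fun x hx => ?_
                have e1 : ∀ y : E d, y + t • (x - y) = t • x + (1 - t) • y := fun y => by module
                simp only [e1]
                refine setLIntegral_comp_affine_le hS _ (by linarith) (fun y hy => ?_) hfm hB
                rw [← e1]; exact hseg x hx y hy t ⟨ht.1.le, ht.2⟩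
            _ = 2 ^ d * (volume A) * ∫⁻ z in S, f z := by
                rw [lintegral_const, Measure.restrict_apply_univ]; ring
            _ ≤ _ := by gcongr; exact le_self_add
        · calc ∫⁻ x in A, ∫⁻ y in B, f (y + t • (x - y))
              = ∫⁻ y in B, ∫⁻ x in A, f (y + t • (x - y)) := by
                rw [lintegral_lintegral_swap]
                exact (hfc.comp (by fun_prop : Continuous fun q : E d × E d =>
                  q.2 + t • (q.1 - q.2))).measurable.aemeasurable
            _ ≤ ∫⁻ y in B, 2 ^ d * ∫⁻ z in S, f z := by
                refine setLIntegral_mono' hB fun y hy => ?_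
                have e1 : ∀ x : E d, y + t • (x - y) = (1 - t) • y + t • x := fun x => by module
                simp only [e1]
                refine setLIntegral_comp_affine_le hS _ h2 (fun x hx => ?_) hfm hA
                rw [← e1]; exact hseg x hx y hy t ⟨ht.1.le, ht.2⟩
            _ = 2 ^ d * (volume B) * ∫⁻ z in S, f z := by
                rw [lintegral_const, Measure.restrict_apply_univ]; ring
            _ ≤ _ := by gcongr; exact le_add_self
    _ = _ := by
        rw [lintegral_const, Measure.restrict_apply_univ]; simp

/-! ### Mollification -/

/-- The mollification of `v` restricted to `T`. -/
def mollify (φ : ContDiffBump (0 : E d)) (T : Set (E d)) (v : E d → ℝ) : E d → ℝ :=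
  convolution (φ.normed volume) (T.indicator v) (ContinuousLinearMap.lsmul ℝ ℝ) volume

section mollify
variable {T : Set (E d)} {v : E d → ℝ} (φ : ContDiffBump (0 : E d))

theorem contDiff_mollify (hv : LocallyIntegrable (T.indicator v) volume) :
    ContDiff ℝ ∞ (mollify φ T v) :=
  φ.hasCompactSupport_normed.contDiff_convolution_left _ φ.contDiff_normed hv

theorem isTest_shift {x : E d} (hx : Metric.closedBall x φ.rOut ⊆ T) :
    IsTest T (fun z => φ.normed volume (x - z)) := by
  have hc : ContDiff ℝ ∞ (fun z => φ.normed volume (x - z)) :=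
    φ.contDiff_normed.comp (contDiff_const.sub contDiff_id)
  have hts : tsupport (fun z => φ.normed volume (x - z)) ⊆ Metric.closedBall x φ.rOut := by
    refine closure_minimal (fun z hz => ?_) Metric.isClosed_closedBall
    have h1 : x - z ∈ Function.support (φ.normed volume) := hz
    rw [φ.support_normed_eq, mem_ball_zero_iff] at h1
    rw [mem_closedBall_iff_norm, norm_sub_rev]
    exact h1.le
  exact ⟨hc, (isCompact_closedBall x _).of_isClosed_subset (isClosed_tsupport _) hts,
    hts.trans hx⟩

theorem pd_mollify (hv : LocallyIntegrable (T.indicator v) volume) (hT : MeasurableSet T)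
    (x : E d) (i : Fin d) :
    pd i (mollify φ T v) x = ∫ z in T, v z * pd i (φ.normed volume) (x - z) := by
  have hφ1 : ContDiff ℝ 1 (φ.normed (volume : Measure (E d))) := φ.contDiff_normed
  have hφc : HasCompactSupport (φ.normed (volume : Measure (E d))) := φ.hasCompactSupport_normed
  have h1 := hφc.hasFDerivAt_convolution_right (ContinuousLinearMap.lsmul ℝ ℝ).flip hv hφ1 x
  have h2 : mollify φ T v = convolution (T.indicator v) (φ.normed volume)
      (ContinuousLinearMap.lsmul ℝ ℝ).flip volume := (convolution_flip _).symm
  unfold pd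
  rw [h2, h1.fderiv, convolution_precompR_apply _ hv (hφc.fderiv ℝ)
    (hφ1.continuous_fderiv (by simp))]
  simp only [convolution, ContinuousLinearMap.flip_apply, ContinuousLinearMap.lsmul_apply,
    smul_eq_mul]
  rw [← integral_indicator hT]
  refine integral_congr_ae (.of_forall fun z => ?_)
  by_cases hz : z ∈ T <;> simp [hz, mul_comm]

/-- When the mollification ball around `x` stays in `T`, the shifted kernel is an admissible test
function. The sign from differentiating `x - z` cancels the one from the weak derivative, leaving
the mollified weak derivative. -/
theorem pd_mollify_eq (hv : MemH 1 T v) (hT : IsOpen T) (hb : Bornology.IsBounded T) {x : E d}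
    (hx : Metric.closedBall x φ.rOut ⊆ T) (i : Fin d) :
    pd i (mollify φ T v) x = ∫ z in T, wderiv T [i] v z * φ.normed volume (x - z) := by
  have hi : LocallyIntegrable (T.indicator v) volume :=
    ((integrable_indicator_iff hT.measurableSet).2 (hv.1.integrable hb)).locallyIntegrable
  have h1 := hv.hasWeakDeriv (L := [i]) le_rfl _ (isTest_shift φ hx)
  simp only [pds, List.length_singleton, pow_one] at h1
  rw [pd_mollify φ hi hT.measurableSet]
  have h2 : ∀ z, pd i (fun z => φ.normed volume (x - z)) z = - pd i (φ.normed volume) (x - z) := by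
    intro z
    unfold pd
    have e1 : HasFDerivAt (φ.normed volume) (fderiv ℝ (φ.normed volume) (x - z)) (x - z) :=
      ((φ.contDiff_normed (n := 1)).differentiable (by simp) _).hasFDerivAt
    have e2 := e1.comp z ((hasFDerivAt_id z).const_sub x)
    rw [show (fun z => φ.normed volume (x - z)) = φ.normed volume ∘ (fun z => x - z) from rfl]
    erw [e2.fderiv]
    simp
  simp only [h2, mul_neg, integral_neg] at h1
  linarith

/-- Jensen's inequality for a probability density `ψ`, obtained from the nonnegativity of the
variance. -/
theorem sq_integral_mul_le {α : Type*} [MeasurableSpace α] {μ : Measure α} {g ψ : α → ℝ}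
    (h0 : ∀ x, 0 ≤ ψ x) (h1 : ∫ x, ψ x ∂μ = 1) (i0 : Integrable ψ μ)
    (i1 : Integrable (fun x => g x * ψ x) μ) (i2 : Integrable (fun x => g x ^ 2 * ψ x) μ) :
    (∫ x, g x * ψ x ∂μ) ^ 2 ≤ ∫ x, g x ^ 2 * ψ x ∂μ := by
  set m := ∫ x, g x * ψ x ∂μ with hm
  have h2 : 0 ≤ ∫ x, (g x - m) ^ 2 * ψ x ∂μ :=
    integral_nonneg fun x => mul_nonneg (sq_nonneg _) (h0 x)
  have h3 : ∫ x, (g x - m) ^ 2 * ψ x ∂μ = (∫ x, g x ^ 2 * ψ x ∂μ) - 2 * m * m + m ^ 2 * 1 := by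
    have : ∀ x, (g x - m) ^ 2 * ψ x = g x ^ 2 * ψ x - 2 * m * (g x * ψ x) + m ^ 2 * ψ x := by
      intro x; ring
    simp only [this]
    have i3 : Integrable (fun x => g x ^ 2 * ψ x - 2 * m * (g x * ψ x)) μ := i2.sub (i1.const_mul _)
    rw [integral_add i3 (i0.const_mul _), integral_sub i2 (i1.const_mul _),
      integral_const_mul, integral_const_mul, h1]
  nlinarith

theorem norm_gradient_mollify_sq_le (hv : MemH 1 T v) (hT : IsOpen T) (hb : Bornology.IsBounded T)
    {x : E d} (hx : Metric.closedBall x φ.rOut ⊆ T) :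
    ENNReal.ofReal (‖gradient (mollify φ T v) x‖ ^ 2) ≤
      ∫⁻ z in T, ENNReal.ofReal (‖wgrad T v z‖ ^ 2) * ENNReal.ofReal (φ.normed volume (x - z)) := by
  have ht := isTest_shift φ hx
  set ψ : E d → ℝ := fun z => φ.normed volume (x - z) with hψ
  have hψ0 : ∀ z, 0 ≤ ψ z := fun z => φ.nonneg_normed _
  have hbd : ∃ C, ∀ z, ‖ψ z‖ ≤ C := ht.2.1.exists_bound_of_continuous ht.1.continuous
  obtain ⟨C, hC⟩ := hbd
  have hψ1 : ∫ z in T, ψ z = 1 := by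
    have := ht.setIntegral_mul (fun _ => 1)
    simp only [one_mul] at this
    rw [this]
    exact (integral_sub_left_eq_self (φ.normed volume) volume x).trans φ.integral_normed
  have hg : ∀ i, MemL2 T (wderiv T [i] v) := fun i => hv.memL2_wderiv le_rfl
  have i2 : ∀ i, Integrable (fun z => wderiv T [i] v z ^ 2 * ψ z) (volume.restrict T) := fun i =>
    ((hg i).integrable_sq).mul_bdd ht.1.continuous.aestronglyMeasurable (.of_forall hC)
  have key : ‖gradient (mollify φ T v) x‖ ^ 2 ≤ ∫ z in T, ‖wgrad T v z‖ ^ 2 * ψ z := by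
    have e1 : ∀ z, ‖wgrad T v z‖ ^ 2 * ψ z = ∑ i, wderiv T [i] v z ^ 2 * ψ z := fun z => by
      rw [EuclideanSpace.norm_sq_eq, Finset.sum_mul]
      simp [wgrad]
    simp only [e1]
    rw [integral_finsetSum _ fun i _ => i2 i, EuclideanSpace.norm_sq_eq]
    refine Finset.sum_le_sum fun i _ => ?_
    rw [Real.norm_eq_abs, sq_abs, gradient_apply, pd_mollify_eq φ hv hT hb hx]
    exact sq_integral_mul_le hψ0 hψ1 ((ht.memL2 hT hb).integrable hb)
      ((hg i).mul_integrable (ht.memL2 hT hb)) (i2 i)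
  refine (ENNReal.ofReal_le_ofReal key).trans ?_
  have i3 : Integrable (fun z => ‖wgrad T v z‖ ^ 2 * ψ z) (volume.restrict T) :=
    (hv.memLp_wgrad.integrable_norm_pow (by norm_num)).mul_bdd
      ht.1.continuous.aestronglyMeasurable (.of_forall hC)
  rw [ofReal_integral_eq_lintegral_ofReal i3 (.of_forall fun z => by
    have := hψ0 z; positivity)]
  refine lintegral_mono fun z => ?_
  simp only [hψ]
  rw [ENNReal.ofReal_mul (by positivity)]

/-- Mollification does not increase the energy: Jensen pointwise, then Tonelli, since the kernel has
mass one. -/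
theorem lintegral_gradient_mollify_le (hv : MemH 1 T v) (hT : IsOpen T)
    (hb : Bornology.IsBounded T) {S : Set (E d)} (hS : MeasurableSet S)
    (hx : ∀ x ∈ S, Metric.closedBall x φ.rOut ⊆ T) :
    ∫⁻ x in S, ENNReal.ofReal (‖gradient (mollify φ T v) x‖ ^ 2) ≤
      ENNReal.ofReal (semi1 T v ^ 2) := by
  have hm : AEMeasurable (fun z => ENNReal.ofReal (‖wgrad T v z‖ ^ 2)) (volume.restrict T) :=
    (hv.memLp_wgrad.1.norm.aemeasurable.pow_const 2).ennreal_ofReal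
  have hφ : Measurable fun q : E d × E d => ENNReal.ofReal (φ.normed volume (q.1 - q.2)) :=
    (ENNReal.continuous_ofReal.comp (φ.continuous_normed.comp (by fun_prop))).measurable
  calc ∫⁻ x in S, ENNReal.ofReal (‖gradient (mollify φ T v) x‖ ^ 2)
      ≤ ∫⁻ x in S, ∫⁻ z in T, ENNReal.ofReal (‖wgrad T v z‖ ^ 2) *
          ENNReal.ofReal (φ.normed volume (x - z)) :=
        setLIntegral_mono' hS fun x hxS => norm_gradient_mollify_sq_le φ hv hT hb (hx x hxS)
    _ ≤ ∫⁻ x, ∫⁻ z in T, ENNReal.ofReal (‖wgrad T v z‖ ^ 2) *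
          ENNReal.ofReal (φ.normed volume (x - z)) := setLIntegral_le_lintegral _ _
    _ = ∫⁻ z in T, ENNReal.ofReal (‖wgrad T v z‖ ^ 2) *
          ∫⁻ x, ENNReal.ofReal (φ.normed volume (x - z)) := by
        rw [lintegral_lintegral_swap]
        · refine lintegral_congr fun z => ?_
          rw [lintegral_const_mul' _ _ ENNReal.ofReal_ne_top]
        · exact hm.comp_snd.mul hφ.aemeasurable
    _ = ∫⁻ z in T, ENNReal.ofReal (‖wgrad T v z‖ ^ 2) := by
        refine lintegral_congr fun z => ?_
        rw [lintegral_sub_right_eq_self (fun x => ENNReal.ofReal (φ.normed volume x)),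
          ← ofReal_integral_eq_lintegral_ofReal φ.integrable_normed
            (.of_forall fun _ => φ.nonneg_normed _), φ.integral_normed]
        simp
    _ = _ := by
        rw [← ofReal_integral_eq_lintegral_ofReal (hv.memLp_wgrad.integrable_norm_pow (by norm_num))
          (.of_forall fun _ => by positivity), semi1_eq_L2n, L2n_sq]

end mollify

/-! ### The Poincaré inequality -/

section poincare
variable {T : Set (E d)} {x0 : E d} {s : ℝ} {v : E d → ℝ}

/-- The image of `T` under the homothety with centre `x0` and ratio `l`. -/
def shrink (x0 : E d) (l : ℝ) (T : Set (E d)) : Set (E d) := {p | x0 + l⁻¹ • (p - x0) ∈ T}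

/-- The copy of `closure T` shrunk by `l < 1` is a compact subset of the open set `T`, so a whole
neighbourhood of it lies in `T`. The bounds `rOut ≤ η` and `rOut ≤ 2 * rIn` serve the
almost-everywhere convergence of the mollifications. -/
theorem IsStarDomain.exists_bump (h : IsStarDomain T x0 s) {l : ℝ} (hl0 : 0 < l) (hl1 : l < 1)
    {η : ℝ} (hη : 0 < η) : ∃ φ : ContDiffBump (0 : E d), φ.rOut ≤ η ∧ φ.rOut ≤ 2 * φ.rIn ∧
      ∀ x ∈ shrink x0 l T, Metric.closedBall x φ.rOut ⊆ T := by
  have hc : Continuous fun x : E d => x0 + l • (x - x0) := by fun_prop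
  have hK : IsCompact ((fun x : E d => x0 + l • (x - x0)) '' closure T) :=
    h.bounded.isCompact_closure.image hc
  have hKT : (fun x : E d => x0 + l • (x - x0)) '' closure T ⊆ T := by
    rintro _ ⟨x, hx, rfl⟩
    exact h.mem_of_closure (Metric.mem_ball_self h.pos) hx hl0.le hl1
  obtain ⟨δ, hδ, hsub⟩ := hK.exists_cthickening_subset_open h.isOpen hKT
  refine ⟨⟨min δ η / 2, min δ η, by positivity, by linarith [lt_min hδ hη]⟩, min_le_right _ _,
    by simp only; linarith, fun x hx => ?_⟩
  have hxK : x ∈ (fun x : E d => x0 + l • (x - x0)) '' closure T := by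
    refine ⟨_, subset_closure hx, ?_⟩
    simp only [add_sub_cancel_left, smul_smul]
    rw [mul_inv_cancel₀ hl0.ne']; simp
  exact (Metric.closedBall_subset_closedBall (min_le_left _ _)).trans
    ((Metric.closedBall_subset_cthickening hxK δ).trans hsub)

/-- The energy of the mollifications is controlled on shrunken copies of `T` only, so the smooth
inequality is used there and Fatou's lemma passes to the limit. -/
theorem IsStarDomain.poincare_double (h : IsStarDomain T x0 s) (hv : MemH 1 T v) :
    ∫⁻ x in T, ∫⁻ y in Metric.ball x0 (s / 2), ENNReal.ofReal ((v x - v y) ^ 2) ≤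
      ENNReal.ofReal (Metric.diam T ^ 2) *
        (2 ^ d * (2 * volume T) * ENNReal.ofReal (semi1 T v ^ 2)) := by
  have hT := h.isOpen
  have hb := h.bounded
  set B := Metric.ball x0 (s / 2) with hB
  have hBT : B ⊆ T := (Metric.ball_subset_ball (by linarith [h.pos])).trans h.ball_subset
  have hi : Integrable (T.indicator v) volume :=
    (integrable_indicator_iff hT.measurableSet).2 (hv.1.integrable hb)
  let l : ℕ → ℝ := fun n => 1 - 1 / ((n : ℝ) + 2)
  have hl2 : ∀ n, 1 / 2 ≤ l n := fun n => by
    have : 1 / ((n : ℝ) + 2) ≤ 1 / 2 := one_div_le_one_div_of_le (by norm_num) (by linarith [n.cast_nonneg (α := ℝ)])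
    simp only [l]; linarith
  have hl0 : ∀ n, 0 < l n := fun n => by linarith [hl2 n]
  have hl1 : ∀ n, l n < 1 := fun n => by
    have : 0 < 1 / ((n : ℝ) + 2) := by positivity
    simp only [l]; linarith
  have hlt : Tendsto l atTop (𝓝 1) := by
    have : Tendsto (fun n : ℕ => 1 / ((n : ℝ) + 2)) atTop (𝓝 0) :=
      tendsto_const_nhds.div_atTop (tendsto_natCast_atTop_atTop.atTop_add tendsto_const_nhds)
    simpa [l] using this.const_sub 1
  choose φ hφ1 hφ2 hφ3 using fun n : ℕ => h.exists_bump (hl0 n) (hl1 n)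
    (η := 1 / ((n : ℝ) + 1)) (by positivity)
  have hφt : Tendsto (fun n => (φ n).rOut) atTop (𝓝 0) :=
    squeeze_zero (fun n => (φ n).rOut_pos.le) hφ1 tendsto_one_div_add_atTop_nhds_zero_nat
  set V : ℕ → E d → ℝ := fun n => mollify (φ n) T v with hV
  have hVs : ∀ n, ContDiff ℝ ∞ (V n) := fun n => contDiff_mollify (φ n) hi.locallyIntegrable
  have hae : ∀ᵐ x ∂(volume : Measure (E d)), Tendsto (fun n => V n x) atTop (𝓝 (T.indicator v x)) :=
    ContDiffBump.ae_convolution_tendsto_right_of_locallyIntegrable hφt (.of_forall hφ2)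
      hi.locallyIntegrable
  set S : ℕ → Set (E d) := fun n => shrink x0 (l n) T with hS
  have hSo : ∀ n, IsOpen (S n) := fun n => hT.preimage (by fun_prop)
  -- The reason for halving the radius: as `l n ≥ 1 / 2`, expanding `B` by `(l n)⁻¹ ≤ 2` stays in
  -- the ball of radius `s`, so each shrunken copy is star-shaped with respect to `B`.
  have hBS : ∀ n, ∀ y ∈ B, x0 + (l n)⁻¹ • (y - x0) ∈ Metric.ball x0 s := fun n y hy => by
    rw [hB, mem_ball_iff_norm] at hy
    rw [mem_ball_iff_norm, add_sub_cancel_left, norm_smul, norm_inv, Real.norm_eq_abs,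
      abs_of_pos (hl0 n)]
    have h1 : (l n)⁻¹ ≤ 2 := inv_le_of_inv_le₀ (by norm_num) (by simpa using hl2 n)
    calc (l n)⁻¹ * ‖y - x0‖ ≤ 2 * ‖y - x0‖ := by gcongr
      _ < s := by linarith
  have hST : ∀ n, S n ⊆ T := fun n x hx => (hφ3 n x hx) (Metric.mem_closedBall_self (φ n).rOut_pos.le)
  have hbound : ∀ n, ∫⁻ x in S n, ∫⁻ y in B, ENNReal.ofReal ((V n x - V n y) ^ 2) ≤
      ENNReal.ofReal (Metric.diam T ^ 2) *
        (2 ^ d * (2 * volume T) * ENNReal.ofReal (semi1 T v ^ 2)) := by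
    intro n
    refine (poincare_smooth (h := Metric.diam T) (hSo n).measurableSet measurableSet_ball
      (hSo n).measurableSet ?_ ?_ (hVs n)).trans ?_
    · intro x hx y hy t ht
      have := (h.star _ (hBS n y hy)) hx (a := 1 - t) (b := t) (by linarith [ht.2]) ht.1 (by ring)
      change x0 + _ ∈ T
      convert! this using 1
      module
    · intro x hx y hy
      rw [← dist_eq_norm]
      exact Metric.dist_le_diam_of_mem hb (hST n hx) (hBT hy)
    · gcongr
      · rw [two_mul]
        exact add_le_add (measure_mono (hST n)) (measure_mono hBT)
      · exact lintegral_gradient_mollify_le (φ n) hv hT hb (hSo n).measurableSet (hφ3 n)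
  -- Fatou's lemma
  set μ := (volume.restrict T).prod (volume.restrict B) with hμ
  set f : ℕ → E d × E d → ENNReal := fun n q =>
    (S n).indicator (fun _ => 1) q.1 * ENNReal.ofReal ((V n q.1 - V n q.2) ^ 2) with hf
  have hfm : ∀ n, Measurable (f n) := fun n => by
    have h1 := (hVs n).continuous.measurable
    have h2 : Measurable ((S n).indicator (fun _ => (1 : ENNReal))) :=
      measurable_const.indicator (hSo n).measurableSet
    fun_prop
  have hvm : AEMeasurable (fun q : E d × E d => ENNReal.ofReal ((v q.1 - v q.2) ^ 2)) μ := by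
    have h1 : AEMeasurable v (volume.restrict T) := hv.1.1.aemeasurable
    have h2 : AEMeasurable v (volume.restrict B) := h1.mono_measure (Measure.restrict_mono hBT le_rfl)
    exact ((h1.comp_fst.sub h2.comp_snd).pow_const 2).ennreal_ofReal
  have hae1 : ∀ᵐ x ∂(volume.restrict T), x ∈ T ∧ Tendsto (fun n => V n x) atTop (𝓝 (v x)) := by
    filter_upwards [ae_restrict_of_ae hae, ae_restrict_mem hT.measurableSet] with x h1 h2
    rw [Set.indicator_of_mem h2] at h1
    exact ⟨h2, h1⟩
  have hae2 : ∀ᵐ x ∂(volume.restrict B), Tendsto (fun n => V n x) atTop (𝓝 (v x)) :=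
    (ae_restrict_of_ae_restrict_of_subset hBT hae1).mono fun x hx => hx.2
  have hlim : ∀ᵐ q ∂μ, Tendsto (fun n => f n q) atTop (𝓝 (ENNReal.ofReal ((v q.1 - v q.2) ^ 2))) := by
    filter_upwards [Measure.quasiMeasurePreserving_fst.ae hae1,
      Measure.quasiMeasurePreserving_snd.ae hae2] with q h1 h2
    have h3 : ∀ᶠ n in atTop, q.1 ∈ S n := by
      have hc : Tendsto (fun n => x0 + (l n)⁻¹ • (q.1 - x0)) atTop (𝓝 q.1) := by
        have := (((hlt.inv₀ one_ne_zero).smul_const (q.1 - x0)).const_add x0)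
        simpa using this
      exact hc.eventually (hT.mem_nhds h1.1)
    have h4 : Tendsto (fun n => ENNReal.ofReal ((V n q.1 - V n q.2) ^ 2)) atTop
        (𝓝 (ENNReal.ofReal ((v q.1 - v q.2) ^ 2))) :=
      (ENNReal.continuous_ofReal.tendsto _).comp ((h1.2.sub h2).pow 2)
    refine h4.congr' (h3.mono fun n hn => ?_)
    simp only [hf]
    rw [Set.indicator_of_mem hn, one_mul]
  calc ∫⁻ x in T, ∫⁻ y in B, ENNReal.ofReal ((v x - v y) ^ 2)
      = ∫⁻ q, ENNReal.ofReal ((v q.1 - v q.2) ^ 2) ∂μ := by rw [hμ, lintegral_prod _ hvm]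
    _ ≤ ∫⁻ q, liminf (fun n => f n q) atTop ∂μ := by
        refine lintegral_mono_ae (hlim.mono fun q hq => ?_)
        rw [hq.liminf_eq]
    _ ≤ liminf (fun n => ∫⁻ q, f n q ∂μ) atTop := lintegral_liminf_le hfm
    _ ≤ _ := by
        refine liminf_le_of_frequently_le' (Frequently.of_forall fun n => ?_)
        refine le_trans (le_of_eq ?_) (hbound n)
        rw [hμ, lintegral_prod _ (hfm n).aemeasurable]
        simp only [hf]
        have e1 : ∀ x, ∫⁻ y in B, (S n).indicator (fun _ => 1) x * ENNReal.ofReal ((V n x - V n y) ^ 2)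
            = (S n).indicator (fun x => ∫⁻ y in B, ENNReal.ofReal ((V n x - V n y) ^ 2)) x := by
          intro x
          by_cases hx : x ∈ S n <;> simp [hx]
        simp only [e1]
        rw [lintegral_indicator (hSo n).measurableSet, Measure.restrict_restrict (hSo n).measurableSet,
          Set.inter_eq_left.2 (hST n)]

/-- The constant in the Poincaré inequality. -/
def poincareConst (d : ℕ) (ρ : ℝ) : ℝ := √(2 ^ (d + 1) * (2 / ρ) ^ d)

theorem IsStarDomain.volume_le (hd : 0 < d) {ρ : ℝ} (hρ : 0 < ρ)
    (h : IsStarDomain T x0 (ρ * Metric.diam T)) :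
    volume.real T ≤ (2 / ρ) ^ d * volume.real (Metric.ball x0 (ρ * Metric.diam T / 2)) := by
  have : Nonempty (Fin d) := ⟨⟨0, hd⟩⟩
  have : Nontrivial (E d) := inferInstance
  have hsub : T ⊆ Metric.closedBall x0 (Metric.diam T) := fun x hx =>
    Metric.dist_le_diam_of_mem h.bounded hx (h.ball_subset (Metric.mem_ball_self h.pos))
  have hD : 0 < Metric.diam T := by
    have := h.pos; exact (pos_iff_pos_of_mul_pos this).1 hρ
  have h1 : volume.real T ≤ volume.real (Metric.closedBall x0 (Metric.diam T)) :=
    measureReal_mono hsub (Metric.isBounded_closedBall.measure_lt_top.ne)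
  refine h1.trans (le_of_eq ?_)
  have hball : volume.real (Metric.ball x0 (ρ * Metric.diam T / 2)) =
      (ρ * Metric.diam T / 2) ^ d * volume.real (Metric.ball (0 : E d) 1) := by
    rw [measureReal_def, Measure.addHaar_ball _ _ (by positivity), ENNReal.toReal_mul,
      ENNReal.toReal_ofReal (by positivity), finrank_euclideanSpace_fin, measureReal_def]
  rw [Measure.addHaar_real_closedBall _ _ hD.le, hball,
    finrank_euclideanSpace_fin, ← mul_assoc, ← mul_pow]
  congr 2
  field_simp

/-- Take for `m` the mean over the half-radius ball `B`; completing the square bounds `|B| * (v x -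
m) ^ 2` by the integral of `(v x - v y) ^ 2` over `y ∈ B`. The double integral estimate and `|T| ≤
(2 / ρ) ^ d * |B|` then give the constant. -/
theorem IsStarDomain.poincare (hd : 0 < d) {ρ : ℝ} (hρ : 0 < ρ)
    (h : IsStarDomain T x0 (ρ * Metric.diam T)) (hv : MemH 1 T v) :
    ∃ m, norm0 T (fun x => v x - m) ≤ poincareConst d ρ * Metric.diam T * semi1 T v := by
  have hT := h.isOpen
  have hb := h.bounded
  set B := Metric.ball x0 (ρ * Metric.diam T / 2) with hB
  have hs := h.pos
  have hBT : B ⊆ T := (Metric.ball_subset_ball (by linarith)).trans h.ball_subset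
  have hBfin : IsFiniteMeasure (volume.restrict B) :=
    ⟨by simpa using Metric.isBounded_ball.measure_lt_top⟩
  have hTfin : IsFiniteMeasure (volume.restrict T) := ⟨by simpa using volume_lt_top hb⟩
  have hBpos : 0 < volume.real B :=
    ENNReal.toReal_pos (Metric.measure_ball_pos _ _ (by linarith)).ne' Metric.isBounded_ball.measure_lt_top.ne
  have hvB : MemLp v 2 (volume.restrict B) := hv.1.mono_measure (Measure.restrict_mono hBT le_rfl)
  have hvB1 : Integrable v (volume.restrict B) := hvB.integrable (by norm_num)
  set m : ℝ := (volume.real B)⁻¹ * ∫ y in B, v y with hm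
  refine ⟨m, ?_⟩
  have hpt : ∀ x, volume.real B * (v x - m) ^ 2 ≤ ∫ y in B, (v x - v y) ^ 2 := by
    intro x
    have e1 : ∀ y, (v x - v y) ^ 2 = (v x - m) ^ 2 + 2 * (v x - m) * (m - v y) + (m - v y) ^ 2 :=
      fun y => by ring
    have i1 : Integrable (fun y => m - v y) (volume.restrict B) := (integrable_const m).sub hvB1
    have i2 : Integrable (fun y => (m - v y) ^ 2) (volume.restrict B) :=
      ((memLp_const m).sub hvB).integrable_sq
    have i3 : Integrable (fun y => (v x - m) ^ 2 + 2 * (v x - m) * (m - v y)) (volume.restrict B) :=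
      (integrable_const _).add (i1.const_mul _)
    have e2 : ∫ y in B, (m - v y) = 0 := by
      rw [integral_sub (integrable_const m) hvB1, integral_const, smul_eq_mul,
        measureReal_restrict_apply_univ, hm, mul_inv_cancel_left₀ hBpos.ne', sub_self]
    simp only [e1]
    rw [integral_add i3 i2, integral_add (integrable_const _) (i1.const_mul _), integral_const_mul, e2,
      integral_const, measureReal_restrict_apply_univ, smul_eq_mul]
    have : 0 ≤ ∫ y in B, (m - v y) ^ 2 := integral_nonneg fun _ => sq_nonneg _
    linarith
  have i4 : Integrable (fun x => volume.real B * (v x - m) ^ 2) (volume.restrict T) :=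
    (((show MemLp v 2 (volume.restrict T) from hv.1).sub (memLp_const m)).integrable_sq).const_mul _
  have hineq : ENNReal.ofReal (volume.real B * ∫ x in T, (v x - m) ^ 2) ≤
      ENNReal.ofReal (Metric.diam T ^ 2 * (2 ^ d * (2 * volume.real T) * semi1 T v ^ 2)) := by
    rw [← integral_const_mul, ofReal_integral_eq_lintegral_ofReal i4
      (.of_forall fun _ => by positivity)]
    refine le_trans ?_ ((h.poincare_double hv).trans (le_of_eq ?_))
    · refine lintegral_mono fun x => ?_
      refine (ENNReal.ofReal_le_ofReal (hpt x)).trans (le_of_eq ?_)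
      exact ofReal_integral_eq_lintegral_ofReal (((memLp_const (v x)).sub hvB).integrable_sq)
        (.of_forall fun _ => sq_nonneg _)
    · rw [ENNReal.ofReal_mul (by positivity), ENNReal.ofReal_mul (by positivity),
        ENNReal.ofReal_mul (by positivity), ENNReal.ofReal_mul (by positivity)]
      rw [ofReal_measureReal (volume_lt_top hb).ne, ENNReal.ofReal_pow zero_le_two]
      simp
  rw [ENNReal.ofReal_le_ofReal_iff (by positivity)] at hineq
  have hvol := h.volume_le hd hρ
  have hfin : ∫ x in T, (v x - m) ^ 2 ≤
      (poincareConst d ρ * Metric.diam T * semi1 T v) ^ 2 := by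
    rw [mul_pow, mul_pow, poincareConst, Real.sq_sqrt (by positivity)]
    refine le_of_mul_le_mul_left (hineq.trans ?_) hBpos
    have h0 : 0 ≤ Metric.diam T ^ 2 * (2 ^ (d + 1)) * semi1 T v ^ 2 := by positivity
    have := mul_le_mul_of_nonneg_left hvol h0
    calc Metric.diam T ^ 2 * (2 ^ d * (2 * volume.real T) * semi1 T v ^ 2)
        = Metric.diam T ^ 2 * (2 ^ (d + 1)) * semi1 T v ^ 2 * volume.real T := by ring
      _ ≤ _ := this
      _ = _ := by ring
  unfold norm0
  refine Real.sqrt_le_iff.2 ⟨?_, hfin⟩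
  exact mul_nonneg (mul_nonneg (Real.sqrt_nonneg _) Metric.diam_nonneg) (Real.sqrt_nonneg _)

/-- The Poincaré inequality for functions of mean value zero. -/
theorem IsStarDomain.poincare_of_integral_eq_zero (hd : 0 < d) {ρ : ℝ} (hρ : 0 < ρ)
    (h : IsStarDomain T x0 (ρ * Metric.diam T)) (hv : MemH 1 T v) (h0 : ∫ x in T, v x = 0) :
    norm0 T v ≤ poincareConst d ρ * Metric.diam T * semi1 T v := by
  obtain ⟨m, hm⟩ := h.poincare hd hρ hv
  refine le_trans ?_ hm
  have hTfin : IsFiniteMeasure (volume.restrict T) := ⟨by simpa using volume_lt_top h.bounded⟩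
  unfold norm0
  refine Real.sqrt_le_sqrt ?_
  -- For mean value zero the mixed term integrates to 0, so subtracting a constant can only increase
  -- the norm.
  have e1 : ∀ x, (v x - m) ^ 2 = v x ^ 2 - 2 * m * v x + m ^ 2 := fun x => by ring
  have hv2 : Integrable (fun x => v x ^ 2) (volume.restrict T) := hv.1.integrable_sq
  have hv1 := hv.1.integrable h.bounded
  have i1 : Integrable (fun x => v x ^ 2 - 2 * m * v x) (volume.restrict T) :=
    hv2.sub (hv1.const_mul _)
  simp only [e1]
  rw [integral_add i1 (integrable_const _), integral_sub hv2 (hv1.const_mul _), integral_const_mul, h0,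
    integral_const, smul_eq_mul]
  have : 0 ≤ (volume.restrict T).real Set.univ * m ^ 2 := by positivity
  linarith

end poincare

/-! ### Polynomials with prescribed derivatives -/

/-- Every differentiation multiplies the shifted coefficient by a positive integer. The weight is
independent of `p`, which allows the coefficients of a polynomial to be solved for below. -/
theorem coeff_pderivs (L : List (Fin d)) (s : Fin d →₀ ℕ) :
    ∃ w : ℝ, 0 < w ∧ ∀ p : MvPolynomial (Fin d) ℝ,
      (pderivs L p).coeff s = w * p.coeff (s + Multiset.toFinsupp (L : Multiset (Fin d))) := by
  induction L generalizing s with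
  | nil => exact ⟨1, one_pos, fun p => by simp [pderivs]⟩
  | cons i L ih =>
    obtain ⟨w, hw, h⟩ := ih (s + Finsupp.single i 1)
    refine ⟨w * (s i + 1), by positivity, fun p => ?_⟩
    rw [pderivs, MvPolynomial.coeff_pderiv, h, ← Multiset.cons_coe, ← Multiset.singleton_add,
      map_add, Multiset.toFinsupp_singleton, add_assoc]
    ring

theorem isHomogeneous_pderivs {p : MvPolynomial (Fin d) ℝ} {m : ℕ} (h : p.IsHomogeneous m)
    (L : List (Fin d)) : (pderivs L p).IsHomogeneous (m - L.length) := by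
  induction L with
  | nil => simpa [pderivs] using h
  | cons i L ih => simpa [pderivs, Nat.sub_sub] using ih.pderiv (i := i)

theorem pderivs_eq_zero {p : MvPolynomial (Fin d) ℝ} {m : ℤ}
    (h : p = 0 ∨ (p.totalDegree : ℤ) ≤ m) {L : List (Fin d)} (hL : m < L.length) :
    pderivs L p = 0 := by
  have key : ∀ L : List (Fin d), pderivs L p = 0 ∨ ((pderivs L p).totalDegree : ℤ) ≤ m - L.length := by
    intro L
    induction L with
    | nil => simpa [pderivs] using h
    | cons i L ih =>
      have := totalDegree_pderiv_le i ih
      simpa [pderivs, sub_sub] using this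
  rcases key L with h1 | h1
  · exact h1
  · omega

/-- There is a homogeneous polynomial with prescribed derivatives of the highest order. -/
theorem exists_poly_pderivs_eq (m : ℕ) (c : List (Fin d) → ℝ)
    (hc : ∀ L L' : List (Fin d), L.Perm L' → c L = c L') :
    ∃ q : MvPolynomial (Fin d) ℝ, (q.totalDegree : ℤ) ≤ m ∧
      ∀ L : List (Fin d), L.length = m → pderivs L q = MvPolynomial.C (c L) := by
  choose w hw hcoeff using fun L : List (Fin d) => coeff_pderivs L 0
  -- A list whose multiplicities are `s`; the coefficient at `s` is divided by the weight with which
  -- differentiation along that list multiplies it.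
  let r : (Fin d →₀ ℕ) → List (Fin d) := fun s => (Finsupp.toMultiset s).toList
  set q : MvPolynomial (Fin d) ℝ :=
    ∑ s ∈ Finset.finsuppAntidiag Finset.univ m, MvPolynomial.monomial s (c (r s) / w (r s)) with hq
  have hmem : ∀ s : Fin d →₀ ℕ, s ∈ Finset.finsuppAntidiag Finset.univ m ↔ s.degree = m := by
    intro s
    rw [Finset.mem_finsuppAntidiag, Finsupp.degree_eq_sum]
    simp
  have hhom : q.IsHomogeneous m := by
    refine MvPolynomial.IsHomogeneous.sum _ _ _ fun s hs => ?_
    exact MvPolynomial.isHomogeneous_monomial _ ((hmem s).1 hs)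
  refine ⟨q, by exact_mod_cast hhom.totalDegree_le, fun L hL => ?_⟩
  -- An order `m` derivative of a homogeneous polynomial of degree `m` is constant, so its
  -- coefficient at 0 determines it.
  have h0 : (pderivs L q).totalDegree = 0 := by
    have := (isHomogeneous_pderivs hhom L).totalDegree_le
    omega
  rw [MvPolynomial.totalDegree_eq_zero_iff_eq_C.1 h0]
  congr 1
  rw [hcoeff, zero_add]
  set s := Multiset.toFinsupp (L : Multiset (Fin d)) with hs
  have hperm : (r s).Perm L := by
    rw [← Multiset.coe_eq_coe, Multiset.coe_toList, hs]
    exact Multiset.toFinsupp.symm_apply_apply (L : Multiset (Fin d))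
  have hdeg : s.degree = m := by
    have : Multiset.card (Finsupp.toMultiset s) = s.degree := by
      rw [Finsupp.card_toMultiset, Finsupp.degree_eq_sum, Finsupp.sum_fintype _ _ (by simp)]; rfl
    rw [← this, ← hL, hs]
    exact congrArg Multiset.card (Multiset.toFinsupp.symm_apply_apply (L : Multiset (Fin d)))
  have hco : q.coeff s = c (r s) / w (r s) := by
    rw [hq, MvPolynomial.coeff_sum]
    simp only [MvPolynomial.coeff_monomial]
    rw [Finset.sum_ite_eq_of_mem' _ _ _ ((hmem s).2 hdeg)]
  -- The weight does not depend on the order of differentiation; the monomial `s` tests this.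
  have hww : w (r s) = w L := by
    have h1 := hcoeff (r s) (MvPolynomial.monomial s 1)
    have h2 := hcoeff L (MvPolynomial.monomial s 1)
    have h3 : pderivs (r s) (MvPolynomial.monomial s (1 : ℝ)) = pderivs L (MvPolynomial.monomial s 1) := by
      have : ∀ {L L' : List (Fin d)}, L.Perm L' → ∀ p : MvPolynomial (Fin d) ℝ,
          pderivs L p = pderivs L' p := by
        intro L L' h p
        induction h with
        | nil => rfl
        | cons i _ ih => simp [pderivs, ih]
        | swap i j L => exact pderiv_comm _ _ _
        | trans _ _ h1 h2 => exact h1.trans h2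
      exact this hperm _
    rw [Multiset.coe_eq_coe.2 hperm] at h1
    rw [h3, h2, zero_add, ← hs, MvPolynomial.coeff_monomial] at h1
    simpa using h1.symm
  rw [hco, hww, hc _ _ hperm, mul_div_cancel₀ _ (hw L).ne']

/-! ### The Bramble–Hilbert lemma -/

section brambleHilbert
variable {T : Set (E d)} {v : E d → ℝ}

theorem MemH.wderiv_perm {n : ℕ} (hT : IsOpen T) (hb : Bornology.IsBounded T) (hv : MemH n T v)
    {L L' : List (Fin d)} (h : L.Perm L') (hL : L.length ≤ n) :
    wderiv T L v =ᵐ[volume.restrict T] wderiv T L' v :=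
  (hv.hasWeakDeriv hL).perm h |>.ae_unique hT hb (hv.memL2_wderiv hL)
    (hv.memL2_wderiv (h.length_eq ▸ hL)) (hv.hasWeakDeriv (h.length_eq ▸ hL))

/-- The polynomial with the same mean values of all derivatives of order less than `m`. -/
theorem MemH.exists_poly_integral_eq_zero (hT : IsOpen T) (hb : Bornology.IsBounded T)
    (hne : T.Nonempty) {n : ℕ} (m : ℕ) (hm : m ≤ n + 1) (hv : MemH n T v) :
    ∃ p : MvPolynomial (Fin d) ℝ, (p = 0 ∨ (p.totalDegree : ℤ) ≤ (m : ℤ) - 1) ∧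
      ∀ L : List (Fin d), L.length < m → ∫ x in T, wderiv T L (fun x => v x - polyFun p x) x = 0 := by
  induction m generalizing v with
  | zero => exact ⟨0, Or.inl rfl, fun L hL => absurd hL (by simp)⟩
  | succ m ih =>
    have hTfin : IsFiniteMeasure (volume.restrict T) := ⟨by simpa using volume_lt_top hb⟩
    have hvol : 0 < volume.real T :=
      ENNReal.toReal_pos (hT.measure_pos volume hne).ne' (volume_lt_top hb).ne
    have hex : ∃ c : List (Fin d) → ℝ, (∀ L L' : List (Fin d), L.Perm L' → c L = c L') ∧
        ∀ L : List (Fin d), L.length = m → c L = (volume.real T)⁻¹ * ∫ x in T, wderiv T L v x := by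
      refine ⟨fun L => if L.length = m then (volume.real T)⁻¹ * ∫ x in T, wderiv T L v x else 0,
        fun L L' h => ?_, fun L hL => if_pos hL⟩
      simp only [h.length_eq]
      split_ifs with h1
      · rw [integral_congr_ae (hv.wderiv_perm hT hb h (by rw [h.length_eq]; omega))]
      · rfl
    obtain ⟨c, hc, hc'⟩ := hex
    obtain ⟨q, hq, hqL⟩ := exists_poly_pderivs_eq m c hc
    have hqH := memH_polyFun hT hb n q
    -- Highest order first: `q` corrects the means of the derivatives of order `m`, and `p` those of
    -- lower order of `v - q`. As `p` has degree below `m`, it does not disturb order `m`.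
    obtain ⟨p, hp, hpL⟩ := ih (by omega) (hv.sub hT hb hqH)
    have hpH := memH_polyFun hT hb n p
    have hfun : (fun x => v x - polyFun (q + p) x) = fun x => v x - polyFun q x - polyFun p x := by
      funext x; simp [polyFun]; ring
    refine ⟨q + p, ?_, fun L hL => ?_⟩
    · rcases hp with rfl | hp
      · right; simpa using hq
      · right
        refine le_trans (Int.ofNat_le.2 (MvPolynomial.totalDegree_add q p)) ?_
        push_cast; exact max_le (by omega) (by omega)
    · rw [hfun]
      rcases Nat.lt_succ_iff_lt_or_eq.1 hL with h1 | h1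
      · exact hpL L h1
      · have hLn : L.length ≤ n := by omega
        have e1 := (hv.sub hT hb hqH).wderiv_sub hT hb hpH hLn
        have e2 := hv.wderiv_sub hT hb hqH hLn
        have e3 := wderiv_polyFun hT hb L q
        have e4 := wderiv_polyFun hT hb L p
        have e5 : wderiv T L (fun x => v x - polyFun q x - polyFun p x) =ᵐ[volume.restrict T]
            fun x => wderiv T L v x - c L := by
          filter_upwards [e1, e2, e3, e4] with x h1 h2 h3 h4
          rw [h1, h2, h3, h4, hqL L ‹_›, pderivs_eq_zero hp (by omega)]
          simp [polyFun]
        rw [integral_congr_ae e5, integral_sub ((hv.memL2_wderiv hLn).integrable hb)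
          (integrable_const _), integral_const, measureReal_restrict_apply_univ, smul_eq_mul, hc' L h1,
          mul_inv_cancel_left₀ hvol.ne', sub_self]

theorem semiH_zero (hT : IsOpen T) (hb : Bornology.IsBounded T) (hv : MemL2 T v) :
    semiH 0 T v = norm0 T v := by
  have : wderiv T [] v =ᵐ[volume.restrict T] v := wderiv_ae_eq hT hb hv hasWeakDeriv_nil
  unfold semiH norm0
  rw [Finset.univ_unique, Finset.sum_singleton, List.ofFn_zero]
  congr 1
  exact integral_congr_ae (this.mono fun x hx => by simp only [hx])

theorem semiH_sq (m : ℕ) : semiH m T v ^ 2 =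
    ∑ I : Fin m → Fin d, norm0 T (wderiv T (List.ofFn I) v) ^ 2 := by
  unfold semiH norm0
  rw [Real.sq_sqrt (Finset.sum_nonneg fun _ _ => integral_nonneg fun _ => sq_nonneg _)]
  exact Finset.sum_congr rfl fun I _ => (Real.sq_sqrt (integral_nonneg fun _ => sq_nonneg _)).symm

theorem semiH_nonneg (m : ℕ) : 0 ≤ semiH m T v := Real.sqrt_nonneg _

theorem norm0_nonneg : 0 ≤ norm0 T v := Real.sqrt_nonneg _

theorem semi1_nonneg : 0 ≤ semi1 T v := Real.sqrt_nonneg _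

theorem semiH_succ_sq (m : ℕ) : semiH (m + 1) T v ^ 2 =
    ∑ I : Fin m → Fin d, ∑ i, norm0 T (wderiv T (i :: List.ofFn I) v) ^ 2 := by
  rw [semiH_sq, Finset.sum_comm, ← Fintype.sum_prod_type',
    ← Equiv.sum_comp (Fin.consEquiv fun _ : Fin (m + 1) => Fin d)]
  refine Finset.sum_congr rfl fun q _ => ?_
  simp [Fin.consEquiv, List.ofFn_succ]

theorem semi1_sq (hv : MemH 1 T v) : semi1 T v ^ 2 = ∑ i, norm0 T (wderiv T [i] v) ^ 2 := by
  rw [semi1_eq_L2n, L2n_sq_euclidean hv.memLp_wgrad]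
  simp only [norm0_eq_L2n]
  rfl

theorem semi1_eq_semiH (hv : MemH 1 T v) : semi1 T v = semiH 1 T v := by
  refine (pow_left_inj₀ semi1_nonneg (semiH_nonneg 1) two_ne_zero).1 ?_
  simp [semi1_sq hv, semiH_succ_sq]

theorem norm0_congr {w : E d → ℝ} (h : v =ᵐ[volume.restrict T] w) : norm0 T v = norm0 T w := by
  rw [norm0_eq_L2n, norm0_eq_L2n, L2n_congr h]

theorem MemH.memH_wderiv {n : ℕ} (hv : MemH n T v) {L : List (Fin d)} (hL : L.length < n) :
    MemH 1 T (wderiv T L v) := by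
  refine ⟨hv.memL2_wderiv hL.le, fun L' hL' => ?_⟩
  match L', hL' with
  | [], _ => exact ⟨_, hv.memL2_wderiv hL.le, hasWeakDeriv_nil⟩
  | [i], _ => exact ⟨_, hv.memL2_wderiv (L := i :: L) (by simpa using hL),
      (hv.hasWeakDeriv hL.le).of_cons (hv.hasWeakDeriv (L := i :: L) (by simpa using hL))⟩

theorem MemH.wderiv_wderiv (hT : IsOpen T) (hb : Bornology.IsBounded T) {n : ℕ} (hv : MemH n T v)
    {L : List (Fin d)} (hL : L.length < n) (i : Fin d) :
    wderiv T [i] (wderiv T L v) =ᵐ[volume.restrict T] wderiv T (i :: L) v :=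
  wderiv_ae_eq hT hb (hv.memL2_wderiv (L := i :: L) (by simpa using hL))
    ((hv.hasWeakDeriv hL.le).of_cons (hv.hasWeakDeriv (L := i :: L) (by simpa using hL)))

theorem poincareConst_pos (d : ℕ) {ρ : ℝ} (hρ : 0 < ρ) : 0 < poincareConst d ρ :=
  Real.sqrt_pos.2 (by positivity)

theorem IsStarDomain.semiH_le_succ (hd : 0 < d) {ρ : ℝ} (hρ : 0 < ρ) {x0 : E d}
    (h : IsStarDomain T x0 (ρ * Metric.diam T)) {n m : ℕ} (hv : MemH n T v) (hm : m < n)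
    (h0 : ∀ L : List (Fin d), L.length = m → ∫ x in T, wderiv T L v x = 0) :
    semiH m T v ≤ poincareConst d ρ * Metric.diam T * semiH (m + 1) T v := by
  have hc : 0 ≤ poincareConst d ρ * Metric.diam T :=
    mul_nonneg (poincareConst_pos d hρ).le Metric.diam_nonneg
  refine (pow_le_pow_iff_left₀ (semiH_nonneg m) (mul_nonneg hc (semiH_nonneg _)) two_ne_zero).1 ?_
  rw [mul_pow, semiH_succ_sq, semiH_sq, Finset.mul_sum]
  refine Finset.sum_le_sum fun I _ => ?_
  have hL : (List.ofFn I).length = m := List.length_ofFn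
  have hL' : (List.ofFn I).length < n := by omega
  have h1 := h.poincare_of_integral_eq_zero hd hρ (hv.memH_wderiv hL') (h0 _ hL)
  have h2 := pow_le_pow_left₀ norm0_nonneg h1 2
  rw [mul_pow, semi1_sq (hv.memH_wderiv hL')] at h2
  refine h2.trans (le_of_eq ?_)
  congr 1
  exact Finset.sum_congr rfl fun i _ => by
    rw [norm0_congr (hv.wderiv_wderiv h.isOpen h.bounded hL' i)]

/-- All derivatives of `v - p` up to order `k` have mean zero, so each application of Poincaré
raises the order by one at the price of a factor `c`. The polynomial is invisible at order `k + 1`.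
The two summands of the constant belong to the L² norm and the H¹ seminorm. -/
theorem IsStarDomain.exists_localApprox (hd : 0 < d) {ρ : ℝ} (hρ : 0 < ρ) {x0 : E d}
    (h : IsStarDomain T x0 (ρ * Metric.diam T)) {k : ℕ} (hv : MemH (k + 1) T v) :
    ∃ p, IsLocalApprox k T (poincareConst d ρ ^ (k + 1) + poincareConst d ρ ^ k) v p := by
  have hT := h.isOpen
  have hb := h.bounded
  obtain ⟨p, hp, hpL⟩ := hv.exists_poly_integral_eq_zero hT hb h.nonempty (k + 1) (by omega)
  have hp' : p = 0 ∨ (p.totalDegree : ℤ) ≤ k := hp.imp_right fun h => by push_cast at h; omega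
  refine ⟨polyFun p, polyFun_mem hp', ?_⟩
  set w : E d → ℝ := fun x => v x - polyFun p x with hw
  have hwH : MemH (k + 1) T w := hv.sub hT hb (memH_polyFun hT hb _ p)
  set c := poincareConst d ρ * Metric.diam T with hc
  have hc0 : 0 ≤ c := mul_nonneg (poincareConst_pos d hρ).le Metric.diam_nonneg
  have hchain : ∀ j m, m + j = k + 1 → semiH m T w ≤ c ^ j * semiH (k + 1) T w := by
    intro j
    induction j with
    | zero => intro m hm; simp at hm; subst hm; simp
    | succ j ih =>
      intro m hm
      have h1 := h.semiH_le_succ hd hρ hwH (m := m) (by omega) (fun L hL => hpL L (by omega))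
      refine h1.trans ?_
      rw [pow_succ', mul_assoc c]
      exact mul_le_mul_of_nonneg_left (ih (m + 1) (by omega)) hc0
  have htop : semiH (k + 1) T w = semiH (k + 1) T v := by
    refine (pow_left_inj₀ (semiH_nonneg _) (semiH_nonneg _) two_ne_zero).1 ?_
    rw [semiH_sq, semiH_sq]
    refine Finset.sum_congr rfl fun I _ => ?_
    have hL : (List.ofFn I).length = k + 1 := List.length_ofFn
    rw [norm0_congr]
    filter_upwards [hv.wderiv_sub hT hb (memH_polyFun hT hb _ p) hL.le,
      wderiv_polyFun hT hb (List.ofFn I) p] with x h1 h2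
    rw [h1, h2, pderivs_eq_zero hp' (by omega)]
    simp [polyFun]
  have h0 := hchain (k + 1) 0 (by omega)
  have h1 := hchain k 1 (by omega)
  rw [semiH_zero hT hb hwH.1, htop] at h0
  rw [← semi1_eq_semiH (hwH.mono (by omega)), htop] at h1
  calc norm0 T w + Metric.diam T * semi1 T w
      ≤ c ^ (k + 1) * semiH (k + 1) T v + Metric.diam T * (c ^ k * semiH (k + 1) T v) :=
        add_le_add h0 (mul_le_mul_of_nonneg_left h1 Metric.diam_nonneg)
    _ = _ := by rw [hc, mul_pow, mul_pow]; ring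

end brambleHilbert

/-! ### The `L²` projection onto polynomials -/

/-- The space `Poly d m` as a submodule. -/
def polySub (d : ℕ) (m : ℤ) : Submodule ℝ (E d → ℝ) where
  carrier := Poly d m
  add_mem' := Poly_add
  zero_mem' := Poly_zero_mem m
  smul_mem' a _ hf := Poly_const_mul a hf

/-- Evaluation of polynomials as a linear map into the space of functions. -/
def polyLin (d : ℕ) : MvPolynomial (Fin d) ℝ →ₗ[ℝ] E d → ℝ where
  toFun := polyFun
  map_add' p q := by funext x; simp [polyFun]
  map_smul' a p := by funext x; simp [polyFun]

instance finiteDimensional_polySub (d : ℕ) (m : ℤ) : FiniteDimensional ℝ (polySub d m) := by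
  have hle : polySub d m ≤ (MvPolynomial.restrictTotalDegree (Fin d) ℝ m.toNat).map (polyLin d) := by
    intro f hf
    obtain ⟨p, hp, rfl⟩ := mem_Poly_iff.1 hf
    refine ⟨p, (MvPolynomial.mem_restrictTotalDegree _ _ _).2 ?_, rfl⟩
    rcases hp with rfl | hp
    · simp
    · omega
  exact Submodule.finiteDimensional_of_le hle

theorem analyticOnNhd_polyFun (p : MvPolynomial (Fin d) ℝ) : AnalyticOnNhd ℝ (polyFun p) Set.univ := by
  have := AnalyticOnNhd.aeval_mvPolynomial (𝕜 := ℝ) (s := Set.univ) (f := fun (x : E d) i => x i)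
    (fun i => (EuclideanSpace.proj (𝕜 := ℝ) i).analyticOnNhd _) p
  convert! this using 1

section proj
variable {T : Set (E d)} {m : ℤ} {v w : E d → ℝ}

theorem Poly_memL2 (hT : IsOpen T) (hb : Bornology.IsBounded T) {f : E d → ℝ} (hf : f ∈ Poly d m) :
    MemL2 T f := memL2_of_continuous hT hb (Poly_contDiff hf).continuous

/-- Vanishing almost everywhere on `T` gives vanishing on `T` by continuity and on the whole space
by the identity theorem for analytic functions. Hence projections are unique as functions, not
merely almost everywhere. -/
theorem Poly_eq_zero (hT : IsOpen T) (hb : Bornology.IsBounded T) (hne : T.Nonempty) {f : E d → ℝ}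
    (hf : f ∈ Poly d m) (h0 : ∫ x in T, f x * f x = 0) : f = 0 := by
  have hc := (Poly_contDiff hf).continuous
  have h1 : f =ᵐ[volume.restrict T] 0 := by
    have := (integral_eq_zero_iff_of_nonneg (fun x => mul_self_nonneg (f x))
      ((Poly_memL2 hT hb hf).mul_integrable (Poly_memL2 hT hb hf))).1 h0
    exact this.mono fun x hx => mul_self_eq_zero.1 hx
  have h2 : Set.EqOn f 0 T :=
    Measure.eqOn_open_of_ae_eq h1 hT hc.continuousOn continuousOn_const
  obtain ⟨x, hx⟩ := hne
  obtain ⟨p, -, rfl⟩ := mem_Poly_iff.1 hf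
  exact (analyticOnNhd_polyFun p).eq_of_eventuallyEq analyticOnNhd_const
    (h2.eventuallyEq_of_mem (hT.mem_nhds hx))

/-- On the finite-dimensional polynomial space the L² product is definite, so its Gram map into the
dual is bijective. -/
theorem exists_proj (hT : IsOpen T) (hb : Bornology.IsBounded T) (hne : T.Nonempty)
    (hv : MemL2 T v) :
    ∃ p ∈ Poly d m, ∀ q ∈ Poly d m, ∫ x in T, (v x - p x) * q x = 0 := by
  have hi : ∀ p q : polySub d m, Integrable (fun x => p.1 x * q.1 x) (volume.restrict T) :=
    fun p q => (Poly_memL2 hT hb p.2).mul_integrable (Poly_memL2 hT hb q.2)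
  have hiv : ∀ q : polySub d m, Integrable (fun x => v x * q.1 x) (volume.restrict T) :=
    fun q => hv.mul_integrable (Poly_memL2 hT hb q.2)
  let B : polySub d m →ₗ[ℝ] Module.Dual ℝ (polySub d m) :=
    LinearMap.mk₂ ℝ (fun p q => ∫ x in T, p.1 x * q.1 x)
      (fun p p' q => by
        rw [← integral_add (hi _ _) (hi _ _)]
        exact integral_congr_ae (.of_forall fun x => by simp [add_mul]))
      (fun a p q => by
        rw [smul_eq_mul, ← integral_const_mul]
        exact integral_congr_ae (.of_forall fun x => by simp [mul_assoc]))
      (fun p q q' => by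
        rw [← integral_add (hi _ _) (hi _ _)]
        exact integral_congr_ae (.of_forall fun x => by simp [mul_add]))
      (fun a p q => by
        rw [smul_eq_mul, ← integral_const_mul]
        exact integral_congr_ae (.of_forall fun x => by simp [mul_left_comm]))
  have hinj : Function.Injective B := by
    rw [← LinearMap.ker_eq_bot, LinearMap.ker_eq_bot']
    intro p hp
    exact Subtype.ext (Poly_eq_zero hT hb hne p.2 (LinearMap.congr_fun hp p))
  have hsurj : Function.Surjective B :=
    (LinearMap.injective_iff_surjective_of_finrank_eq_finrank
      Subspace.dual_finrank_eq.symm).1 hinj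
  let l : Module.Dual ℝ (polySub d m) :=
    { toFun := fun q => ∫ x in T, v x * q.1 x
      map_add' := fun q q' => by
        rw [← integral_add (hiv _) (hiv _)]
        exact integral_congr_ae (.of_forall fun x => by simp [mul_add])
      map_smul' := fun a q => by
        rw [RingHom.id_apply, smul_eq_mul, ← integral_const_mul]
        exact integral_congr_ae (.of_forall fun x => by simp [mul_left_comm]) }
  obtain ⟨p, hp⟩ := hsurj l
  refine ⟨p.1, p.2, fun q hq => ?_⟩
  have h1 : ∫ x in T, p.1 x * q x = ∫ x in T, v x * q x := LinearMap.congr_fun hp ⟨q, hq⟩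
  simp only [sub_mul]
  rw [integral_sub (hiv ⟨q, hq⟩) (hi p ⟨q, hq⟩), h1, sub_self]

theorem proj_spec (hT : IsOpen T) (hb : Bornology.IsBounded T) (hne : T.Nonempty)
    (hv : MemL2 T v) :
    proj T m v ∈ Poly d m ∧ ∀ q ∈ Poly d m, ∫ x in T, (v x - proj T m v x) * q x = 0 := by
  have h := exists_proj (m := m) hT hb hne hv
  unfold proj
  rw [dif_pos h]
  exact h.choose_spec

theorem proj_mem (hT : IsOpen T) (hb : Bornology.IsBounded T) (hne : T.Nonempty)
    (hv : MemL2 T v) : proj T m v ∈ Poly d m := (proj_spec hT hb hne hv).1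

theorem memL2_proj (hT : IsOpen T) (hb : Bornology.IsBounded T) (hne : T.Nonempty)
    (hv : MemL2 T v) : MemL2 T (proj T m v) := Poly_memL2 hT hb (proj_mem hT hb hne hv)

theorem integral_proj_mul (hT : IsOpen T) (hb : Bornology.IsBounded T) (hne : T.Nonempty)
    (hv : MemL2 T v) {q : E d → ℝ} (hq : q ∈ Poly d m) :
    ∫ x in T, proj T m v x * q x = ∫ x in T, v x * q x := by
  have h := (proj_spec hT hb hne hv).2 q hq
  simp only [sub_mul] at h
  rw [integral_sub (hv.mul_integrable (Poly_memL2 hT hb hq))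
    ((memL2_proj hT hb hne hv).mul_integrable (Poly_memL2 hT hb hq))] at h
  linarith

theorem proj_eq (hT : IsOpen T) (hb : Bornology.IsBounded T) (hne : T.Nonempty)
    (hv : MemL2 T v) {p : E d → ℝ} (hp : p ∈ Poly d m)
    (h : ∀ q ∈ Poly d m, ∫ x in T, p x * q x = ∫ x in T, v x * q x) : proj T m v = p := by
  have hm : (fun x => proj T m v x + (-1) * p x) ∈ Poly d m :=
    Poly_add (proj_mem hT hb hne hv) (Poly_const_mul _ hp)
  have := Poly_eq_zero hT hb hne hm (by
    have e : ∀ x, (proj T m v x + (-1) * p x) * (proj T m v x + (-1) * p x) =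
        proj T m v x * (proj T m v x + (-1) * p x) - p x * (proj T m v x + (-1) * p x) := by
      intro x; ring
    simp only [e]
    rw [integral_sub ((memL2_proj hT hb hne hv).mul_integrable (Poly_memL2 hT hb hm))
      ((Poly_memL2 hT hb hp).mul_integrable (Poly_memL2 hT hb hm)),
      integral_proj_mul hT hb hne hv hm, h _ hm, sub_self])
  funext x
  have := congrFun this x
  simp only [Pi.zero_apply] at this
  linarith

theorem proj_congr (hT : IsOpen T) (hb : Bornology.IsBounded T) (hne : T.Nonempty)
    (hv : MemL2 T v) (h : v =ᵐ[volume.restrict T] w) : proj T m v = proj T m w := by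
  have hw : MemL2 T w := (memLp_congr_ae h).1 hv
  refine proj_eq hT hb hne hv (proj_mem hT hb hne hw) fun q hq => ?_
  rw [integral_proj_mul hT hb hne hw hq]
  exact integral_congr_ae (h.mono fun x hx => by simp only [hx])

theorem proj_of_mem (hT : IsOpen T) (hb : Bornology.IsBounded T) (hne : T.Nonempty)
    (hv : v ∈ Poly d m) : proj T m v = v :=
  proj_eq hT hb hne (Poly_memL2 hT hb hv) hv fun _ _ => rfl

theorem proj_add (hT : IsOpen T) (hb : Bornology.IsBounded T) (hne : T.Nonempty)
    (hv : MemL2 T v) (hw : MemL2 T w) :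
    proj T m (fun x => v x + w x) = fun x => proj T m v x + proj T m w x := by
  refine proj_eq hT hb hne (v := fun x => v x + w x) (hv.add hw) (Poly_add (proj_mem hT hb hne hv) (proj_mem hT hb hne hw))
    fun q hq => ?_
  have hq2 := Poly_memL2 hT hb hq
  simp only [add_mul]
  rw [integral_add (hv.mul_integrable hq2) (hw.mul_integrable hq2),
    integral_add ((memL2_proj hT hb hne hv).mul_integrable hq2)
      ((memL2_proj hT hb hne hw).mul_integrable hq2),
    integral_proj_mul hT hb hne hv hq, integral_proj_mul hT hb hne hw hq]

theorem proj_const_mul (hT : IsOpen T) (hb : Bornology.IsBounded T) (hne : T.Nonempty) (a : ℝ)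
    (hv : MemL2 T v) : proj T m (fun x => a * v x) = fun x => a * proj T m v x := by
  refine proj_eq hT hb hne (MemLp.const_mul hv a) (Poly_const_mul _ (proj_mem hT hb hne hv))
    fun q hq => ?_
  simp only [mul_assoc, integral_const_mul]
  rw [integral_proj_mul hT hb hne hv hq]

theorem norm0_proj_le (hT : IsOpen T) (hb : Bornology.IsBounded T) (hne : T.Nonempty)
    (hv : MemL2 T v) : norm0 T (proj T m v) ≤ norm0 T v := by
  have h1 := integral_proj_mul hT hb hne hv (proj_mem (m := m) hT hb hne hv)
  have h2 := integral_mul_le_L2n hv (memL2_proj (m := m) hT hb hne hv)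
  rw [← norm0_eq_L2n, ← norm0_eq_L2n, ← h1] at h2
  have h3 : ∫ x in T, proj T m v x * proj T m v x = norm0 T (proj T m v) ^ 2 := by
    rw [norm0, Real.sq_sqrt (integral_nonneg fun _ => sq_nonneg _)]
    simp only [pow_two]
  rw [h3, abs_of_nonneg (sq_nonneg _), pow_two] at h2
  by_contra hlt
  rw [not_le] at hlt
  have h4 : 0 < norm0 T (proj T m v) := lt_of_le_of_lt norm0_nonneg hlt
  exact absurd (le_of_mul_le_mul_right h2 h4) (not_le.2 hlt)

theorem memLp_projGrad (hT : IsOpen T) (hb : Bornology.IsBounded T) (hne : T.Nonempty)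
    (hv : MemH 1 T v) : MemLp (projGrad T m v) 2 (volume.restrict T) :=
  memLp_euclidean fun i => memL2_proj hT hb hne (hv.memL2_wderiv (L := [i]) le_rfl)

theorem L2n_projGrad_le (hT : IsOpen T) (hb : Bornology.IsBounded T) (hne : T.Nonempty)
    (hv : MemH 1 T v) : L2n (volume.restrict T) (projGrad T m v) ≤ semi1 T v := by
  refine (pow_le_pow_iff_left₀ (L2n_nonneg _) semi1_nonneg two_ne_zero).1 ?_
  rw [semi1_sq hv, L2n_sq_euclidean (memLp_projGrad hT hb hne hv)]
  refine Finset.sum_le_sum fun i _ => ?_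
  rw [← norm0_eq_L2n]
  exact pow_le_pow_left₀ norm0_nonneg
    (norm0_proj_le hT hb hne (hv.memL2_wderiv (L := [i]) le_rfl)) 2

theorem projGrad_add (hT : IsOpen T) (hb : Bornology.IsBounded T) (hne : T.Nonempty)
    (hv : MemH 1 T v) (hw : MemH 1 T w) :
    projGrad T m (fun x => v x + w x) = fun x => projGrad T m v x + projGrad T m w x := by
  funext x; ext i
  simp only [projGrad, PiLp.add_apply]
  rw [proj_congr hT hb hne ((hv.add hT hb hw).memL2_wderiv (L := [i]) le_rfl)
    (hv.wderiv_add hT hb hw le_rfl), proj_add hT hb hne (hv.memL2_wderiv (L := [i]) le_rfl)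
    (hw.memL2_wderiv (L := [i]) le_rfl)]

theorem projGrad_const_mul (hT : IsOpen T) (hb : Bornology.IsBounded T) (hne : T.Nonempty) (a : ℝ)
    (hv : MemH 1 T v) :
    projGrad T m (fun x => a * v x) = fun x => a • projGrad T m v x := by
  funext x; ext i
  simp only [projGrad, PiLp.smul_apply, smul_eq_mul]
  rw [proj_congr hT hb hne ((hv.const_mul a).memL2_wderiv (L := [i]) le_rfl)
    (hv.wderiv_const_mul hT hb a le_rfl), proj_const_mul hT hb hne a
    (hv.memL2_wderiv (L := [i]) le_rfl)]

end proj

/-! ### An inverse inequality for the Laplacian -/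

/-- A linear map into square-integrable functions, as a map into `L²`. -/
def toL2 {α V : Type*} [MeasurableSpace α] [AddCommGroup V] [Module ℝ V] {μ : Measure α}
    (Φ : V →ₗ[ℝ] α → ℝ) (h : ∀ p, MemLp (Φ p) 2 μ) : V →ₗ[ℝ] Lp ℝ 2 μ where
  toFun p := (h p).toLp
  map_add' p q := by
    rw [← MemLp.toLp_add]
    exact MemLp.toLp_congr _ _ (by rw [map_add])
  map_smul' a p := by
    rw [RingHom.id_apply, ← MemLp.toLp_const_smul]
    exact MemLp.toLp_congr _ _ (by rw [map_smul])

theorem norm_toL2 {α V : Type*} [MeasurableSpace α] [AddCommGroup V] [Module ℝ V] {μ : Measure α}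
    (Φ : V →ₗ[ℝ] α → ℝ) (h : ∀ p, MemLp (Φ p) 2 μ) (p : V) : ‖toL2 Φ h p‖ = L2n μ (Φ p) := by
  rw [L2n_eq_toReal (h p)]
  exact Lp.norm_toLp _ (h p)

/-- Equivalence of norms on a finite-dimensional space. -/
theorem exists_L2n_le {α β V : Type*} [MeasurableSpace α] [MeasurableSpace β] [AddCommGroup V]
    [Module ℝ V] [FiniteDimensional ℝ V] {μ : Measure α} {ν : Measure β} (Φ : V →ₗ[ℝ] α → ℝ)
    (Ψ : V →ₗ[ℝ] β → ℝ) (hΦ : ∀ p, MemLp (Φ p) 2 μ) (hΨ : ∀ p, MemLp (Ψ p) 2 ν)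
    (h0 : ∀ p, L2n μ (Φ p) = 0 → p = 0) :
    ∃ C : ℝ, 0 ≤ C ∧ ∀ p, L2n ν (Ψ p) ≤ C * L2n μ (Φ p) := by
  have hinj : Function.Injective (toL2 Φ hΦ) := by
    rw [← LinearMap.ker_eq_bot, LinearMap.ker_eq_bot']
    intro p hp
    exact h0 p (by rw [← norm_toL2 Φ hΦ, hp, norm_zero])
  let e := LinearEquiv.ofInjective (toL2 Φ hΦ) hinj
  let A := LinearMap.toContinuousLinearMap ((toL2 Ψ hΨ).comp e.symm.toLinearMap)
  refine ⟨‖A‖, A.opNorm_nonneg, fun p => ?_⟩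
  have h := A.le_opNorm (e p)
  have h1 : A (e p) = toL2 Ψ hΨ p := by
    change toL2 Ψ hΨ (e.symm (e p)) = _
    rw [e.symm_apply_apply]
  have h2 : ‖e p‖ = ‖toL2 Φ hΦ p‖ := rfl
  rwa [h1, h2, norm_toL2, norm_toL2] at h

theorem Poly_comp_affine {m : ℤ} {f : E d → ℝ} (hf : f ∈ Poly d m) (x0 : E d) (s : ℝ) :
    (fun y => f (x0 + s • y)) ∈ Poly d m := by
  obtain ⟨p, hp, rfl⟩ := mem_Poly_iff.1 hf
  let g : Fin d → MvPolynomial (Fin d) ℝ := fun i =>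
    MvPolynomial.C (x0 i) + MvPolynomial.C s * MvPolynomial.X i
  refine mem_Poly_iff.2 ⟨MvPolynomial.bind₁ g p, ?_, ?_⟩
  · rcases hp with rfl | hp
    · left; simp
    right
    refine le_trans (Int.ofNat_le.2 ?_) hp
    have hg : ∀ i, (g i).totalDegree ≤ 1 := fun i => by
      refine (MvPolynomial.totalDegree_add _ _).trans (max_le (by simp) ?_)
      refine (MvPolynomial.totalDegree_mul _ _).trans ?_
      simp
    rw [MvPolynomial.bind₁, MvPolynomial.aeval_def, MvPolynomial.eval₂_eq']
    refine MvPolynomial.totalDegree_finsetSum_le fun a ha => ?_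
    refine (MvPolynomial.totalDegree_mul _ _).trans ?_
    have h1 : (algebraMap ℝ (MvPolynomial (Fin d) ℝ) (MvPolynomial.coeff a p)).totalDegree = 0 :=
      MvPolynomial.totalDegree_C _
    rw [h1, zero_add]
    refine (MvPolynomial.totalDegree_finsetProd _ _).trans ?_
    refine le_trans (Finset.sum_le_sum fun i _ => ?_) ((Finsupp.sum_fintype a (fun _ e => e)
      (by simp)).symm.le.trans (MvPolynomial.le_totalDegree ha))
    refine (MvPolynomial.totalDegree_pow _ _).trans ?_
    calc a i * (g i).totalDegree ≤ a i * 1 := Nat.mul_le_mul_left _ (hg i)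
      _ = a i := mul_one _
  · funext y
    simp only [polyFun]
    clear hp hf
    induction p using MvPolynomial.induction_on with
    | C a => simp
    | add p q hp hq => simp_all
    | mul_X p i hp => simp_all [g]

theorem integral_comp_affine {F : E d → ℝ} (x0 : E d) {s : ℝ} (hs : 0 < s) :
    ∫ x, F (s⁻¹ • (x - x0)) = s ^ d * ∫ y, F y := by
  rw [integral_sub_right_eq_self (fun x => F (s⁻¹ • x)) x0, Measure.integral_comp_inv_smul]
  simp [abs_of_pos (pow_pos hs d)]

theorem pd_comp_affine {W : E d → ℝ} (hW : ContDiff ℝ ∞ W) (x0 : E d) (c : ℝ) (i : Fin d) (x : E d) :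
    pd i (fun x => W (c • (x - x0))) x = c * pd i W (c • (x - x0)) := by
  have h1 : HasFDerivAt W (fderiv ℝ W (c • (x - x0))) (c • (x - x0)) :=
    ((hW.differentiable (by simp)) _).hasFDerivAt
  have h2 : HasFDerivAt (fun x : E d => c • (x - x0)) (c • ContinuousLinearMap.id ℝ (E d)) x :=
    ((hasFDerivAt_id x).sub_const x0).const_smul c
  have h3 := h1.comp x h2
  unfold pd
  rw [show (fun x => W (c • (x - x0))) = W ∘ fun x => c • (x - x0) from rfl, h3.fderiv]
  simp

/-- Multiplication by a smooth function, as a linear map on polynomials. -/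
def mulLin (d : ℕ) (m : ℤ) (χ : E d → ℝ) : polySub d m →ₗ[ℝ] E d → ℝ where
  toFun p := fun x => χ x * p.1 x
  map_add' p q := by funext x; simp [mul_add]
  map_smul' a p := by funext x; simp [mul_left_comm]

/-- Multiplication by a smooth function and differentiation, as a linear map on polynomials. -/
def pdMulLin (d : ℕ) (m : ℤ) {χ : E d → ℝ} (hχ : ContDiff ℝ ∞ χ) (i : Fin d) :
    polySub d m →ₗ[ℝ] E d → ℝ where
  toFun p := pd i (fun x => χ x * p.1 x)
  map_add' p q := by
    funext x
    have hp := Poly_contDiff p.2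
    have hq := Poly_contDiff q.2
    have e : (fun x => χ x * (p + q).1 x) = (fun x => χ x * p.1 x) + fun x => χ x * q.1 x := by
      funext x; simp [mul_add]
    unfold pd
    rw [e, fderiv_add (((hχ.mul hp).differentiable (by simp)) x)
      (((hχ.mul hq).differentiable (by simp)) x)]
    rfl
  map_smul' a p := by
    funext x
    have hp := Poly_contDiff p.2
    have e : (fun x => χ x * (a • p).1 x) = a • fun x => χ x * p.1 x := by
      funext x; simp [mul_left_comm]
    unfold pd
    rw [e, fderiv_const_smul (((hχ.mul hp).differentiable (by simp)) x)]
    rfl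

/-- The inequalities on the reference ball behind the inverse inequality. -/
theorem exists_reference_bounds (d : ℕ) (m : ℤ) (R : ℝ) :
    ∃ (ψ : E d → ℝ) (C : ℝ), ContDiff ℝ ∞ ψ ∧ tsupport ψ ⊆ Metric.closedBall 0 (1 / 2) ∧ 0 ≤ C ∧
      ∀ p ∈ Poly d m,
        ∫ y in Metric.closedBall (0 : E d) R, p y ^ 2 ≤ C * ∫ y, (ψ y * p y) ^ 2 ∧
        ∑ i, ∫ y, pd i (fun y => ψ y ^ 2 * p y) y ^ 2 ≤ C * ∫ y, (ψ y * p y) ^ 2 := by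
  -- The cutoff is 1 on the ball of radius 1/4, so `φ * p = 0` forces `p = 0`. Thus the norm of `φ *
  -- p` is a norm on a finite-dimensional space and dominates the other two seminorms.
  let φ : ContDiffBump (0 : E d) := ⟨1 / 4, 1 / 2, by norm_num, by norm_num⟩
  have hφs : ContDiff ℝ ∞ (φ : E d → ℝ) := φ.contDiff
  have hφc : HasCompactSupport (φ : E d → ℝ) := φ.hasCompactSupport
  have hφ2 : ContDiff ℝ ∞ (fun y => φ y ^ 2) := hφs.pow 2
  have hφ2c : HasCompactSupport (fun y => φ y ^ 2) := by
    exact hφc.comp_left (g := fun t => t ^ 2) (by simp)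
  have hm0 : ∀ p, MemLp (mulLin d m φ p) 2 (volume : Measure (E d)) := fun p =>
    (hφs.continuous.mul (Poly_contDiff p.2).continuous).memLp_of_hasCompactSupport hφc.mul_right
  have hm1 : ∀ p, MemLp (mulLin d m (fun _ => 1) p) 2 (volume.restrict (Metric.closedBall (0 : E d) R)) :=
    fun p => memLp_of_continuous Metric.isBounded_closedBall Metric.isBounded_closedBall.measure_lt_top
      Metric.isClosed_closedBall.measurableSet (continuous_const.mul (Poly_contDiff p.2).continuous) 2
  have hm2 : ∀ i p, MemLp (pdMulLin d m hφ2 i p) 2 (volume : Measure (E d)) := fun i p => by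
    have hc : HasCompactSupport fun y => φ y ^ 2 * p.1 y := hφ2c.mul_right
    refine (contDiff_pd (hφ2.mul (Poly_contDiff p.2)) i).continuous.memLp_of_hasCompactSupport ?_
    exact (hc.fderiv ℝ).comp_left (g := fun A : E d →L[ℝ] ℝ => A (EuclideanSpace.single i 1)) rfl
  have h0 : ∀ p, L2n volume (mulLin d m φ p) = 0 → p = 0 := fun p hp => by
    have h1 : ∫ y, ‖mulLin d m φ p y‖ ^ 2 = 0 := by rw [← L2n_sq, hp]; simp
    have hB : (Metric.ball (0 : E d) (1 / 4)).Nonempty := ⟨0, by simp⟩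
    refine Subtype.ext (Poly_eq_zero Metric.isOpen_ball Metric.isBounded_ball hB p.2 ?_)
    refine le_antisymm ?_ (integral_nonneg fun x => mul_self_nonneg _)
    rw [← h1]
    calc ∫ x in Metric.ball (0 : E d) (1 / 4), p.1 x * p.1 x
        = ∫ x in Metric.ball (0 : E d) (1 / 4), ‖mulLin d m φ p x‖ ^ 2 := by
          refine setIntegral_congr_fun measurableSet_ball fun x hx => ?_
          have : φ x = 1 := φ.one_of_mem_closedBall (Metric.ball_subset_closedBall hx)
          simp [mulLin, this, pow_two]
      _ ≤ _ := setIntegral_le_integral ((hm0 p).integrable_norm_pow (by norm_num))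
          (.of_forall fun _ => by positivity)
  obtain ⟨C1, hC1, h1⟩ := exists_L2n_le _ _ hm0 hm1 h0
  choose C2 hC2 h2 using fun i => exists_L2n_le _ _ hm0 (hm2 i) h0
  refine ⟨φ, C1 ^ 2 + ∑ i, C2 i ^ 2, hφs, ?_, by positivity, fun p hp => ?_⟩
  · rw [φ.tsupport_eq]
  have e0 : L2n volume (mulLin d m φ ⟨p, hp⟩) ^ 2 = ∫ y, (φ y * p y) ^ 2 := by
    rw [L2n_sq]; simp only [mulLin, LinearMap.coe_mk, AddHom.coe_mk, Real.norm_eq_abs, sq_abs]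
  have hN : 0 ≤ ∫ y, (φ y * p y) ^ 2 := integral_nonneg fun _ => sq_nonneg _
  constructor
  · have := pow_le_pow_left₀ (L2n_nonneg _) (h1 ⟨p, hp⟩) 2
    rw [mul_pow, e0, L2n_sq] at this
    simp only [mulLin, LinearMap.coe_mk, AddHom.coe_mk, one_mul, Real.norm_eq_abs, sq_abs] at this
    refine this.trans (mul_le_mul_of_nonneg_right ?_ hN)
    have : 0 ≤ ∑ i, C2 i ^ 2 := Finset.sum_nonneg fun _ _ => sq_nonneg _
    linarith
  · calc ∑ i, ∫ y, pd i (fun y => φ y ^ 2 * p y) y ^ 2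
        ≤ ∑ i, C2 i ^ 2 * ∫ y, (φ y * p y) ^ 2 := by
          refine Finset.sum_le_sum fun i _ => ?_
          have := pow_le_pow_left₀ (L2n_nonneg _) (h2 i ⟨p, hp⟩) 2
          rw [mul_pow, e0, L2n_sq] at this
          simpa [pdMulLin] using this
      _ = (∑ i, C2 i ^ 2) * ∫ y, (φ y * p y) ^ 2 := by rw [Finset.sum_mul]
      _ ≤ _ := mul_le_mul_of_nonneg_right (by nlinarith [sq_nonneg C1]) hN

/-- The inverse inequality `‖r‖ ≤ C h⁻¹ |v|₁` for functions `v` with polynomial Laplacian `r`. -/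
theorem exists_inverse_inequality (d : ℕ) (m : ℤ) {ρ : ℝ} (hρ : 0 < ρ) :
    ∃ C : ℝ, 0 ≤ C ∧ ∀ (T : Set (E d)) (x0 : E d), IsStarDomain T x0 (ρ * Metric.diam T) →
      ∀ (v r : E d → ℝ), MemH 1 T v → r ∈ Poly d m →
        (∀ w, IsTest T w → (∫ x in T, inner ℝ (wgrad T v x) (gradient w x)) +
          ∫ x in T, r x * w x = 0) →
        norm0 T r * Metric.diam T ≤ C * semi1 T v := by
  obtain ⟨ψ, C, hψ, hsupp, hC, hb⟩ := exists_reference_bounds d m (1 / ρ)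
  refine ⟨C * ρ⁻¹, by positivity, fun T x0 hT v r hv hr hgreen => ?_⟩
  -- Scaling by `s` makes the ball of star-shapedness the unit ball and puts `T` into the ball of
  -- radius `1 / ρ`, whatever its shape; so the reference constant depends on `d`, `m`, `ρ` only.
  set s := ρ * Metric.diam T with hs
  have hs0 : 0 < s := hT.pos
  set p : E d → ℝ := fun y => r (x0 + s • y) with hp
  have hpP : p ∈ Poly d m := Poly_comp_affine hr x0 s
  obtain ⟨hb1, hb2⟩ := hb p hpP
  set N := ∫ y, (ψ y * p y) ^ 2 with hN
  have hN0 : 0 ≤ N := integral_nonneg fun _ => sq_nonneg _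
  have hback : ∀ x, p (s⁻¹ • (x - x0)) = r x := fun x => by
    simp only [hp, smul_smul, mul_inv_cancel₀ hs0.ne', one_smul, add_sub_cancel]
  -- The localized test function: tested against `r` it returns the square norm `N` of `ψ * p` up to
  -- scaling, and its gradient is bounded by the same `N`.
  set W : E d → ℝ := fun y => ψ y ^ 2 * p y with hW
  have hWs : ContDiff ℝ ∞ W := (hψ.pow 2).mul (Poly_contDiff hpP)
  set w : E d → ℝ := fun x => W (s⁻¹ • (x - x0)) with hw
  have hws : ContDiff ℝ ∞ w := hWs.comp ((contDiff_id.sub contDiff_const).const_smul _)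
  have hwsupp : tsupport w ⊆ Metric.closedBall x0 (s / 2) := by
    refine closure_minimal (fun x hx => ?_) Metric.isClosed_closedBall
    have h1 : s⁻¹ • (x - x0) ∈ tsupport ψ := subset_tsupport _ fun h0 => hx (by simp [hw, hW, h0])
    have h2 := hsupp h1
    rw [mem_closedBall_zero_iff, norm_smul, norm_inv, Real.norm_eq_abs, abs_of_pos hs0,
      inv_mul_le_iff₀ hs0] at h2
    rw [mem_closedBall_iff_norm]; linarith
  have hwt : IsTest T w := ⟨hws, (isCompact_closedBall x0 _).of_isClosed_subset (isClosed_tsupport _)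
    hwsupp, hwsupp.trans ((Metric.closedBall_subset_ball (by linarith)).trans hT.ball_subset)⟩
  have hD : 0 < Metric.diam T := (pos_iff_pos_of_mul_pos hT.pos).1 hρ
  -- the three scaled quantities
  have q1 : ∫ x in T, r x * w x = s ^ d * N := by
    rw [hwt.setIntegral_mul, hN, ← integral_comp_affine x0 hs0]
    refine integral_congr_ae (.of_forall fun x => ?_)
    simp only [hw, hW, hback]; ring
  have q2 : ∫ x in T, r x ^ 2 ≤ C * (s ^ d * N) := by
    have hsub : T ⊆ Metric.closedBall x0 (Metric.diam T) := fun x hx =>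
      Metric.dist_le_diam_of_mem hT.bounded hx (hT.ball_subset (Metric.mem_ball_self hT.pos))
    have hrc := (Poly_contDiff hr).continuous
    calc ∫ x in T, r x ^ 2 ≤ ∫ x in Metric.closedBall x0 (Metric.diam T), r x ^ 2 :=
          setIntegral_mono_set ((by fun_prop : Continuous fun x => r x ^ 2).continuousOn.integrableOn_compact
            (isCompact_closedBall _ _))
            (.of_forall fun _ => sq_nonneg _) hsub.eventuallyLE
      _ = ∫ x, (Metric.closedBall (0 : E d) (1 / ρ)).indicator (fun y => p y ^ 2)
            (s⁻¹ • (x - x0)) := by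
          rw [← integral_indicator Metric.isClosed_closedBall.measurableSet]
          refine integral_congr_ae (.of_forall fun x => ?_)
          have hiff : x ∈ Metric.closedBall x0 (Metric.diam T) ↔
              s⁻¹ • (x - x0) ∈ Metric.closedBall (0 : E d) (1 / ρ) := by
            rw [mem_closedBall_iff_norm, mem_closedBall_zero_iff, norm_smul, norm_inv,
              Real.norm_eq_abs, abs_of_pos hs0, inv_mul_le_iff₀ hs0, hs]
            have : ρ * Metric.diam T * (1 / ρ) = Metric.diam T := by field_simp
            rw [this]
          by_cases hx : x ∈ Metric.closedBall x0 (Metric.diam T)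
          · simp only [Set.indicator_of_mem hx, Set.indicator_of_mem (hiff.1 hx), hback]
          · simp only [Set.indicator_of_notMem hx, Set.indicator_of_notMem (fun h => hx (hiff.2 h))]
      _ = s ^ d * ∫ y in Metric.closedBall (0 : E d) (1 / ρ), p y ^ 2 := by
          rw [integral_comp_affine x0 hs0, integral_indicator Metric.isClosed_closedBall.measurableSet]
      _ ≤ s ^ d * (C * N) := mul_le_mul_of_nonneg_left hb1 (by positivity)
      _ = _ := by ring
  have hgm : MemLp (gradient w) 2 (volume.restrict T) :=
    memLp_of_continuous hT.bounded (volume_lt_top hT.bounded) hT.isOpen.measurableSet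
      (continuous_gradient hws) 2
  have q3 : L2n (volume.restrict T) (gradient w) ^ 2 ≤ s⁻¹ ^ 2 * (C * (s ^ d * N)) := by
    rw [L2n_sq_euclidean hgm]
    calc ∑ i, L2n (volume.restrict T) (fun x => gradient w x i) ^ 2
        = ∑ i, ∫ x, pd i w x ^ 2 := by
          refine Finset.sum_congr rfl fun i _ => ?_
          rw [L2n_sq]
          simp only [gradient_apply, Real.norm_eq_abs, sq_abs]
          exact setIntegral_eq_integral_of_forall_compl_eq_zero fun x hx => by
            rw [(hwt.pd i).eq_zero hx]; simp
      _ = ∑ i, s⁻¹ ^ 2 * (s ^ d * ∫ y, pd i W y ^ 2) := by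
          refine Finset.sum_congr rfl fun i _ => ?_
          simp only [hw, pd_comp_affine hWs, mul_pow]
          rw [integral_const_mul, integral_comp_affine x0 hs0 (F := fun y => pd i W y ^ 2)]
      _ = s⁻¹ ^ 2 * (s ^ d * ∑ i, ∫ y, pd i W y ^ 2) := by rw [← Finset.mul_sum, ← Finset.mul_sum]
      _ ≤ s⁻¹ ^ 2 * (s ^ d * (C * N)) := by gcongr
      _ = _ := by ring
  -- conclusion
  set κ := s ^ d * N with hκ
  have hκ0 : 0 ≤ κ := by positivity
  -- Green's formula turns `∫ r w` into `-∫ ∇v · ∇w`, so `κ` is bounded by a multiple of `√κ`;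
  -- dividing, with `κ = 0` treated apart, bounds `√κ`.
  have hE : κ ≤ semi1 T v * (s⁻¹ * √(C * κ)) := by
    have h1 := hgreen w hwt
    rw [q1] at h1
    have h2 := integral_norm_mul_le_L2n (C := 1) zero_le_one hv.memLp_wgrad hgm
      (B := fun x => inner ℝ (wgrad T v x) (gradient w x))
      (.of_forall fun x => by rw [one_mul]; exact abs_real_inner_le_norm _ _)
    rw [one_mul, ← semi1_eq_L2n] at h2
    have h3 : L2n (volume.restrict T) (gradient w) ≤ s⁻¹ * √(C * κ) := by
      refine (pow_le_pow_iff_left₀ (L2n_nonneg _) (by positivity) two_ne_zero).1 ?_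
      rw [mul_pow, Real.sq_sqrt (by positivity)]; exact q3
    have h4 : κ = -∫ x in T, inner ℝ (wgrad T v x) (gradient w x) := by linarith
    refine h4.le.trans ?_
    exact (neg_le_abs _).trans (h2.trans (mul_le_mul_of_nonneg_left h3 semi1_nonneg))
  have hsq : √κ ≤ √C * s⁻¹ * semi1 T v := by
    rcases hκ0.eq_or_lt with h0 | h0
    · rw [← h0, Real.sqrt_zero]
      have := semi1_nonneg (T := T) (v := v)
      positivity
    · rw [Real.sqrt_mul hC] at hE
      have h5 : √κ * √κ = κ := Real.mul_self_sqrt hκ0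
      have h6 : 0 < √κ := Real.sqrt_pos.2 h0
      refine le_of_mul_le_mul_right ?_ h6
      rw [h5]; linarith
  have hr' : norm0 T r ≤ √C * √κ := by
    rw [norm0, ← Real.sqrt_mul hC]
    exact Real.sqrt_le_sqrt q2
  have h7 : √C * √C = C := Real.mul_self_sqrt hC
  calc norm0 T r * Metric.diam T ≤ √C * (√C * s⁻¹ * semi1 T v) * Metric.diam T := by
        gcongr
        exact hr'.trans (by gcongr)
    _ = (√C * √C) * (s⁻¹ * Metric.diam T) * semi1 T v := by ring
    _ = C * ρ⁻¹ * semi1 T v := by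
        rw [h7, hs]; congr 2; field_simp

/-! ### The local virtual element space -/

theorem _root_.MeasureTheory.MemLp.integrable_inner {α H : Type*} [MeasurableSpace α]
    [NormedAddCommGroup H] [InnerProductSpace ℝ H] {μ : Measure α} {f g : α → H} (hf : MemLp f 2 μ)
    (hg : MemLp g 2 μ) : Integrable (fun x => (inner ℝ (f x) (g x) : ℝ)) μ :=
  (hf.norm.integrable_mul hg.norm).mono' (hf.1.inner hg.1)
    (.of_forall fun _ => norm_inner_le_norm _ _)

theorem tendsto_integral_inner {α H : Type*} [MeasurableSpace α] [NormedAddCommGroup H]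
    [InnerProductSpace ℝ H] {μ : Measure α} {f g0 : α → H} {g : ℕ → α → H} (hf : MemLp f 2 μ)
    (hg : ∀ n, MemLp (g n) 2 μ) (hg0 : MemLp g0 2 μ)
    (h : Tendsto (fun n => ∫ x, ‖g n x - g0 x‖ ^ 2 ∂μ) atTop (𝓝 0)) :
    Tendsto (fun n => ∫ x, inner ℝ (f x) (g n x) ∂μ) atTop (𝓝 (∫ x, inner ℝ (f x) (g0 x) ∂μ)) := by
  have hs : Tendsto (fun n => L2n μ f * L2n μ (fun x => g n x - g0 x)) atTop (𝓝 0) := by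
    have := (h.sqrt).const_mul (L2n μ f)
    rwa [Real.sqrt_zero, mul_zero] at this
  rw [tendsto_iff_norm_sub_tendsto_zero]
  refine squeeze_zero (fun n => norm_nonneg _) (fun n => ?_) hs
  rw [← integral_sub ((hf.integrable_inner (hg n))) (hf.integrable_inner hg0), Real.norm_eq_abs]
  refine (integral_norm_mul_le_L2n (C := 1) zero_le_one hf ((hg n).sub hg0)
    (.of_forall fun x => ?_)).trans_eq (one_mul _)
  rw [one_mul, ← inner_sub_right]
  exact abs_real_inner_le_norm _ _

/-- Green's formula for a vector field `X` with divergence `r` and normal components `q`. -/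
def GreenId (T : Set (E d)) (F : Finset (Set (E d))) (X : E d → E d) (r : E d → ℝ)
    (q : Set (E d) → E d → ℝ) : Prop :=
  ∀ w : E d → ℝ, ContDiff ℝ ∞ w →
    (∫ x in T, inner ℝ (X x) (gradient w x)) + (∫ x in T, r x * w x)
      = ∑ e ∈ F, ∫ x in e, q e x * w x ∂(surf d)

section local_space
variable {T : Set (E d)} {x0 : E d} {s : ℝ} {F : Finset (Set (E d))} {n : Set (E d) → E d}
  {a : Set (E d) → ℝ} {X Y : E d → E d} {r t : E d → ℝ} {q p : Set (E d) → E d → ℝ} {k : ℕ}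
  {v w u uI : E d → ℝ}

theorem IsPolyBoundary.memLp_face (h : IsPolyBoundary T x0 s F n a) {e : Set (E d)} (he : e ∈ F)
    {f : E d → ℝ} (hf : Continuous f) : MemLp f 2 ((surf d).restrict e) :=
  memLp_of_continuous (h.compact e he).isBounded (h.surf_lt_top he) (h.compact e he).measurableSet
    hf 2

theorem IsPolyBoundary.memLp_smooth {H : Type*} [NormedAddCommGroup H] [SecondCountableTopology H]
    (h : IsPolyBoundary T x0 s F n a)
    {f : E d → H} (hf : Continuous f) : MemLp f 2 (volume.restrict T) :=
  memLp_of_continuous h.star.bounded (volume_lt_top h.star.bounded) h.star.isOpen.measurableSet hf 2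

/-- Green's formula extends to functions with a trace. -/
theorem GreenId.trace (hG : GreenId T F X r q) (h : IsPolyBoundary T x0 s F n a)
    (hX : MemLp X 2 (volume.restrict T)) (hr : MemL2 T r) (hq : ∀ e ∈ F, Continuous (q e))
    (hw : MemH 1 T w) {g : E d → ℝ} (hg : HasTrace T w g) :
    (∫ x in T, inner ℝ (X x) (wgrad T w x)) + (∫ x in T, r x * w x)
      = ∑ e ∈ F, ∫ x in e, q e x * g x ∂(surf d) := by
  obtain ⟨hg2, φ, hφ, h1, h2, h3⟩ := hg
  have hφm : ∀ m, MemLp (φ m) 2 ((surf d).restrict (frontier T)) := fun m =>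
    memLp_of_continuous (h.star.bounded.closure.subset frontier_subset_closure)
      h.surf_frontier_lt_top isClosed_frontier.measurableSet (hφ m).continuous 2
  have l1 := tendsto_integral_inner hX (fun m => h.memLp_smooth (continuous_gradient (hφ m)))
    hw.memLp_wgrad h2
  have l2 : Tendsto (fun m => ∫ x in T, r x * φ m x) atTop (𝓝 (∫ x in T, r x * w x)) := by
    have := tendsto_integral_inner hr (fun m => h.memLp_smooth (hφ m).continuous) hw.1
      (by simpa using h1)
    simpa [mul_comm] using this
  have l3 : Tendsto (fun m => ∑ e ∈ F, ∫ x in e, q e x * φ m x ∂(surf d)) atTop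
      (𝓝 (∑ e ∈ F, ∫ x in e, q e x * g x ∂(surf d))) := by
    refine tendsto_finsetSum _ fun e he => ?_
    have hle : (surf d).restrict e ≤ (surf d).restrict (frontier T) :=
      Measure.restrict_mono_set _ (h.subset he)
    have hge := hg2.mono_measure hle
    have hφe : ∀ m, MemLp (φ m) 2 ((surf d).restrict e) := fun m => (hφm m).mono_measure hle
    have := tendsto_integral_inner (h.memLp_face he (hq e he)) hφe hge
      (squeeze_zero (fun m => integral_nonneg fun x => by positivity) (fun m => by
        simp only [Real.norm_eq_abs, sq_abs]
        exact integral_mono_measure hle (.of_forall fun x => sq_nonneg _)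
          (by simpa using ((hφm m).sub hg2).integrable_norm_pow (by norm_num))) h3)
    simpa [mul_comm] using this
  refine tendsto_nhds_unique (l1.add l2) ?_
  simpa only [hG _ (hφ _)] using l3

theorem GreenId.add (hG : GreenId T F X r q) (hG' : GreenId T F Y t p)
    (h : IsPolyBoundary T x0 s F n a) (hX : MemLp X 2 (volume.restrict T))
    (hY : MemLp Y 2 (volume.restrict T)) (hr : MemL2 T r) (ht : MemL2 T t)
    (hq : ∀ e ∈ F, Continuous (q e)) (hp : ∀ e ∈ F, Continuous (p e)) :
    GreenId T F (fun x => X x + Y x) (fun x => r x + t x) (fun e x => q e x + p e x) := by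
  intro w hw
  have hgw := h.memLp_smooth (continuous_gradient hw)
  have hw2 : MemL2 T w := h.memLp_smooth hw.continuous
  simp only [inner_add_left, add_mul]
  rw [integral_add (hX.integrable_inner hgw) (hY.integrable_inner hgw),
    integral_add (hr.mul_integrable hw2) (ht.mul_integrable hw2)]
  have e : ∀ e ∈ F, ∫ x in e, (q e x * w x + p e x * w x) ∂(surf d) =
      (∫ x in e, q e x * w x ∂(surf d)) + ∫ x in e, p e x * w x ∂(surf d) := fun e he =>
    integral_add ((h.memLp_face he (hq e he)).integrable_mul (h.memLp_face he hw.continuous))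
      ((h.memLp_face he (hp e he)).integrable_mul (h.memLp_face he hw.continuous))
  rw [Finset.sum_congr rfl e, Finset.sum_add_distrib, ← hG w hw, ← hG' w hw]
  ring

theorem GreenId.const_mul (hG : GreenId T F X r q) (c : ℝ) :
    GreenId T F (fun x => c • X x) (fun x => c * r x) (fun e x => c * q e x) := by
  intro w hw
  simp only [real_inner_smul_left, mul_assoc, integral_const_mul]
  rw [← Finset.mul_sum, ← hG w hw, mul_add]

theorem GreenId.congr (hG : GreenId T F X r q) (hXY : X =ᵐ[volume.restrict T] Y) :
    GreenId T F Y r q := by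
  intro w hw
  rw [← hG w hw]
  congr 1
  exact integral_congr_ae (hXY.mono fun x hx => by simp only [hx])

theorem MemVLoc.add (h : IsPolyBoundary T x0 s F n a) (hv : MemVLoc k T F v) (hw : MemVLoc k T F w) :
    MemVLoc k T F (fun x => v x + w x) := by
  obtain ⟨hv1, r, hr, q, hq, hG⟩ := hv
  obtain ⟨hw1, t, ht, p, hp, hG'⟩ := hw
  have hT := h.star.isOpen
  have hb := h.star.bounded
  exact ⟨hv1.add hT hb hw1, _, Poly_add hr ht, _, fun e he => Poly_add (hq e he) (hp e he),
    (GreenId.add (X := wgrad T v) (Y := wgrad T w) hG hG' h hv1.memLp_wgrad hw1.memLp_wgrad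
      (Poly_memL2 hT hb hr) (Poly_memL2 hT hb ht) (fun e he => (Poly_contDiff (hq e he)).continuous)
      (fun e he => (Poly_contDiff (hp e he)).continuous)).congr (hv1.wgrad_add hT hb hw1).symm⟩

theorem MemVLoc.const_mul (h : IsPolyBoundary T x0 s F n a) (c : ℝ) (hv : MemVLoc k T F v) :
    MemVLoc k T F (fun x => c * v x) := by
  obtain ⟨hv1, r, hr, q, hq, hG⟩ := hv
  exact ⟨hv1.const_mul c, _, Poly_const_mul c hr, _, fun e he => Poly_const_mul c (hq e he),
    (GreenId.const_mul (X := wgrad T v) hG c).congr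
      (hv1.wgrad_const_mul h.star.isOpen h.star.bounded c).symm⟩

theorem MemVLoc.sub (h : IsPolyBoundary T x0 s F n a) (hv : MemVLoc k T F v) (hw : MemVLoc k T F w) :
    MemVLoc k T F (fun x => v x - w x) := by
  rw [sub_eq_add_neg_one_mul]; exact hv.add h (hw.const_mul h _)

/-- Green's formula for test functions has no boundary terms. -/
theorem GreenId.test (hG : GreenId T F X r q) (h : IsPolyBoundary T x0 s F n a)
    (hw : IsTest T w) :
    (∫ x in T, inner ℝ (X x) (gradient w x)) + (∫ x in T, r x * w x) = 0 := by
  rw [hG w hw.1]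
  refine Finset.sum_eq_zero fun e he => ?_
  refine setIntegral_eq_zero_of_forall_eq_zero fun x hx => ?_
  have : x ∉ T := fun hxT => by
    have := (h.subset he hx).2
    rw [h.star.isOpen.interior_eq] at this
    exact this hxT
  rw [hw.eq_zero this, mul_zero]

theorem GreenId.wlap_ae_eq (hG : GreenId T F (wgrad T v) r q) (h : IsPolyBoundary T x0 s F n a)
    (hv : MemH 1 T v) (hr : MemL2 T r) : wlap T v =ᵐ[volume.restrict T] r := by
  have hT := h.star.isOpen
  have hb := h.star.bounded
  have hlap : HasWeakLap T v r := fun φ hφ => by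
    have h1 := hG.test h hφ
    have hi : ∀ i, Integrable (fun x => v x * pds [i, i] φ x) (volume.restrict T) := fun i =>
      hv.1.mul_integrable ((hφ.pds [i, i]).memL2 hT hb)
    have hi' : ∀ i, Integrable (fun x => wderiv T [i] v x * pd i φ x) (volume.restrict T) := fun i =>
      (hv.memL2_wderiv (L := [i]) le_rfl).mul_integrable ((hφ.pd i).memL2 hT hb)
    have h2 : ∫ x in T, inner ℝ (wgrad T v x) (gradient φ x) =
        ∑ i, ∫ x in T, wderiv T [i] v x * pd i φ x := by
      rw [← integral_finsetSum _ fun i _ => hi' i]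
      refine integral_congr_ae (.of_forall fun x => ?_)
      simp only [PiLp.inner_apply, gradient_apply, wgrad]
      exact Finset.sum_congr rfl fun i _ => by simp [mul_comm]
    simp only [Finset.mul_sum]
    rw [integral_finsetSum _ fun i _ => hi i]
    have h3 : ∀ i, ∫ x in T, v x * pds [i, i] φ x = - ∫ x in T, wderiv T [i] v x * pd i φ x :=
      fun i => by
        have := hv.hasWeakDeriv (L := [i]) le_rfl _ (hφ.pd i)
        simpa [pds] using this
    simp only [h3, Finset.sum_neg_distrib]
    linarith
  have hex : ∃ g, MemL2 T g ∧ HasWeakLap T v g := ⟨r, hr, hlap⟩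
  have hsp : MemL2 T (wlap T v) ∧ HasWeakLap T v (wlap T v) := by
    unfold wlap; rw [dif_pos hex]; exact hex.choose_spec
  exact ae_eq_of_forall_isTest hT hb hsp.1 hr fun φ hφ => (hsp.2 φ hφ).symm.trans (hlap φ hφ)

/-- Test functions identify the weak Laplacian with the polynomial in Green's formula, so the
projection in the streamline term changes it at most on a null set. The projected Laplacian thus
satisfies the hypotheses of the inverse inequality. -/
theorem MemVLoc.wlap (h : IsPolyBoundary T x0 s F n a) (hv : MemVLoc k T F v) :
    ∃ q, MemL2 T (wlap T v) ∧ proj T ((k : ℤ) - 2) (wlap T v) ∈ Poly d ((k : ℤ) - 2) ∧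
      (∀ e ∈ F, q e ∈ Poly d ((k : ℤ) - 1)) ∧
      GreenId T F (wgrad T v) (proj T ((k : ℤ) - 2) (wlap T v)) q := by
  obtain ⟨hv1, r, hr, q, hq, hG⟩ := hv
  have hr2 := Poly_memL2 h.star.isOpen h.star.bounded hr
  have hae := GreenId.wlap_ae_eq (q := q) hG h hv1 hr2
  have hm : MemL2 T (NCVEM.wlap T v) := (memLp_congr_ae hae).2 hr2
  have e : proj T ((k : ℤ) - 2) (NCVEM.wlap T v) = r := by
    rw [proj_congr h.star.isOpen h.star.bounded h.star.nonempty hm hae,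
      proj_of_mem h.star.isOpen h.star.bounded h.star.nonempty hr]
  exact ⟨q, hm, by rwa [e], hq, by rw [e]; exact hG⟩

/-! ### The interpolation error -/

/-- `u` and `uI` have traces with the same moments on the faces. -/
def SameFaceMoments (k : ℕ) (T : Set (E d)) (F : Finset (Set (E d))) (u uI : E d → ℝ) : Prop :=
  ∃ g gI, HasTrace T u g ∧ HasTrace T uI gI ∧ ∀ e ∈ F, ∀ q ∈ Poly d ((k : ℤ) - 1),
    ∫ x in e, gI x * q x ∂(surf d) = ∫ x in e, g x * q x ∂(surf d)

/-- The normal components are polynomials of degree `k - 1` on each face, so the boundary terms for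
`u` and `uI` coincide and cancel. -/
theorem GreenId.interpolant (hG : GreenId T F X r q) (h : IsPolyBoundary T x0 s F n a)
    (hX : MemLp X 2 (volume.restrict T)) (hr : MemL2 T r) (hq : ∀ e ∈ F, q e ∈ Poly d ((k : ℤ) - 1))
    (hu : MemH 1 T u) (huI : MemH 1 T uI) (hm : SameFaceMoments k T F u uI) :
    (∫ x in T, inner ℝ (X x) (wgrad T (fun x => u x - uI x) x)) + ∫ x in T, r x * (u x - uI x) = 0 := by
  obtain ⟨g, gI, hg, hgI, hmom⟩ := hm
  have hqc : ∀ e ∈ F, Continuous (q e) := fun e he => (Poly_contDiff (hq e he)).continuous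
  have h1 := hG.trace h hX hr hqc hu hg
  have h2 := hG.trace h hX hr hqc huI hgI
  have h3 : ∑ e ∈ F, ∫ x in e, q e x * gI x ∂(surf d) = ∑ e ∈ F, ∫ x in e, q e x * g x ∂(surf d) :=
    Finset.sum_congr rfl fun e he => by simpa only [mul_comm] using hmom e he (q e) (hq e he)
  have h4 : ∫ x in T, inner ℝ (X x) (wgrad T (fun x => u x - uI x) x) =
      (∫ x in T, inner ℝ (X x) (wgrad T u x)) - ∫ x in T, inner ℝ (X x) (wgrad T uI x) := by
    rw [← integral_sub (hX.integrable_inner hu.memLp_wgrad) (hX.integrable_inner huI.memLp_wgrad)]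
    refine integral_congr_ae ((hu.wgrad_sub h.star.isOpen h.star.bounded huI).mono fun x hx => ?_)
    simp only [hx, inner_sub_right]
  have h5 : ∫ x in T, r x * (u x - uI x) = (∫ x in T, r x * u x) - ∫ x in T, r x * uI x := by
    rw [← integral_sub (hr.mul_integrable hu.1) (hr.mul_integrable huI.1)]
    simp only [mul_sub]
  rw [h4, h5]; linarith

/-- The interpolation error is energy orthogonal to the virtual element space. -/
theorem MemVLoc.integral_inner_interpolant (hv : MemVLoc k T F v) (h : IsPolyBoundary T x0 s F n a)
    (hu : MemH 1 T u) (huI : MemH 1 T uI) (hm : SameFaceMoments k T F u uI)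
    (hmT : ∀ q ∈ Poly d ((k : ℤ) - 2), ∫ x in T, uI x * q x = ∫ x in T, u x * q x) :
    ∫ x in T, inner ℝ (wgrad T v x) (wgrad T (fun x => u x - uI x) x) = 0 := by
  obtain ⟨hv1, r, hr, q, hq, hG⟩ := hv
  have hr2 := Poly_memL2 h.star.isOpen h.star.bounded hr
  have h1 := GreenId.interpolant (q := q) hG h hv1.memLp_wgrad hr2 hq hu huI hm
  have h2 : ∫ x in T, r x * (u x - uI x) = 0 := by
    have := hmT r hr
    simp only [mul_sub]
    rw [integral_sub (hr2.mul_integrable hu.1) (hr2.mul_integrable huI.1)]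
    simp only [mul_comm] at this ⊢
    linarith
  linarith

/-- `uI - p` lies in the local space, to which `u - uI` is energy orthogonal. So the square of the
left side is the energy product of `uI - p` and `u - p`. -/
theorem semi1_interpolant_sub_le (h : IsPolyBoundary T x0 s F n a) (hu : MemH 1 T u)
    (huI : MemVLoc k T F uI) (hm : SameFaceMoments k T F u uI)
    (hmT : ∀ q ∈ Poly d ((k : ℤ) - 2), ∫ x in T, uI x * q x = ∫ x in T, u x * q x)
    {p : E d → ℝ} (hp : p ∈ Poly d k) :
    semi1 T (fun x => uI x - p x) ≤ semi1 T (fun x => u x - p x) := by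
  have hT := h.star.isOpen
  have hb := h.star.bounded
  have hp1 : MemH 1 T p := Poly_memH hT hb 1 hp
  have he := huI.sub h (h.memVLoc_of_poly hp)
  have h0 := he.integral_inner_interpolant h hu huI.1 hm hmT
  have hup := hu.sub hT hb hp1
  have h1 : semi1 T (fun x => uI x - p x) ^ 2 = ∫ x in T,
      inner ℝ (wgrad T (fun x => uI x - p x) x) (wgrad T (fun x => u x - p x) x) := by
    rw [← sub_zero (semi1 T _ ^ 2), ← neg_zero, ← h0, sub_neg_eq_add, semi1_eq_L2n, L2n_sq,
      ← integral_add (he.1.memLp_wgrad.integrable_norm_pow (by norm_num))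
        (he.1.memLp_wgrad.integrable_inner (hu.sub hT hb huI.1).memLp_wgrad)]
    refine integral_congr_ae ?_
    filter_upwards [hu.wgrad_sub hT hb huI.1, hu.wgrad_sub hT hb hp1,
      huI.1.wgrad_sub hT hb hp1] with x h1 h2 h3
    rw [← real_inner_self_eq_norm_sq, ← inner_add_right, h1, h2, h3]
    congr 1; abel
  have h2 := integral_norm_mul_le_L2n (C := 1) zero_le_one he.1.memLp_wgrad hup.memLp_wgrad
    (B := fun x => inner ℝ (wgrad T (fun x => uI x - p x) x) (wgrad T (fun x => u x - p x) x))
    (.of_forall fun x => by rw [one_mul]; exact abs_real_inner_le_norm _ _)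
  rw [← h1, one_mul, ← semi1_eq_L2n, ← semi1_eq_L2n] at h2
  have h3 := (le_abs_self _).trans h2
  by_contra hlt
  push Not at hlt
  nlinarith [semi1_nonneg (T := T) (v := fun x => u x - p x)]

theorem Poly_const {m : ℤ} (hm : 0 ≤ m) (c : ℝ) : (fun _ => c) ∈ Poly d m :=
  mem_Poly_iff.2 ⟨MvPolynomial.C c, Or.inr (by simpa using hm), by funext x; simp [polyFun]⟩

/-- Green's formula for the vector field `x - x0`. -/
theorem IsPolyBoundary.greenId_radial (h : IsPolyBoundary T x0 s F n a) :
    GreenId T F (fun x => x - x0) (fun _ => (d : ℝ)) (fun e _ => a e - inner ℝ (n e) x0) := by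
  intro w hw
  -- The field `x - x0` is the gradient of this function, whose Laplacian is `d`.
  have hf : ContDiff ℝ ∞ (fun x : E d => 1 / 2 * ‖x - x0‖ ^ 2) :=
    contDiff_const.mul ((contDiff_id.sub contDiff_const).norm_sq ℝ)
  have hpd : ∀ i, pd i (fun x : E d => 1 / 2 * ‖x - x0‖ ^ 2) = fun x => x i - x0 i := fun i => by
    funext x
    have h1 : HasFDerivAt (fun x : E d => 1 / 2 * ‖x - x0‖ ^ 2) _ x :=
      (((hasFDerivAt_id x).sub_const x0).norm_sq).const_mul (1 / 2 : ℝ)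
    unfold pd
    rw [HasFDerivAt.fderiv h1]
    simp [EuclideanSpace.inner_single_right]
  have hpd2 : ∀ i (x : E d), pd i (fun x => x i - x0 i) x = 1 := fun i x => by
    have h1 : HasFDerivAt (fun x : E d => x i - x0 i) (EuclideanSpace.proj (𝕜 := ℝ) i) x :=
      ((EuclideanSpace.proj (𝕜 := ℝ) (i : Fin d)).hasFDerivAt (x := x)).sub_const (x0 i)
    unfold pd
    rw [HasFDerivAt.fderiv h1]
    simp
  have hgrad : ∀ x : E d, gradient (fun x : E d => 1 / 2 * ‖x - x0‖ ^ 2) x = x - x0 := fun x => by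
    ext i; rw [gradient_apply, hpd]; rfl
  have h1 := h.green hf hw
  simp only [hgrad, hpd, hpd2, Finset.sum_const, Finset.card_univ, Fintype.card_fin,
    nsmul_eq_mul, mul_one] at h1
  rw [h1]
  refine Finset.sum_congr rfl fun e he => ?_
  refine setIntegral_congr_fun (h.compact e he).measurableSet fun x hx => ?_
  have : ∑ i, n e i * (x i - x0 i) = inner ℝ (n e) (x - x0) := by
    simp [PiLp.inner_apply, mul_comm]
  simp only [this, inner_sub_right, h.flat e he x hx]

/-- Poincaré leaves an unknown constant `m`. In Green's formula for `x - x0` the normal components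
are constant on each face, so matching face moments of order 0, available as `1 ≤ k`, express the
mean of `u - uI` through its gradient. Element moments would not do, since there are none for `k =
1`. -/
theorem norm0_sub_interpolant_le (hd : 0 < d) {ρ : ℝ} (hρ : 0 < ρ) (hk : 1 ≤ k)
    (h : IsPolyBoundary T x0 (ρ * Metric.diam T) F n a) (hu : MemH 1 T u)
    (huI : MemH 1 T uI) (hm : SameFaceMoments k T F u uI) :
    norm0 T (fun x => u x - uI x) ≤
      (2 * poincareConst d ρ + 1) * Metric.diam T * semi1 T (fun x => u x - uI x) := by
  have hT := h.star.isOpen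
  have hb := h.star.bounded
  have hw : MemH 1 T (fun x => u x - uI x) := hu.sub hT hb huI
  obtain ⟨m, hmP⟩ := h.star.poincare hd hρ hw
  set μ := volume.restrict T with hμ
  set D := Metric.diam T
  have h1m : MemLp (fun _ : E d => (1 : ℝ)) 2 μ := h.memLp_smooth continuous_const
  have hXm : MemLp (fun x : E d => x - x0) 2 μ := h.memLp_smooth (by fun_prop)
  have hcm : MemLp (fun _ : E d => m) 2 μ := h.memLp_smooth continuous_const
  set V := L2n μ (fun _ : E d => (1 : ℝ)) with hV
  have hV2 : V ^ 2 = volume.real T := by rw [hV, L2n_sq]; simp [hμ]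
  have hVpos : 0 < V := by
    refine (L2n_nonneg _).lt_of_ne fun h0 => ?_
    rw [← hV] at h0
    have h1 : volume.real T ≠ 0 := by
      rw [measureReal_def, Ne, ENNReal.toReal_eq_zero_iff, not_or]
      exact ⟨(hT.measure_pos _ h.star.nonempty).ne', (volume_lt_top hb).ne⟩
    exact h1 (by rw [← hV2, ← h0]; ring)
  set W := semi1 T (fun x => u x - uI x) with hW
  have hW0 : 0 ≤ W := semi1_nonneg
  have hg := h.greenId_radial.interpolant (k := k) h hXm (h.memLp_smooth continuous_const)
    (fun e _ => Poly_const (by omega) _) hu huI hm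
  rw [integral_const_mul] at hg
  have hX : L2n μ (fun x : E d => x - x0) ≤ D * V := by
    refine L2n_le_of_norm_le Metric.diam_nonneg h1m ?_
    refine (ae_restrict_mem hT.measurableSet).mono fun x hx => ?_
    rw [norm_one, mul_one, ← dist_eq_norm]
    exact Metric.dist_le_diam_of_mem hb hx (h.star.ball_subset (Metric.mem_ball_self h.star.pos))
  have hint : |∫ x in T, (u x - uI x)| ≤ D * V * W := by
    have h1 := integral_norm_mul_le_L2n (C := 1) zero_le_one hXm hw.memLp_wgrad
      (B := fun x => inner ℝ (x - x0) (wgrad T (fun x => u x - uI x) x))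
      (.of_forall fun x => by rw [one_mul]; exact abs_real_inner_le_norm _ _)
    rw [one_mul, ← semi1_eq_L2n] at h1
    have hd1 : (1 : ℝ) ≤ d := by exact_mod_cast hd
    calc |∫ x in T, (u x - uI x)| ≤ d * |∫ x in T, (u x - uI x)| :=
          le_mul_of_one_le_left (abs_nonneg _) hd1
      _ = |∫ x in T, inner ℝ (x - x0) (wgrad T (fun x => u x - uI x) x)| := by
          rw [eq_neg_of_add_eq_zero_left hg, abs_neg, abs_mul, Nat.abs_cast]
      _ ≤ _ := h1.trans (mul_le_mul_of_nonneg_right hX hW0)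
  set N := norm0 T (fun x => u x - uI x - m) with hN
  have hwm : MemLp (fun x => u x - uI x - m) 2 μ := hw.1.sub hcm
  -- From `m |T| = ∫ (u - uI) - ∫ (u - uI - m)` after division by `V = |T| ^ (1/2)`. The triangle
  -- inequality then gives `2 N + D W`, whence the factor `2 * poincareConst d ρ + 1`.
  have hmV : |m| * V ≤ D * W + N := by
    have h1 := integral_mul_le_L2n h1m hwm
    rw [← hV, ← norm0_eq_L2n, ← hN] at h1
    have hfin : IsFiniteMeasure μ := ⟨by simpa [hμ] using volume_lt_top hb⟩
    have h2 : m * V ^ 2 = (∫ x in T, (u x - uI x)) - ∫ x in T, 1 * (u x - uI x - m) := by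
      have h3 : ∫ x in T, 1 * (u x - uI x - m) = (∫ x in T, (u x - uI x)) - ∫ x in T, m := by
        rw [← integral_sub (hw.1.integrable hb) (integrable_const m)]; simp
      rw [h3, hV2]; simp [mul_comm]
    have h4 : |m| * V ^ 2 ≤ D * V * W + V * N := by
      rw [← abs_of_nonneg (sq_nonneg V), ← abs_mul, h2]
      exact (abs_sub _ _).trans (add_le_add hint h1)
    refine le_of_mul_le_mul_right ?_ hVpos
    linarith
  have hcN : L2n μ (fun _ : E d => m) ≤ |m| * V :=
    L2n_le_of_norm_le (abs_nonneg _) h1m (.of_forall fun x => by simp)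
  have htri : norm0 T (fun x => u x - uI x) ≤ N + |m| * V := by
    have := L2n_add_le hwm hcm
    simp only [sub_add_cancel] at this
    rw [norm0_eq_L2n, hN, norm0_eq_L2n]
    exact this.trans (add_le_add le_rfl hcN)
  linarith

theorem interpolant_sub_localApprox_le (hd : 0 < d) {ρ : ℝ} (hρ : 0 < ρ) (hk : 1 ≤ k)
    (h : IsPolyBoundary T x0 (ρ * Metric.diam T) F n a) (hu : MemH (k + 1) T u)
    (huI : MemVLoc k T F uI) (hm : SameFaceMoments k T F u uI)
    (hmT : ∀ q ∈ Poly d ((k : ℤ) - 2), ∫ x in T, uI x * q x = ∫ x in T, u x * q x)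
    {CP : ℝ} {p : E d → ℝ} (hp : IsLocalApprox k T CP u p) :
    semi1 T (fun x => uI x - p x) ≤ CP * Metric.diam T ^ k * semiH (k + 1) T u ∧
    norm0 T (fun x => uI x - p x) ≤
      (4 * poincareConst d ρ + 3) * CP * Metric.diam T ^ (k + 1) * semiH (k + 1) T u := by
  have hT := h.star.isOpen
  have hb := h.star.bounded
  have hu1 : MemH 1 T u := hu.mono (by omega)
  obtain ⟨hpP, hpa⟩ := hp
  have hp1 : MemH 1 T p := Poly_memH hT hb 1 hpP
  have hD : 0 < Metric.diam T := diam_pos hd hT hb h.star.nonempty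
  have a1 := semi1_interpolant_sub_le h hu1 huI hm hmT hpP
  have n1 := norm0_nonneg (T := T) (v := fun x => u x - p x)
  have n2 := semi1_nonneg (T := T) (v := fun x => u x - p x)
  set M := semiH (k + 1) T u
  have a2 : semi1 T (fun x => u x - p x) ≤ CP * Metric.diam T ^ k * M := by
    refine le_of_mul_le_mul_left ?_ hD
    calc _ ≤ CP * Metric.diam T ^ (k + 1) * M := by linarith
      _ = _ := by ring
  have a3 : norm0 T (fun x => u x - p x) ≤ CP * Metric.diam T ^ (k + 1) * M := by
    have := mul_nonneg hD.le n2
    linarith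
  have a4 := norm0_sub_interpolant_le hd hρ hk h hu1 huI.1 hm
  have hup := hu1.sub hT hb hp1
  have heI := huI.1.sub hT hb hp1
  have a5 : semi1 T (fun x => u x - uI x) ≤
      semi1 T (fun x => u x - p x) + semi1 T (fun x => uI x - p x) := by
    simp only [semi1_eq_L2n]
    refine le_trans (le_of_eq (L2n_congr ?_)) (L2n_sub_le hup.memLp_wgrad heI.memLp_wgrad)
    filter_upwards [hu1.wgrad_sub hT hb huI.1, hu1.wgrad_sub hT hb hp1,
      huI.1.wgrad_sub hT hb hp1] with x h1 h2 h3
    rw [h1, h2, h3]; abel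
  have a6 : norm0 T (fun x => uI x - p x) ≤
      norm0 T (fun x => u x - p x) + norm0 T (fun x => u x - uI x) := by
    simp only [norm0_eq_L2n]
    have := L2n_sub_le hup.1 (hu1.sub hT hb huI.1).1
    simpa using this
  refine ⟨a1.trans a2, ?_⟩
  have hc : 0 ≤ (2 * poincareConst d ρ + 1) * Metric.diam T := by
    have := poincareConst_pos d hρ
    positivity
  -- The factor 2 is the triangle inequality for the seminorm of `u - uI`; hence the constant `1 + 2
  -- * (2 * poincareConst d ρ + 1)`.
  calc _ ≤ CP * Metric.diam T ^ (k + 1) * M + (2 * poincareConst d ρ + 1) * Metric.diam T *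
        (2 * (CP * Metric.diam T ^ k * M)) := by
        refine a6.trans (add_le_add a3 (a4.trans (mul_le_mul_of_nonneg_left ?_ hc)))
        linarith
    _ = _ := by ring

end local_space

/-! ### Bilinear forms on the local virtual element space -/

/-- `B` is a symmetric bilinear form on the local virtual element space. -/
structure IsBilinOn (k : ℕ) (T : Set (E d)) (F : Finset (Set (E d)))
    (B : (E d → ℝ) → (E d → ℝ) → ℝ) : Prop where
  add_left : ∀ u v w, MemVLoc k T F u → MemVLoc k T F v → MemVLoc k T F w →
    B (fun x => u x + v x) w = B u w + B v w
  mul_left : ∀ (c : ℝ) (u w), MemVLoc k T F u → MemVLoc k T F w →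
    B (fun x => c * u x) w = c * B u w
  symm : ∀ u w, B u w = B w u

section forms
variable {T : Set (E d)} {x0 : E d} {s : ℝ} {F : Finset (Set (E d))} {n : Set (E d) → E d}
  {a : Set (E d) → ℝ} {k : ℕ} {v w u : E d → ℝ} {B : (E d → ℝ) → (E d → ℝ) → ℝ}

/-- The discriminant argument, run inside the local space, where alone semidefiniteness is known.
`N` need only dominate the quadratic form. -/
theorem IsBilinOn.cauchy_schwarz (hB : IsBilinOn k T F B) (h : IsPolyBoundary T x0 s F n a)
    (h0 : ∀ v, MemVLoc k T F v → 0 ≤ B v v) {N : (E d → ℝ) → ℝ} (hN : ∀ v, 0 ≤ N v)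
    (hBN : ∀ v, MemVLoc k T F v → B v v ≤ N v ^ 2)
    (hu : MemVLoc k T F u) (hv : MemVLoc k T F v) : |B u v| ≤ N u * N v := by
  have hq : ∀ t : ℝ, 0 ≤ B v v * (t * t) + 2 * B u v * t + B u u := fun t => by
    have htv := hv.const_mul h t
    have h1 := h0 _ (hu.add h htv)
    rw [hB.add_left _ _ _ hu htv (hu.add h htv), hB.mul_left _ _ _ hv (hu.add h htv),
      hB.symm u, hB.symm v, hB.add_left _ _ _ hu htv hu, hB.add_left _ _ _ hu htv hv,
      hB.mul_left _ _ _ hv hu, hB.mul_left _ _ _ hv hv, hB.symm v u] at h1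
    linarith
  have hd := discrim_le_zero hq
  rw [discrim] at hd
  refine abs_le_of_sq_le_sq ?_ (mul_nonneg (hN u) (hN v))
  have h1 := mul_le_mul (hBN u hu) (hBN v hv) (h0 v hv) (sq_nonneg _)
  nlinarith

/-- `B` may be indefinite. Adding `K` times the L² product makes it semidefinite with quadratic form
at most `2 * K * norm0 T v ^ 2`; removing the shift costs one more `K`. -/
theorem IsBilinOn.norm0_bound (hB : IsBilinOn k T F B) (h : IsPolyBoundary T x0 s F n a) {K : ℝ}
    (hK : 0 ≤ K) (hBK : ∀ v, MemVLoc k T F v → |B v v| ≤ K * norm0 T v ^ 2)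
    (hu : MemVLoc k T F u) (hv : MemVLoc k T F v) :
    |B u v| ≤ 3 * K * (norm0 T u * norm0 T v) := by
  have hI : ∀ v : E d → ℝ, ∫ x in T, v x * v x = norm0 T v ^ 2 := fun v => by
    rw [norm0_eq_L2n, L2n_sq]; simp [pow_two]
  have hB' : IsBilinOn k T F fun u v => B u v + K * ∫ x in T, u x * v x :=
    { add_left := fun u v w hu hv hw => by
        rw [hB.add_left u v w hu hv hw]
        simp only [add_mul]
        rw [integral_add (hu.1.1.mul_integrable hw.1.1) (hv.1.1.mul_integrable hw.1.1)]
        ring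
      mul_left := fun c u w hu hw => by
        rw [hB.mul_left c u w hu hw]
        simp only [mul_assoc, integral_const_mul]
        ring
      symm := fun u w => by rw [hB.symm]; simp only [mul_comm] }
  have h1 := hB'.cauchy_schwarz h (N := fun v => √(2 * K) * norm0 T v)
    (fun v hv => by
      rw [hI]; have := (abs_le.1 (hBK v hv)).1; linarith)
    (fun v => mul_nonneg (Real.sqrt_nonneg _) norm0_nonneg)
    (fun v hv => by
      rw [hI, mul_pow, Real.sq_sqrt (by positivity)]
      have := (abs_le.1 (hBK v hv)).2
      linarith) hu hv
  have h2 := integral_mul_le_L2n hu.1.1 hv.1.1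
  rw [← norm0_eq_L2n, ← norm0_eq_L2n] at h2
  have h3 : √(2 * K) * norm0 T u * (√(2 * K) * norm0 T v) = 2 * K * (norm0 T u * norm0 T v) := by
    rw [mul_mul_mul_comm, Real.mul_self_sqrt (by positivity)]
  rw [h3] at h1
  have h4 : |K * ∫ x in T, u x * v x| ≤ K * (norm0 T u * norm0 T v) := by
    rw [abs_mul, abs_of_nonneg hK]; exact mul_le_mul_of_nonneg_left h2 hK
  have h5 := abs_sub (B u v + K * ∫ x in T, u x * v x) (K * ∫ x in T, u x * v x)
  rw [add_sub_cancel_right] at h5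
  linarith

theorem compl_add (hT : IsOpen T) (hb : Bornology.IsBounded T) (hne : T.Nonempty)
    (hv : MemL2 T v) (hw : MemL2 T w) :
    compl k T (fun x => v x + w x) = compl k T v + compl k T w := by
  funext x
  simp only [compl, proj_add hT hb hne hv hw, Pi.add_apply]
  ring

theorem compl_const_mul (hT : IsOpen T) (hb : Bornology.IsBounded T) (hne : T.Nonempty) (c : ℝ)
    (hv : MemL2 T v) : compl k T (fun x => c * v x) = c • compl k T v := by
  funext x
  simp only [compl, proj_const_mul hT hb hne c hv, Pi.smul_apply, smul_eq_mul]
  ring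

/-- The common shape of the four discrete forms: a weighted product of projected quantities `Φ` plus
a stabilization acting on the complements. -/
theorem isBilinOn_form {H : Type*} [NormedAddCommGroup H] [InnerProductSpace ℝ H]
    (h : IsPolyBoundary T x0 s F n a) {κ : E d → ℝ} {C : ℝ} (hκ : ContinuousOn κ T)
    (hC : ∀ x ∈ T, |κ x| ≤ C) {Φ : (E d → ℝ) → E d → H}
    (hΦ : ∀ u, MemVLoc k T F u → MemLp (Φ u) 2 (volume.restrict T))
    (hadd : ∀ u v, MemVLoc k T F u → MemVLoc k T F v →
      ∀ x, Φ (fun x => u x + v x) x = Φ u x + Φ v x)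
    (hmul : ∀ c u, MemVLoc k T F u → ∀ x, Φ (fun x => c * u x) x = c • Φ u x)
    {σ : (E d → ℝ) →ₗ[ℝ] (E d → ℝ) →ₗ[ℝ] ℝ} (hσ : ∀ v w, σ v w = σ w v) :
    IsBilinOn k T F fun u v =>
      (∫ x in T, κ x * inner ℝ (Φ u x) (Φ v x)) + σ (compl k T u) (compl k T v) := by
  have hT := h.star.isOpen
  have hb := h.star.bounded
  have hne := h.star.nonempty
  have hi : ∀ u v, MemVLoc k T F u → MemVLoc k T F v →
      Integrable (fun x => κ x * (inner ℝ (Φ u x) (Φ v x) : ℝ)) (volume.restrict T) :=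
    fun u v hu hv => ((hΦ u hu).integrable_inner (hΦ v hv)).bdd_mul (c := C)
      (hκ.aestronglyMeasurable hT.measurableSet)
      ((ae_restrict_mem hT.measurableSet).mono fun x hx => hC x hx)
  refine ⟨fun u v w hu hv hw => ?_, fun c u w hu hw => ?_, fun u w => ?_⟩
  · simp only [hadd u v hu hv, inner_add_left, mul_add]
    rw [integral_add (hi u w hu hw) (hi v w hv hw), compl_add hT hb hne hu.1.1 hv.1.1, map_add,
      LinearMap.add_apply]
    ring
  · simp only [hmul c u hu, real_inner_smul_left, mul_left_comm _ c, integral_const_mul]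
    rw [compl_const_mul hT hb hne c hu.1.1, map_smul, LinearMap.smul_apply, smul_eq_mul]
    ring
  · rw [hσ]
    simp only [real_inner_comm]

variable {ε : ℝ} {b : E d → E d} {c : E d → ℝ} {δT Cb Cc Cd : ℝ} {S : StabForms d}

theorem isBilinOn_formAh (h : IsPolyBoundary T x0 s F n a) :
    IsBilinOn k T F (formAh k ε T S) := by
  have hT := h.star.isOpen
  have hb := h.star.bounded
  have hne := h.star.nonempty
  exact isBilinOn_form h (κ := fun _ => ε) (C := |ε|) continuousOn_const (fun _ _ => le_rfl)
    (fun u hu => memLp_projGrad hT hb hne hu.1)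
    (fun u v hu hv x => congrFun (projGrad_add hT hb hne hu.1 hv.1) x)
    (fun c u hu x => congrFun (projGrad_const_mul hT hb hne c hu.1) x) S.sa_symm

theorem isBilinOn_formCh (h : IsPolyBoundary T x0 s F n a) (hc : ContinuousOn c T)
    (hcC : ∀ x ∈ T, |c x| ≤ Cc) : IsBilinOn k T F (formCh k c T S) := by
  have hT := h.star.isOpen
  have hb := h.star.bounded
  have hne := h.star.nonempty
  have := isBilinOn_form (k := k) h hc hcC (Φ := fun u => proj T k u)
    (fun u hu => memL2_proj hT hb hne hu.1.1)
    (fun u v hu hv x => congrFun (proj_add hT hb hne hu.1.1 hv.1.1) x)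
    (fun c u hu x => congrFun (proj_const_mul hT hb hne c hu.1.1) x) S.sc_symm
  refine (congrArg (IsBilinOn k T F) ?_).mp this
  funext u v
  simp only [formCh, RCLike.inner_apply, conj_trivial]
  congr 2; funext x; ring

theorem isBilinOn_formBsymh (h : IsPolyBoundary T x0 s F n a) (hc : ContinuousOn (divergence b) T)
    (hcC : ∀ x ∈ T, |divergence b x| ≤ Cd) : IsBilinOn k T F (formBsymh k b T S) := by
  have hT := h.star.isOpen
  have hb := h.star.bounded
  have hne := h.star.nonempty
  have := isBilinOn_form (k := k) h (κ := fun x => 1 / 2 * divergence b x) (C := 1 / 2 * Cd)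
    (continuousOn_const.mul hc)
    (fun x hx => by rw [abs_mul, abs_of_pos (by norm_num)]; linarith [hcC x hx])
    (Φ := fun u => proj T k u)
    (fun u hu => memL2_proj hT hb hne hu.1.1)
    (fun u v hu hv x => congrFun (proj_add hT hb hne hu.1.1 hv.1.1) x)
    (fun c u hu x => congrFun (proj_const_mul hT hb hne c hu.1.1) x) S.ssym_symm
  refine (congrArg (IsBilinOn k T F) ?_).mp this
  funext u v
  simp only [formBsymh, RCLike.inner_apply, conj_trivial]
  rw [← integral_const_mul]
  congr 2; funext x; ring

theorem memLp_inner_of_continuousOn (hT : IsOpen T) (hb : ContinuousOn b T)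
    (hbC : ∀ x ∈ T, ‖b x‖ ≤ Cb) {X : E d → E d} (hX : MemLp X 2 (volume.restrict T)) :
    MemL2 T (fun x => inner ℝ (b x) (X x)) := by
  refine MemLp.of_le_mul (c := Cb) hX ((hb.aestronglyMeasurable hT.measurableSet).inner hX.1) ?_
  refine (ae_restrict_mem hT.measurableSet).mono fun x hx => ?_
  exact (norm_inner_le_norm _ _).trans (mul_le_mul_of_nonneg_right (hbC x hx) (norm_nonneg _))

theorem isBilinOn_formGh (h : IsPolyBoundary T x0 s F n a) (hbc : ContinuousOn b T)
    (hbC : ∀ x ∈ T, ‖b x‖ ≤ Cb) : IsBilinOn k T F (formGh k b δT T S) := by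
  have hT := h.star.isOpen
  have hb := h.star.bounded
  have hne := h.star.nonempty
  have := isBilinOn_form (k := k) h (κ := fun x => δT) (C := |δT|) continuousOn_const (fun _ _ => le_rfl)
    (Φ := fun u x => (inner ℝ (b x) (projGrad T ((k : ℤ) - 1) u x) : ℝ))
    (fun u hu => memLp_inner_of_continuousOn hT hbc hbC (memLp_projGrad hT hb hne hu.1))
    (fun u v hu hv x => by rw [projGrad_add hT hb hne hu.1 hv.1, inner_add_right])
    (fun c u hu x => by
      rw [projGrad_const_mul hT hb hne c hu.1, real_inner_smul_right, smul_eq_mul]) S.sb_symm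
  refine (congrArg (IsBilinOn k T F) ?_).mp this
  funext u v
  simp only [formGh, RCLike.inner_apply, conj_trivial]
  congr 2; funext x; ring

/-! ### Bounds on the discrete forms -/

variable {K : StabConst}

/-- The lower stability bound gives semidefiniteness and the upper one the quadratic bound, so
nothing about the stabilization itself has to be known. -/
theorem formAh_le (h : IsPolyBoundary T x0 s F n a) (hε : 0 < ε)
    (hS : IsStable K k ε b c δT T F S) (hu : MemVLoc k T F u) (hv : MemVLoc k T F v) :
    |formAh k ε T S u v| ≤ K.αup * (ε * (semi1 T u * semi1 T v)) := by
  have hA : ∀ v, formA ε T v v = ε * semi1 T v ^ 2 := fun v => by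
    rw [formA, integral_const_mul, semi1_eq_L2n, L2n_sq]
    simp only [real_inner_self_eq_norm_sq]
  have hK := K.αup_pos
  have hK' := K.αlo_pos
  refine ((isBilinOn_formAh h).cauchy_schwarz h (fun v hv => ?_)
    (N := fun v => √(K.αup * ε) * semi1 T v) (fun v => mul_nonneg (Real.sqrt_nonneg _) semi1_nonneg)
    (fun v hv => ?_) hu hv).trans_eq ?_
  · refine le_trans ?_ (hS v hv).1.1
    rw [hA]; positivity
  · refine (hS v hv).1.2.trans_eq ?_
    rw [hA, mul_pow, Real.sq_sqrt (by positivity)]; ring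
  · rw [mul_mul_mul_comm, Real.mul_self_sqrt (by positivity)]; ring

theorem formGh_le (h : IsPolyBoundary T x0 s F n a) (hbc : ContinuousOn b T)
    (hbC : ∀ x ∈ T, ‖b x‖ ≤ Cb) (hδ : 0 < δT)
    (hS : IsStable K k ε b c δT T F S) (hu : MemVLoc k T F u) (hv : MemVLoc k T F v) :
    |formGh k b δT T S u v| ≤ K.Γup * (δT * (norm0 T (fun x => inner ℝ (b x) (wgrad T u x)) *
      norm0 T (fun x => inner ℝ (b x) (wgrad T v x)))) := by
  have hA : ∀ v, formG b δT T v v = δT * norm0 T (fun x => inner ℝ (b x) (wgrad T v x)) ^ 2 :=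
    fun v => by
    rw [norm0, Real.sq_sqrt (integral_nonneg fun _ => sq_nonneg _), ← integral_const_mul, formG]
    congr 1; funext x; ring
  have hK := K.Γup_pos
  have hK' := K.Γlo_pos
  refine ((isBilinOn_formGh h hbc hbC).cauchy_schwarz h (fun v hv => ?_)
    (N := fun v => √(K.Γup * δT) * norm0 T (fun x => inner ℝ (b x) (wgrad T v x)))
    (fun v => mul_nonneg (Real.sqrt_nonneg _) norm0_nonneg)
    (fun v hv => ?_) hu hv).trans_eq ?_
  · refine le_trans ?_ (hS v hv).2.2.1.1
    rw [hA]; positivity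
  · refine (hS v hv).2.2.1.2.trans_eq ?_
    rw [hA, mul_pow, Real.sq_sqrt (by positivity)]; ring
  · rw [mul_mul_mul_comm, Real.mul_self_sqrt (by positivity)]; ring

theorem abs_integral_weight_le (hT : IsOpen T) {κ : E d → ℝ} {C : ℝ} (hC0 : 0 ≤ C)
    (hC : ∀ x ∈ T, |κ x| ≤ C) (hv : MemL2 T v) :
    |∫ x in T, κ x * v x * v x| ≤ C * norm0 T v ^ 2 := by
  have := integral_norm_mul_le_L2n hC0 hv hv (B := fun x => κ x * v x * v x)
    ((ae_restrict_mem hT.measurableSet).mono fun x hx => by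
      rw [mul_assoc, abs_mul, abs_mul]
      exact mul_le_mul_of_nonneg_right (hC x hx) (by positivity))
  rwa [← norm0_eq_L2n, ← pow_two] at this

/-- The sign of `x` is unknown, so the lower factor bounds `y` from below and the upper one from
above; the sum covers both. -/
theorem abs_le_of_mul_bounds {x y lo up C : ℝ} (hlo : 0 < lo) (hup : 0 < up) (hx : |x| ≤ C)
    (h1 : lo * x ≤ y) (h2 : y ≤ up * x) : |y| ≤ (lo + up) * C := by
  obtain ⟨h3, h4⟩ := abs_le.1 hx
  have hC := (abs_nonneg x).trans hx
  refine abs_le.2 ⟨?_, ?_⟩ <;> nlinarith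

theorem formCh_le (h : IsPolyBoundary T x0 s F n a) (hc : ContinuousOn c T) (hC0 : 0 ≤ Cc)
    (hcC : ∀ x ∈ T, |c x| ≤ Cc)
    (hS : IsStable K k ε b c δT T F S) (hu : MemVLoc k T F u) (hv : MemVLoc k T F v) :
    |formCh k c T S u v| ≤ 3 * ((K.γlo + K.γup) * Cc) * (norm0 T u * norm0 T v) := by
  have h1 := K.γlo_pos
  have h2 := K.γup_pos
  refine (isBilinOn_formCh h hc hcC).norm0_bound h (by positivity) (fun v hv => ?_) hu hv
  rw [mul_assoc]
  exact abs_le_of_mul_bounds h1 h2 (abs_integral_weight_le h.star.isOpen hC0 hcC hv.1.1)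
    (hS v hv).2.1.1 (hS v hv).2.1.2

theorem formBsymh_le (h : IsPolyBoundary T x0 s F n a) (hc : ContinuousOn (divergence b) T)
    (hC0 : 0 ≤ Cd) (hcC : ∀ x ∈ T, |divergence b x| ≤ Cd)
    (hS : IsStable K k ε b c δT T F S) (hu : MemVLoc k T F u) (hv : MemVLoc k T F v) :
    |formBsymh k b T S u v| ≤ 3 * ((K.slo + K.sup) * Cd) * (norm0 T u * norm0 T v) := by
  have h1 := K.slo_pos
  have h2 := K.sup_pos
  refine (isBilinOn_formBsymh h hc hcC).norm0_bound h (by positivity) (fun v hv => ?_) hu hv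
  rw [mul_assoc]
  refine abs_le_of_mul_bounds h1 h2 ?_ (hS v hv).2.2.2.1 (hS v hv).2.2.2.2
  have h3 := abs_integral_weight_le h.star.isOpen hC0 hcC hv.1.1
  rw [formBsym, abs_mul, abs_of_pos (by norm_num : (0 : ℝ) < 1 / 2)]
  linarith [abs_nonneg (∫ x in T, divergence b x * v x * v x)]

theorem abs_integral_inner_projGrad_mul_le (h : IsPolyBoundary T x0 s F n a) (hC0 : 0 ≤ Cb)
    (hbC : ∀ x ∈ T, ‖b x‖ ≤ Cb) (hu : MemH 1 T u) {m : ℤ} (hw : MemL2 T w) :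
    |∫ x in T, inner ℝ (b x) (projGrad T m u x) * w x| ≤ Cb * (semi1 T u * norm0 T w) := by
  have hT := h.star.isOpen
  have hb := h.star.bounded
  have hne := h.star.nonempty
  refine (integral_norm_mul_le_L2n hC0 (memLp_projGrad hT hb hne hu (m := m)) hw
    ((ae_restrict_mem hT.measurableSet).mono fun x hx => ?_)).trans ?_
  · rw [abs_mul, Real.norm_eq_abs, ← mul_assoc]
    refine mul_le_mul_of_nonneg_right ((abs_real_inner_le_norm _ _).trans
      (mul_le_mul_of_nonneg_right (hbC x hx) (norm_nonneg _))) (abs_nonneg _)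
  · rw [← norm0_eq_L2n]
    exact mul_le_mul_of_nonneg_left (mul_le_mul_of_nonneg_right (L2n_projGrad_le hT hb hne hu)
      norm0_nonneg) hC0

theorem formBskewh_le (h : IsPolyBoundary T x0 s F n a) (hC0 : 0 ≤ Cb)
    (hbC : ∀ x ∈ T, ‖b x‖ ≤ Cb) (hu : MemH 1 T u) (hv : MemH 1 T v) :
    |formBskewh k b T u v| ≤ Cb * (semi1 T u * norm0 T v) + Cb * (semi1 T v * norm0 T u) := by
  have hT := h.star.isOpen
  have hb := h.star.bounded
  have hne := h.star.nonempty
  have key : ∀ u v, MemH 1 T u → MemH 1 T v →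
      |∫ x in T, inner ℝ (b x) (projGrad T ((k : ℤ) - 1) u x) * proj T k v x| ≤
        Cb * (semi1 T u * norm0 T v) := fun u v hu hv =>
    (abs_integral_inner_projGrad_mul_le h hC0 hbC hu (memL2_proj hT hb hne hv.1)).trans
      (mul_le_mul_of_nonneg_left (mul_le_mul_of_nonneg_left (norm0_proj_le hT hb hne hv.1)
        semi1_nonneg) hC0)
  rw [formBskewh, abs_mul, abs_of_pos (by norm_num : (0 : ℝ) < 1 / 2)]
  have h1 := key u v hu hv
  have h2 := key v u hv hu
  have h3 := abs_sub (∫ x in T, inner ℝ (b x) (projGrad T ((k : ℤ) - 1) u x) * proj T k v x)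
    (∫ x in T, inner ℝ (b x) (projGrad T ((k : ℤ) - 1) v x) * proj T k u x)
  linarith [abs_nonneg (∫ x in T, inner ℝ (b x) (projGrad T ((k : ℤ) - 1) u x) * proj T k v x),
    abs_nonneg (∫ x in T, inner ℝ (b x) (projGrad T ((k : ℤ) - 1) v x) * proj T k u x)]

theorem formBstabh_sub_formGh_le (h : IsPolyBoundary T x0 s F n a) (hε : 0 < ε) (hδ : 0 < δT)
    (hC0 : 0 ≤ Cb) (hbC : ∀ x ∈ T, ‖b x‖ ≤ Cb) (hc : ContinuousOn c T) (hC0c : 0 ≤ Cc)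
    (hcC : ∀ x ∈ T, |c x| ≤ Cc) (hu : MemVLoc k T F u) (hv : MemH 1 T v) :
    |formBstabh k ε b c δT T S u v - formGh k b δT T S u v| ≤
      ε * δT * Cb * (norm0 T (proj T ((k : ℤ) - 2) (wlap T u)) * semi1 T v) +
        δT * Cc * Cb * (norm0 T u * semi1 T v) := by
  have hT := h.star.isOpen
  have hb := h.star.bounded
  have hne := h.star.nonempty
  obtain ⟨-, -, hr, -⟩ := hu.wlap h
  set r := proj T ((k : ℤ) - 2) (wlap T u) with hrdef
  have hr2 : MemL2 T r := Poly_memL2 hT hb hr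
  have hp2 : MemL2 T (proj T k u) := memL2_proj hT hb hne hu.1.1
  have hcp : MemL2 T (fun x => c x * proj T k u x) :=
    MemLp.of_le_mul (c := Cc) hp2 ((hc.aestronglyMeasurable hT.measurableSet).mul hp2.1)
      ((ae_restrict_mem hT.measurableSet).mono fun x hx => by
        rw [norm_mul]; exact mul_le_mul_of_nonneg_right (hcC x hx) (norm_nonneg _))
  have hw : MemL2 T (fun x => -ε * r x + c x * proj T k u x) := (MemLp.const_mul hr2 (-ε)).add hcp
  have h1 := abs_integral_inner_projGrad_mul_le h hC0 hbC hv (m := (k : ℤ) - 1) hw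
  have h2 : norm0 T (fun x => -ε * r x + c x * proj T k u x) ≤ ε * norm0 T r + Cc * norm0 T u := by
    simp only [norm0_eq_L2n]
    refine (L2n_add_le (MemLp.const_mul hr2 (-ε)) hcp).trans (add_le_add ?_ ?_)
    · exact L2n_le_of_norm_le hε.le hr2 (.of_forall fun x => by
        rw [norm_mul, norm_neg, Real.norm_of_nonneg hε.le])
    · refine (L2n_le_of_norm_le hC0c hp2 ((ae_restrict_mem hT.measurableSet).mono fun x hx => by
        rw [norm_mul]; exact mul_le_mul_of_nonneg_right (hcC x hx) (norm_nonneg _))).trans ?_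
      rw [← norm0_eq_L2n, ← norm0_eq_L2n]
      exact mul_le_mul_of_nonneg_left (norm0_proj_le hT hb hne hu.1.1) hC0c
  have e : formBstabh k ε b c δT T S u v - formGh k b δT T S u v =
      δT * ∫ x in T, inner ℝ (b x) (projGrad T ((k : ℤ) - 1) v x) *
        (-ε * r x + c x * proj T k u x) := by
    rw [formBstabh, add_sub_cancel_right, ← integral_const_mul]
    congr 1; funext x; ring
  rw [e, abs_mul, abs_of_pos hδ]
  calc _ ≤ δT * (Cb * (semi1 T v * (ε * norm0 T r + Cc * norm0 T u))) := by
        refine mul_le_mul_of_nonneg_left (h1.trans ?_) hδ.le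
        exact mul_le_mul_of_nonneg_left (mul_le_mul_of_nonneg_left h2 semi1_nonneg) hC0
    _ = _ := by ring

end forms

/-! ### The local estimate -/

/-- The constant in the local estimate; `A1`, `A0` are the constants of the error bounds in `H¹` and
`L²`, `CI` is the constant of the inverse inequality, and `Cb`, `Cc`, `Cd` bound the data. -/
def localConst (K : StabConst) (c0 μ1 A1 A0 CI Cb Cc Cd : ℝ) : ℝ :=
  K.αup * A1 + 3 * ((K.slo + K.sup) * Cd) * A0 / √c0
    + (Cb * A1 / √c0 + Cb * A0)
    + 3 * ((K.γlo + K.γup) * Cc) * A0 / √c0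
    + (K.αlo / (2 * μ1 ^ 2) * CI * Cb * A1 + Cc * Cb * A0) + K.Γup * Cb * A1

section final
variable {T : Set (E d)} {x0 : E d} {s : ℝ} {F : Finset (Set (E d))} {n : Set (E d) → E d}
  {a : Set (E d) → ℝ} {k : ℕ} {u v : E d → ℝ}
  {ε : ℝ} {b : E d → E d} {c : E d → ℝ} {δT Cb Cc Cd : ℝ} {S : StabForms d} {K : StabConst}

theorem norm0_inner_wgrad_le (hT : IsOpen T) (hC0 : 0 ≤ Cb) (hbC : ∀ x ∈ T, ‖b x‖ ≤ Cb)
    (hu : MemH 1 T u) : norm0 T (fun x => inner ℝ (b x) (wgrad T u x)) ≤ Cb * semi1 T u := by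
  rw [norm0_eq_L2n, semi1_eq_L2n]
  exact L2n_le_of_norm_le hC0 hu.memLp_wgrad ((ae_restrict_mem hT.measurableSet).mono fun x hx =>
    (norm_inner_le_norm _ _).trans (mul_le_mul_of_nonneg_right (hbC x hx) (norm_nonneg _)))

/-- The contribution of one element to the square of the mesh-dependent norm. -/
def localNormSq (ε : ℝ) (b : E d → E d) (c0 δT : ℝ) (T : Set (E d)) (v : E d → ℝ) : ℝ :=
  ε * semi1 T v ^ 2 + c0 * norm0 T v ^ 2 + δT * norm0 T (fun x => inner ℝ (b x) (wgrad T v x)) ^ 2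

/-- Each piece is at most a constant times `Q = H ^ k * (Z * M) * R`. A factor `D1` costs `1 / √ε`
and a factor `D0` costs `1 / √c0` when traded for `R`, and the weight `zeta` absorbs the powers of
`ε`, `δT` and `H` that remain. -/
theorem formDisc_le (h : IsPolyBoundary T x0 s F n a) (hD : 0 < Metric.diam T)
    {c0 μ1 A1 A0 CI M : ℝ}
    (hbc : ContinuousOn b T) (hCb : 0 ≤ Cb) (hb : ∀ x ∈ T, ‖b x‖ ≤ Cb)
    (hdc : ContinuousOn (divergence b) T) (hCd : 0 ≤ Cd) (hd : ∀ x ∈ T, |divergence b x| ≤ Cd)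
    (hcc : ContinuousOn c T) (hCc : 0 ≤ Cc) (hc : ∀ x ∈ T, |c x| ≤ Cc)
    (hε : 0 < ε) (hδ : 0 < δT) (hc0 : 0 < c0) (hμ1 : 0 < μ1)
    (hctrl : δT * (2 * ε * μ1 ^ 2) ≤ Metric.diam T ^ 2 * K.αlo)
    (hS : IsStable K k ε b c δT T F S) (hu : MemVLoc k T F u) (hv : MemVLoc k T F v)
    (hA1 : 0 ≤ A1) (hA0 : 0 ≤ A0) (hCI : 0 ≤ CI) (hM : 0 ≤ M)
    (h1 : semi1 T u ≤ A1 * Metric.diam T ^ k * M)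
    (h0 : norm0 T u ≤ A0 * Metric.diam T ^ (k + 1) * M)
    (hI : norm0 T (proj T ((k : ℤ) - 2) (wlap T u)) * Metric.diam T ≤ CI * semi1 T u) :
    |formDisc k ε b c δT T S u v| ≤ localConst K c0 μ1 A1 A0 CI Cb Cc Cd *
      (Metric.diam T ^ k * (√(zeta ε δT T) * M) * √(localNormSq ε b c0 δT T v)) := by
  have hB1 := norm0_inner_wgrad_le h.star.isOpen hCb hb hu.1
  have t1 := formAh_le h hε hS hu hv
  have t2 := formBsymh_le h hdc hCd hd hS hu hv
  have t3 := formCh_le h hcc hCc hc hS hu hv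
  have t4 := formBskewh_le (k := k) h hCb hb hu.1 hv.1
  have t5 := formGh_le h hbc hb hδ hS hu hv
  have t6 := formBstabh_sub_formGh_le (S := S) h hε hδ hCb hb hcc hCc hc hu hv.1
  have hsum : |formDisc k ε b c δT T S u v| ≤ |formAh k ε T S u v| + |formBsymh k b T S u v| +
      |formBskewh k b T u v| + |formCh k c T S u v| +
      |formBstabh k ε b c δT T S u v - formGh k b δT T S u v| + |formGh k b δT T S u v| := by
    rw [formDisc, abs_le]
    constructor <;>
    linarith [le_abs_self (formAh k ε T S u v), le_abs_self (formBsymh k b T S u v),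
      le_abs_self (formBskewh k b T u v), le_abs_self (formCh k c T S u v),
      le_abs_self (formBstabh k ε b c δT T S u v - formGh k b δT T S u v),
      le_abs_self (formGh k b δT T S u v), neg_abs_le (formAh k ε T S u v),
      neg_abs_le (formBsymh k b T S u v),
      neg_abs_le (formBskewh k b T u v), neg_abs_le (formCh k c T S u v),
      neg_abs_le (formBstabh k ε b c δT T S u v - formGh k b δT T S u v),
      neg_abs_le (formGh k b δT T S u v)]
  have k1 := K.αup_pos
  have k2 := K.slo_pos
  have k3 := K.sup_pos
  have k4 := K.γlo_pos
  have k5 := K.γup_pos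
  have k6 := K.αlo_pos
  have k7 := K.Γup_pos
  set Z := √(zeta ε δT T) with hZ
  set R := √(localNormSq ε b c0 δT T v) with hR
  set H := Metric.diam T with hH
  set E1 := semi1 T u
  set E0 := norm0 T u
  set D1 := semi1 T v with hD1
  set D0 := norm0 T v with hD0
  set r := norm0 T (proj T ((k : ℤ) - 2) (wlap T u))
  set Bu := norm0 T (fun x => inner ℝ (b x) (wgrad T u x))
  set Bv := norm0 T (fun x => inner ℝ (b x) (wgrad T v x)) with hBv
  have e1 : 0 ≤ E1 := semi1_nonneg
  have e0 : 0 ≤ E0 := norm0_nonneg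
  have d1 : 0 ≤ D1 := semi1_nonneg
  have d0 : 0 ≤ D0 := norm0_nonneg
  have r0 : 0 ≤ r := norm0_nonneg
  have bu0 : 0 ≤ Bu := norm0_nonneg
  have bv0 : 0 ≤ Bv := norm0_nonneg
  have hR0 : 0 ≤ R := Real.sqrt_nonneg _
  have hZ0 : 0 ≤ Z := Real.sqrt_nonneg _
  set σ := √ε with hσ
  set σ0 := √c0 with hσ0
  set τ := √δT with hτ
  have σpos : 0 < σ := Real.sqrt_pos.2 hε
  have σ0pos : 0 < σ0 := Real.sqrt_pos.2 hc0
  have τpos : 0 < τ := Real.sqrt_pos.2 hδ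
  have σsq : σ ^ 2 = ε := Real.sq_sqrt hε.le
  have σ0sq : σ0 ^ 2 = c0 := Real.sq_sqrt hc0.le
  have τsq : τ ^ 2 = δT := Real.sq_sqrt hδ.le
  have p1 : 0 ≤ H ^ 2 / ε := by positivity
  have p2 : 0 ≤ δT ^ 2 * (H ^ 2 / ε) := by positivity
  have p3 : 0 ≤ H ^ 2 := by positivity
  -- The summands of `zeta` in use: `ε` for the diffusion, `δT` for `formGh`, `H ^ 2` for reaction
  -- and symmetric part, 1 and `H ^ 2 / ε` for the two halves of the skew part, `H ^ 2 / ε` again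
  -- for the Laplacian, and the last one for the reaction term against the streamline derivative.
  have z1 : σ ≤ Z := Real.le_sqrt_of_sq_le (by rw [σsq, zeta]; linarith)
  have z2 : τ ≤ Z := Real.le_sqrt_of_sq_le (by rw [τsq, zeta]; linarith)
  have z3 : H ≤ Z := Real.le_sqrt_of_sq_le (by rw [zeta]; linarith)
  have z4 : 1 ≤ Z := Real.le_sqrt_of_sq_le (by rw [zeta]; linarith)
  have z5 : H / σ ≤ Z := Real.le_sqrt_of_sq_le (by rw [div_pow, σsq, zeta]; linarith)
  have z6 : δT * (H / σ) ≤ Z :=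
    Real.le_sqrt_of_sq_le (by rw [mul_pow, div_pow, σsq, zeta]; linarith)
  have q1 : 0 ≤ ε * D1 ^ 2 := by positivity
  have q2 : 0 ≤ c0 * D0 ^ 2 := by positivity
  have q3 : 0 ≤ δT * Bv ^ 2 := by positivity
  have r1 : σ * D1 ≤ R := Real.le_sqrt_of_sq_le (by rw [mul_pow, σsq, localNormSq]; linarith)
  have r2 : σ0 * D0 ≤ R := Real.le_sqrt_of_sq_le (by rw [mul_pow, σ0sq, localNormSq]; linarith)
  have r3 : τ * Bv ≤ R := Real.le_sqrt_of_sq_le (by rw [mul_pow, τsq, localNormSq]; linarith)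
  have r1' : D1 ≤ R / σ := (le_div_iff₀' σpos).2 r1
  have r2' : D0 ≤ R / σ0 := (le_div_iff₀' σ0pos).2 r2
  have hQ : ∀ x, x ≤ Z → H ^ k * (x * M) * R ≤ H ^ k * (Z * M) * R := fun x hx => by gcongr
  set Q := H ^ k * (Z * M) * R with hQdef
  have s1 : K.αup * (ε * (E1 * D1)) ≤ K.αup * A1 * Q := by
    calc K.αup * (ε * (E1 * D1)) = K.αup * (σ * E1 * (σ * D1)) := by rw [← σsq]; ring
      _ ≤ K.αup * (Z * (A1 * H ^ k * M) * R) := by gcongr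
      _ = _ := by ring
  have s2 : ∀ κ, 0 ≤ κ → κ * (E0 * D0) ≤ κ * A0 / σ0 * Q := fun κ hκ => by
    calc κ * (E0 * D0) ≤ κ * (A0 * H ^ (k + 1) * M * (R / σ0)) := by gcongr
      _ = κ * A0 / σ0 * (H ^ k * (H * M) * R) := by ring
      _ ≤ _ := mul_le_mul_of_nonneg_left (hQ _ z3) (by positivity)
  have s3 : Cb * (E1 * D0) ≤ Cb * A1 / σ0 * Q := by
    calc Cb * (E1 * D0) ≤ Cb * (A1 * H ^ k * M * (R / σ0)) := by gcongr
      _ = Cb * A1 / σ0 * (H ^ k * (1 * M) * R) := by ring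
      _ ≤ _ := mul_le_mul_of_nonneg_left (hQ _ z4) (by positivity)
  have s4 : Cb * (D1 * E0) ≤ Cb * A0 * Q := by
    calc Cb * (D1 * E0) ≤ Cb * (R / σ * (A0 * H ^ (k + 1) * M)) := by gcongr
      _ = Cb * A0 * (H ^ k * (H / σ * M) * R) := by ring
      _ ≤ _ := mul_le_mul_of_nonneg_left (hQ _ z5) (by positivity)
  have s5 : K.Γup * (δT * (Bu * Bv)) ≤ K.Γup * Cb * A1 * Q := by
    calc K.Γup * (δT * (Bu * Bv)) = K.Γup * (τ * Bu * (τ * Bv)) := by rw [← τsq]; ring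
      _ ≤ K.Γup * (Z * (Cb * (A1 * H ^ k * M)) * R) := by
          gcongr
          exact hB1.trans (mul_le_mul_of_nonneg_left h1 hCb)
      _ = _ := by ring
  -- The control condition trades `ε * δT` for `H ^ 2`. One power of `H` pays for the inverse
  -- inequality, the other accompanies `D1 ≤ R / σ`.
  have s6 : ε * δT * Cb * (r * D1) ≤ K.αlo / (2 * μ1 ^ 2) * CI * Cb * A1 * Q := by
    have h2 : ε * δT ≤ K.αlo / (2 * μ1 ^ 2) * H ^ 2 := by
      rw [div_mul_eq_mul_div, le_div_iff₀ (by positivity)]; linarith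
    calc ε * δT * Cb * (r * D1) ≤ K.αlo / (2 * μ1 ^ 2) * H ^ 2 * Cb * (r * D1) := by gcongr
      _ = K.αlo / (2 * μ1 ^ 2) * Cb * ((r * H) * (H * D1)) := by ring
      _ ≤ K.αlo / (2 * μ1 ^ 2) * Cb * ((CI * (A1 * H ^ k * M)) * (H * (R / σ))) := by
          refine mul_le_mul_of_nonneg_left (mul_le_mul ?_ (by gcongr) (by positivity)
            (by positivity)) (by positivity)
          exact hI.trans (mul_le_mul_of_nonneg_left h1 hCI)
      _ = K.αlo / (2 * μ1 ^ 2) * CI * Cb * A1 * (H ^ k * (H / σ * M) * R) := by ring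
      _ ≤ _ := mul_le_mul_of_nonneg_left (hQ _ z5) (by positivity)
  have s7 : δT * Cc * Cb * (E0 * D1) ≤ Cc * Cb * A0 * Q := by
    calc δT * Cc * Cb * (E0 * D1) ≤ δT * Cc * Cb * (A0 * H ^ (k + 1) * M * (R / σ)) := by gcongr
      _ = Cc * Cb * A0 * (H ^ k * (δT * (H / σ) * M) * R) := by ring
      _ ≤ _ := mul_le_mul_of_nonneg_left (hQ _ z6) (by positivity)
  have s8 := s2 (3 * ((K.slo + K.sup) * Cd)) (by positivity)
  have s9 := s2 (3 * ((K.γlo + K.γup) * Cc)) (by positivity)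
  rw [localConst]
  linarith

end final

/-! ### Data bounds and summation over the elements -/

/-- Bounds for the data of the problem on a bounded set. -/
theorem exists_data_bounds {Ω : Set (E d)} (hΩ : Bornology.IsBounded Ω) {b : E d → E d}
    {c : E d → ℝ} (hb : ∃ U, IsOpen U ∧ closure Ω ⊆ U ∧ ContDiffOn ℝ 1 b U)
    (hc : ContinuousOn c (closure Ω)) :
    ContinuousOn b (closure Ω) ∧ ContinuousOn (divergence b) (closure Ω) ∧
    ∃ C, 0 ≤ C ∧ ∀ x ∈ closure Ω, ‖b x‖ ≤ C ∧ |divergence b x| ≤ C ∧ |c x| ≤ C := by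
  obtain ⟨U, hU, hsub, hbU⟩ := hb
  have hbc : ContinuousOn b (closure Ω) := hbU.continuousOn.mono hsub
  have hdc : ContinuousOn (divergence b) (closure Ω) := by
    have h1 : ContinuousOn (fderiv ℝ b) U := hbU.continuousOn_fderiv_of_isOpen hU le_rfl
    refine ContinuousOn.mono ?_ hsub
    refine continuousOn_finsetSum _ fun i _ => ?_
    exact (EuclideanSpace.proj (𝕜 := ℝ) i).continuous.comp_continuousOn
      (h1.clm_apply continuousOn_const)
  obtain ⟨C1, h1⟩ := hΩ.isCompact_closure.exists_bound_of_continuousOn hbc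
  obtain ⟨C2, h2⟩ := hΩ.isCompact_closure.exists_bound_of_continuousOn hdc
  obtain ⟨C3, h3⟩ := hΩ.isCompact_closure.exists_bound_of_continuousOn hc
  exact ⟨hbc, hdc, max 0 (max C1 (max C2 C3)), le_max_left _ _, fun x hx =>
    ⟨(h1 x hx).trans (by simp), (h2 x hx).trans (by simp), (h3 x hx).trans (by simp)⟩⟩

theorem Mesh.diam_le_size {Ω : Set (E d)} (M : Mesh Ω) {T : Set (E d)} (hT : T ∈ M.elems) :
    Metric.diam T ≤ M.size :=
  le_csSup (M.elems.finite_toSet.image _).bddAbove ⟨T, hT, rfl⟩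

/-- Replace each local size by the mesh size and apply the discrete Cauchy–Schwarz inequality. The
empty sum is separate because `0 ≤ h` is only known once there is an element. -/
theorem abs_sum_le_of_local {ι : Type*} (S : Finset ι) {f H z m r : ι → ℝ} {C h : ℝ} (k : ℕ)
    (hC : 0 ≤ C) (hH0 : ∀ i ∈ S, 0 ≤ H i) (hH : ∀ i ∈ S, H i ≤ h) (hz : ∀ i ∈ S, 0 ≤ z i)
    (hm : ∀ i ∈ S, 0 ≤ m i) (hr : ∀ i ∈ S, 0 ≤ r i)
    (hf : ∀ i ∈ S, |f i| ≤ C * (H i ^ k * (√(z i) * m i) * √(r i))) :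
    |∑ i ∈ S, f i| ≤ C * h ^ k * √(∑ i ∈ S, z i * m i ^ 2) * √(∑ i ∈ S, r i) := by
  rcases S.eq_empty_or_nonempty with rfl | ⟨j, hj⟩
  · simp
  have h0 : 0 ≤ h := (hH0 j hj).trans (hH j hj)
  calc |∑ i ∈ S, f i| ≤ ∑ i ∈ S, |f i| := Finset.abs_sum_le_sum_abs _ _
    _ ≤ ∑ i ∈ S, C * h ^ k * ((√(z i) * m i) * √(r i)) := by
        refine Finset.sum_le_sum fun i hi => (hf i hi).trans ?_
        have h1 := pow_le_pow_left₀ (hH0 i hi) (hH i hi) k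
        have h2 := hm i hi
        rw [mul_assoc C, mul_assoc (H i ^ k)]
        gcongr
    _ = C * h ^ k * ∑ i ∈ S, (√(z i) * m i) * √(r i) := by rw [Finset.mul_sum]
    _ ≤ C * h ^ k * (√(∑ i ∈ S, (√(z i) * m i) ^ 2) * √(∑ i ∈ S, √(r i) ^ 2)) := by
        gcongr
        exact Real.sum_mul_le_sqrt_mul_sqrt _ _ _
    _ = _ := by
        rw [Finset.sum_congr rfl fun i hi => show (√(z i) * m i) ^ 2 = z i * m i ^ 2 by
          rw [mul_pow, Real.sq_sqrt (hz i hi)],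
          Finset.sum_congr rfl fun i hi => Real.sq_sqrt (hr i hi), mul_assoc (C * h ^ k)]

end NCVEM

end

/-! ### The global estimate -/

theorem mainTheorem3 (d k : ℕ) (hd : d = 2 ∨ d = 3) (hk : 1 ≤ k) (ρ : ℝ) (hρ : 0 < ρ) :
    -- local polynomial approximations exist, with a constant depending on `d`, `k`, `ρ` only
    (∃ CP : ℝ, 0 < CP ∧
      ∀ (Ω : Set (NCVEM.E d)), NCVEM.IsPolytopalDomain Ω →
      ∀ M : NCVEM.Mesh Ω, M.ShapeRegular ρ →
      ∀ T ∈ M.elems, ∀ u : NCVEM.E d → ℝ, NCVEM.MemH (k + 1) T u →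
        ∃ p, NCVEM.IsLocalApprox k T CP u p) ∧
    -- the discrete bilinear form is bounded
    ∀ (Ω : Set (NCVEM.E d)), NCVEM.IsPolytopalDomain Ω →
    ∀ (b : NCVEM.E d → NCVEM.E d) (c : NCVEM.E d → ℝ) (c0 : ℝ),
      (∃ U, IsOpen U ∧ closure Ω ⊆ U ∧ ContDiffOn ℝ 1 b U) → ContinuousOn c (closure Ω) →
      0 < c0 → (∀ x ∈ Ω, c0 ≤ c x - 1 / 2 * NCVEM.divergence b x) →
    ∀ (K : NCVEM.StabConst) (μ1 μ2 cI CP : ℝ), 0 < μ1 → 0 < μ2 → 0 < cI → 0 < CP →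
    ∃ C : ℝ, 0 < C ∧
      ∀ (ε : ℝ), 0 < ε →
      ∀ M : NCVEM.Mesh Ω, M.ShapeRegular ρ →
      ∀ (δ : Set (NCVEM.E d) → ℝ) (s : Set (NCVEM.E d) → NCVEM.StabForms d),
        (∀ T ∈ M.elems, NCVEM.IsControl K Ω ε b c c0 μ1 μ2 cI T (δ T)) →
        (∀ T ∈ M.elems, NCVEM.IsStable K k ε b c (δ T) T (M.facesOf T) (s T)) →
      ∀ (u uI uh : NCVEM.E d → ℝ) (uPi : Set (NCVEM.E d) → NCVEM.E d → ℝ),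
        (∀ T ∈ M.elems, NCVEM.MemH (k + 1) T u) →
        NCVEM.IsInterpolant M k u uI →
        (∀ T ∈ M.elems, NCVEM.IsLocalApprox k T CP u (uPi T)) →
        NCVEM.MemV M k uh →
        |∑ T ∈ M.elems, NCVEM.formDisc k ε b c (δ T) T (s T)
            (fun x => uI x - uPi T x) (fun x => uh x - uI x)|
          ≤ C * M.size ^ k
            * √(∑ T ∈ M.elems, NCVEM.zeta ε (δ T) T * NCVEM.semiH (k + 1) T u ^ 2)
            * NCVEM.tripleNorm M ε b c0 δ (fun x => uh x - uI x) := by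
  have hd0 : 0 < d := by omega
  refine ⟨⟨NCVEM.poincareConst d ρ ^ (k + 1) + NCVEM.poincareConst d ρ ^ k, ?_, ?_⟩, ?_⟩
  · have := NCVEM.poincareConst_pos d hρ
    positivity
  · intro Ω hΩ M hM T hT u hu
    obtain ⟨x0, n, a, h⟩ := hM.isPolyBoundary hd0 hρ hΩ.2.2.1 hT
    exact h.star.exists_localApprox hd0 hρ hu
  intro Ω hΩ b c c0 hb hc hc0 _ K μ1 μ2 cI CP hμ1 _ _ hCP
  -- This inverse constant depends on `d`, `k`, `ρ` only and is unrelated to `μ1`, which enters the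
  -- final constant through the control condition.
  obtain ⟨CI, hCI, hinv⟩ := NCVEM.exists_inverse_inequality d ((k : ℤ) - 2) hρ
  obtain ⟨hbc, hdc, C, hC, hbd⟩ := NCVEM.exists_data_bounds hΩ.2.2.1 hb hc
  have hP := NCVEM.poincareConst_pos d hρ
  have hA0 : 0 ≤ (4 * NCVEM.poincareConst d ρ + 3) * CP := by positivity
  set Cl := NCVEM.localConst K c0 μ1 CP ((4 * NCVEM.poincareConst d ρ + 3) * CP) CI C C C with hCl
  have hClpos : 0 ≤ Cl := by
    have k1 := K.αup_pos
    have k2 := K.slo_pos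
    have k3 := K.sup_pos
    have k4 := K.γlo_pos
    have k5 := K.γup_pos
    have k6 := K.αlo_pos
    have k7 := K.Γup_pos
    rw [hCl, NCVEM.localConst]
    positivity
  -- `Cl` is only recorded as nonnegative; adding 1 makes the constant positive.
  refine ⟨Cl + 1, by positivity, fun ε hε M hM δ s hδ hS u uI uh uPi hu huI huPi huh => ?_⟩
  have hloc : ∀ T ∈ M.elems, |NCVEM.formDisc k ε b c (δ T) T (s T)
      (fun x => uI x - uPi T x) (fun x => uh x - uI x)| ≤
      (Cl + 1) * (Metric.diam T ^ k * (√(NCVEM.zeta ε (δ T) T) * NCVEM.semiH (k + 1) T u) *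
        √(NCVEM.localNormSq ε b c0 (δ T) T (fun x => uh x - uI x))) := by
    intro T hT
    obtain ⟨x0, n, a, h⟩ := hM.isPolyBoundary hd0 hρ hΩ.2.2.1 hT
    have hsub : T ⊆ closure Ω := (M.subset T hT).trans subset_closure
    have hIT := huI.1.2 T hT
    obtain ⟨e1, e0⟩ := NCVEM.interpolant_sub_localApprox_le hd0 hρ hk h (hu T hT) hIT
      (huI.2 T hT).1 (huI.2 T hT).2 (huPi T hT)
    have he : NCVEM.MemVLoc k T (M.facesOf T) (fun x => uI x - uPi T x) :=
      hIT.sub h (h.memVLoc_of_poly (huPi T hT).1)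
    have hδv : NCVEM.MemVLoc k T (M.facesOf T) (fun x => uh x - uI x) := (huh.2 T hT).sub h hIT
    obtain ⟨q, -, hr, -, hG⟩ := he.wlap h
    refine (NCVEM.formDisc_le h (NCVEM.diam_pos hd0 h.star.isOpen h.star.bounded h.star.nonempty)
      (hbc.mono hsub) hC (fun x hx => (hbd x (hsub hx)).1)
      (hdc.mono hsub) hC (fun x hx => (hbd x (hsub hx)).2.1)
      (hc.mono hsub) hC (fun x hx => (hbd x (hsub hx)).2.2)
      hε (hδ T hT).1 hc0 hμ1 (hδ T hT).2.2.1 (hS T hT) he hδv hCP.le hA0 hCI (NCVEM.semiH_nonneg _)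
      e1 e0 (hinv T x0 h.star _ _ he.1 hr fun w hw => hG.test h hw)).trans ?_
    refine mul_le_mul_of_nonneg_right (by linarith) ?_
    have h1 : 0 ≤ Metric.diam T := Metric.diam_nonneg
    have h2 : 0 ≤ NCVEM.semiH (k + 1) T u := NCVEM.semiH_nonneg _
    positivity
  refine NCVEM.abs_sum_le_of_local M.elems k
    (r := fun T => NCVEM.localNormSq ε b c0 (δ T) T (fun x => uh x - uI x)) (by positivity) (fun T _ => Metric.diam_nonneg)
    (fun T hT => M.diam_le_size hT) (fun T hT => ?_) (fun T _ => NCVEM.semiH_nonneg _) (fun T hT => ?_)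
    hloc
  · have := (hδ T hT).1
    simp only [NCVEM.zeta]; positivity
  · have := (hδ T hT).1
    simp only [NCVEM.localNormSq]; positivity
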